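/- **Setting.** Let $\mu$ be a probability measure on $\mathbb R$ with moments $s_n=\int x^n\,d\mu$ of every order, and let $(P_n)_{n\ge 0}$ be its orthonormal polynomials ($\deg P_n=n$, positive leading coefficients). Assume that the moment problem is symmetric and given by a sequence $(b_n)_{n\ge0}$ of positive numbers, i.e. $$xP_n(x)=b_nP_{n+1}(x)+b_{n-1}P_{n-1}(x),\qquad n\ge 0,\qquad P_{-1}:=0 .$$ Write $P_n(x)=\sum_{k=0}^n b_{k,n}x^k$ and put $$c_k=\Big(\sum_{n\ge k}b_{k,n}^2\Big)^{1/2}\in[0,\infty],\qquad U_n=\frac{s_{2n}}{b_0^2b_1^2\cdots b_{n-1}^2},\qquad V_n=b_0b_1\cdots b_{n-1}\,c_n\in[0,\infty].$$ The moment problem is indeterminate if some measure different from $\mu$ has the same moments; in that case all $c_k$ and $V_n$ are finite. It has property (cs*) if it is indeterminate and $\sum_{l=0}^\infty c_l|s_{l+m}|<\infty$ for all $m\ge 0$. Define $$u(\alpha)=\max_{2^{-1/\alpha}\le x\le 1}(x+1)\int_x^1\log\Big(\frac{y^\alpha}{1-y^\alpha}\Big)\frac{dy}{(1+y)^2}\quad(0<\alpha<\infty),\qquad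 u(0)=\infty,\ u(\infty)=0,$$ $$v(\alpha)=\int_1^\infty\log\big([1-x^{-\alpha}]^{-1}\big)\,dx\in[0,\infty]\quad(1\le\alpha<\infty),\qquad v(\infty)=0,$$ (so $v(1)=\infty$) and $$k(\alpha)=4^{-\alpha}\exp\big(2u(\alpha)+v(\alpha)\big)\quad(1<\alpha<\infty),\qquad k(\infty)=0 .$$ **Theorem 1.7.** Suppose that for some $n_0\ge 1$ $$\frac{b_{n-1}}{b_n}\le e^{-f(n)},\qquad n\ge n_0,$$ where $f(n)>0$ for $n\ge n_0$, and let $\alpha=\liminf_{n\to\infty} nf(n)\in[0,\infty]$. Then (with $e^{\infty}=\infty$): 1. $\limsup_{n\to\infty}U_n^{1/n}\le e^{2u(\alpha)}$ for $0\le\alpha\le\infty$; 2. if $\alpha>1$ the moment problem is indeterminate, and $\limsup_{n\to\infty}V_n^{1/n}\le e^{v(\alpha)/2}$ for $1\le\alpha\le\infty$; 3. if $\alpha>1$ and $k(\alpha)<1$, then property (cs*) holds; moreover $k(\alpha)<1$ whenever $\alpha\ge 1.68746$. -/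

import Mathlib

open Filter Topology MeasureTheory Polynomial
open scoped ENNReal

noncomputable section

namespace SymMoment

/-- All moments of `μ` exist. -/
def HasAllMoments (μ : Measure ℝ) : Prop :=
  ∀ n : ℕ, Integrable (fun x : ℝ => x ^ n) μ

/-- The moments `s_n = ∫ x ^ n dμ`. -/
def moment (μ : Measure ℝ) (n : ℕ) : ℝ := ∫ x, x ^ n ∂μ

/-- The moment problem of `μ` is indeterminate: some measure different from `μ` has the same
moments. -/
def Indeterminate (μ : Measure ℝ) : Prop :=
  ∃ ν : Measure ℝ, ν ≠ μ ∧ HasAllMoments ν ∧ ∀ n, moment ν n = moment μ n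

/-- `P` is the sequence of orthonormal polynomials of `μ`, with `deg P_n = n` and positive leading
coefficients (the Gram--Schmidt orthonormalization of the monomials in `L²(μ)`). -/
structure IsOrthonormalPoly (μ : Measure ℝ) (P : ℕ → ℝ[X]) : Prop where
  natDegree_eq : ∀ n, (P n).natDegree = n
  leadingCoeff_pos : ∀ n, 0 < (P n).leadingCoeff
  orthonormal : ∀ m n, ∫ x, (P m).eval x * (P n).eval x ∂μ = if m = n then 1 else 0

/-- A symmetric moment problem given in terms of `(b_n)`: `μ` is a probability measure with moments
of all orders, `P` is its sequence of orthonormal polynomials, and the three-term recurrence is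
`x P_n = b_n P_{n+1} + b_{n-1} P_{n-1}` (with `P_{-1} = 0`), where all `b_n > 0`.
The orthonormality forces the support of `μ` to be infinite. -/
structure IsSymmetricProblem (μ : Measure ℝ) (P : ℕ → ℝ[X]) (b : ℕ → ℝ) : Prop where
  prob : IsProbabilityMeasure μ
  moments : HasAllMoments μ
  ortho : IsOrthonormalPoly μ P
  b_pos : ∀ n, 0 < b n
  rec_zero : X * P 0 = C (b 0) * P 1
  rec_succ : ∀ n, X * P (n + 1) = C (b (n + 1)) * P (n + 2) + C (b n) * P n

/-- `c_k = (∑_{n ≥ k} b_{k,n} ^ 2) ^ (1/2)`, where `b_{k,n}` is the coefficient of `x ^ k` in `P_n`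
(it vanishes for `n < k`). The value lies in `[0, ∞]`; it is finite in the indeterminate case. -/
def c (P : ℕ → ℝ[X]) (k : ℕ) : ℝ≥0∞ :=
  (∑' n, ENNReal.ofReal ((P n).coeff k ^ 2)) ^ (1 / 2 : ℝ)

/-- `U_n = s_{2n} / (b_0 ⋯ b_{n-1}) ^ 2`. -/
def U (μ : Measure ℝ) (b : ℕ → ℝ) (n : ℕ) : ℝ :=
  moment μ (2 * n) / (∏ i ∈ Finset.range n, b i) ^ 2

/-- `V_n = b_0 ⋯ b_{n-1} c_n`. -/
def V (P : ℕ → ℝ[X]) (b : ℕ → ℝ) (n : ℕ) : ℝ≥0∞ :=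
  ENNReal.ofReal (∏ i ∈ Finset.range n, b i) * c P n

/-- Property (cs*): the moment problem is indeterminate and `∑_l c_l |s_{l+m}| < ∞` for every
`m ≥ 0`. -/
def PropertyCSStar (μ : Measure ℝ) (P : ℕ → ℝ[X]) : Prop :=
  Indeterminate μ ∧
    ∀ m : ℕ, ∑' l, c P l * ENNReal.ofReal |moment μ (l + m)| < ⊤

/-- The function
`u(α) = max_{2^{-1/α} ≤ x ≤ 1} (x + 1) ∫_x^1 log (y^α / (1 - y^α)) dy / (1 + y)^2` for real
`α > 0`; the maximum of a continuous function on a compact interval, written as a supremum. -/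
def uReal (α : ℝ) : ℝ :=
  sSup ((fun x : ℝ =>
    (x + 1) * ∫ y in x..1, Real.log (y ^ α / (1 - y ^ α)) / (1 + y) ^ 2) ''
      Set.Icc ((2 : ℝ) ^ (-1 / α)) 1)

/-- The function `u` on `[0, ∞]`, with the limiting values `u(0) = ∞` and `u(∞) = 0`. -/
def u (α : EReal) : EReal :=
  if α = ⊤ then 0 else if α ≤ 0 then ⊤ else (uReal α.toReal : EReal)

/-- The function `v(α) = ∫_1^∞ log ([1 - x^{-α}]^{-1}) dx` (the integrand is nonnegative), with
values in `[0, ∞]`, for real `α ≥ 1`. The integral is infinite for `α = 1`. -/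
def vReal (α : ℝ) : ℝ≥0∞ :=
  ∫⁻ x in Set.Ioi (1 : ℝ), ENNReal.ofReal (Real.log (1 - x ^ (-α))⁻¹)

/-- The function `v` on `[1, ∞]`, with `v(∞) = 0`. -/
def v (α : EReal) : EReal :=
  if α = ⊤ then 0 else (vReal α.toReal : EReal)

/-- The function `k(α) = 4^{-α} exp (2 u(α) + v(α))` for `1 < α < ∞`, and `k(∞) = 0`. -/
def k (α : EReal) : ℝ≥0∞ :=
  if α = ⊤ then 0
  else ENNReal.ofReal ((4 : ℝ) ^ (-α.toReal)) * EReal.exp (2 * u α + v α)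

end SymMoment

end

/-!
Fix `a` below the lower limit of `n f(n)`. The ratio condition telescopes to *power growth*:
`b_m / b_n ≤ ((m + K) / (n + K)) ^ a` for `m ≤ n` and some shift `K` (`exists_powerGrowth`). All the
estimates are made for such a fixed `a`, and `a` tends to the lower limit at the end.

**Both sequences satisfy the same kind of recurrence.** Let `a_{n,k}` be the coefficients of `x ^ n`
with respect to the orthonormal polynomials (`monoCoeff`), so that `s_{2n} = ∑_k a_{n,k} ^ 2`. After
division by `b_0 ⋯ b_{n-1}`, the recurrence of the `a_{n,k}` has ratios `b_m / b_n` as coefficients,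
and so has the recurrence of the coefficients `b_{k,n}` of `P_n` after multiplication by
`b_0 ⋯ b_{k-1}`. In suitable indices both read `g N (j+1) ≤ q N j * g (N-1) (j+1) + p N j * g N j`
with `p`, `q` increasing in `N`, and then `g N j` is at most a constant times
`∏_{i<j} p N i / (1 - q N i)` (`exists_le_mul_prod`).

* For `U_n` this is a product of odds `q / (1 - q)` with `q = y_i ^ a`, where the points `y_i` are
  equally spaced for the measure `dy / (1 + y) ^ 2`. Its logarithm is a Riemann sum of the integral
  in the definition of `u`, and maximizing over `k` gives `u(a)` (`exists_U_le`).
* For `V_n` this is `∏ 1 / (1 - q)` times a factor that makes the squares summable as `a > 1`.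
  Expanding the logarithms in powers and comparing sums with integrals gives `v(a)`, in the form
  `∑_m 1 / (m (m a - 1))` (`vReal_eq_tsum`, `exists_V_le`).

**Indeterminacy.** The bound for the `c_k` makes `∑ P_n(x) ^ 2` convergent for small real `x`. For
each such `x`, Gauss-type quadratures with a node at `x` (spectral measures of modified finite
Jacobi matrices) have mass at least `1 / ∑ P_n(x) ^ 2` at `x`, and by Prokhorov's theorem they
accumulate at a measure with the moments of `μ` and an atom at `x`. A single measure cannot have an
atom at every point of an interval, so the measures with the moments of `μ` are not all equal
(`indeterminate_of_summable`).

**Property (cs\*).** With `l = 2 d + m` and `n = d + m`, the summand `c_l s_{l+m}` is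
`V_l U_n (b_0 ⋯ b_{n-1}) ^ 2 / (b_0 ⋯ b_{l-1})`, and power growth bounds the last quotient by
`4 ^ (-a d)` up to subexponential factors. So the series converges once
`e ^ (2 u(a) + v(a)) < 4 ^ a` (`propertyCSStar`).

**The numerical bound.** `2 u(a) + v(a) - a log 4` is about `-3 · 10 ^ (-5)` at `a = 1.68746`. The
maximum defining `u` is bounded by a one-sided integral inequality (`uReal_le_of_majorant`), which
is verified with an explicit polynomial primitive; `v` is bounded by thirty terms of its series and
a telescoping majorant of the rest.
-/

namespace SymMoment

/-! ### Growth of the recurrence coefficients -/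

/-- The coefficients `b` grow at least like the power `n ^ a`, up to a shift `K` of the indices:
`b m / b n ≤ ((m + K) / (n + K)) ^ a` for all `m ≤ n` with `n ≥ K`. The shift absorbs the finitely
many small indices at which nothing is assumed about `b`. -/
def PowerGrowth (b : ℕ → ℝ) (a : ℝ) (K : ℕ) : Prop :=
  ∀ n, K ≤ n → ∀ m, m ≤ n → b m / b n ≤ (((m : ℝ) + K) / (n + K)) ^ a

lemma exp_neg_div_le_rpow {a x : ℝ} (ha : 0 < a) (hx : 0 < x) :
    Real.exp (-(a / x)) ≤ (x / (x + 1)) ^ a := by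
  have hy : 0 < x / (x + 1) := by positivity
  rw [Real.rpow_def_of_pos hy, Real.exp_le_exp]
  have h := Real.one_sub_inv_le_log_of_pos hy
  have e : 1 - (x / (x + 1))⁻¹ = -(1 / x) := by field_simp; ring
  rw [e] at h
  calc -(a / x) = -(1 / x) * a := by ring
    _ ≤ _ := by gcongr

lemma div_le_rpow_of_ratio {b : ℕ → ℝ} (hb : ∀ n, 0 < b n) {a : ℝ} (ha : 0 < a) {n₁ : ℕ}
    (h : ∀ n, n₁ ≤ n → b (n - 1) / b n ≤ Real.exp (-(a / n))) {m : ℕ} (hm : n₁ ≤ m) (d : ℕ) :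
    b m / b (m + d) ≤ (((m : ℝ) + 1) / (m + d + 1)) ^ a := by
  induction d with
  | zero =>
    have : ((m : ℝ) + 1) ≠ 0 := by positivity
    simp [div_self this, div_self (hb m).ne']
  | succ d ih =>
    have e : b m / b (m + (d + 1)) = b m / b (m + d) * (b (m + d) / b (m + (d + 1))) := by
      have := (hb (m + d)).ne'
      field_simp
    have h1 := h (m + (d + 1)) (by omega)
    have e1 : m + (d + 1) - 1 = m + d := by omega
    rw [e1] at h1
    have h2 := exp_neg_div_le_rpow (x := (m : ℝ) + d + 1) ha (by positivity)
    push_cast at h1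
    rw [show (m : ℝ) + ((d : ℝ) + 1) = m + d + 1 by ring] at h1
    rw [e]
    calc _ ≤ (((m : ℝ) + 1) / (m + d + 1)) ^ a * (((m : ℝ) + d + 1) / (m + d + 1 + 1)) ^ a := by
          have := (hb (m + (d + 1)))
          have := (hb (m + d))
          gcongr
          exact h1.trans h2
      _ = _ := by
          rw [← Real.mul_rpow (by positivity) (by positivity)]
          congr 1
          push_cast
          field_simp
          ring

lemma exists_powerGrowth {b : ℕ → ℝ} (hb : ∀ n, 0 < b n) {a : ℝ} (ha : 0 < a) {n₁ : ℕ}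
    (h : ∀ n, n₁ ≤ n → b (n - 1) / b n ≤ Real.exp (-(a / n))) :
    ∃ K, 2 ≤ K ∧ PowerGrowth b a K := by
  set C : ℝ := 1 + ∑ m ∈ Finset.range n₁, b m / b n₁ with hC
  have hsum : 0 ≤ ∑ m ∈ Finset.range n₁, b m / b n₁ :=
    Finset.sum_nonneg fun i _ => (div_pos (hb i) (hb n₁)).le
  have hC1 : 0 < C := by linarith
  obtain ⟨K₀, hK₀⟩ := exists_nat_ge (2 * (C ^ (1 / a) * (n₁ + 1)))
  refine ⟨K₀ + n₁ + 2, by omega, fun n hn m hmn => ?_⟩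
  set K : ℕ := K₀ + n₁ + 2 with hK
  have hKpos : (0 : ℝ) < K := by rw [hK]; positivity
  have hnK : (K : ℝ) ≤ n := by exact_mod_cast hn
  rcases le_or_gt n₁ m with hm | hm
  · obtain ⟨d, rfl⟩ := Nat.exists_eq_add_of_le hmn
    refine (div_le_rpow_of_ratio hb ha h hm d).trans ?_
    apply Real.rpow_le_rpow (by positivity) _ ha.le
    rw [div_le_div_iff₀ (by positivity) (by positivity)]
    have : (1 : ℝ) ≤ K := by exact_mod_cast (by omega : 1 ≤ K)
    push_cast
    nlinarith [Nat.cast_nonneg (α := ℝ) d]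
  · obtain ⟨d, rfl⟩ := Nat.exists_eq_add_of_le (show n₁ ≤ n by omega)
    have h1 := div_le_rpow_of_ratio hb ha h le_rfl d
    have h2 : b m / b n₁ ≤ C := by
      have := Finset.single_le_sum (f := fun m => b m / b n₁)
        (fun i _ => (div_pos (hb i) (hb n₁)).le) (Finset.mem_range.2 hm)
      linarith
    have e : b m / b (n₁ + d) = b m / b n₁ * (b n₁ / b (n₁ + d)) := by
      have := (hb n₁).ne'
      field_simp
    have hCa : C = (C ^ (1 / a)) ^ a := by
      rw [← Real.rpow_mul hC1.le, one_div, inv_mul_cancel₀ ha.ne', Real.rpow_one]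
    rw [e]
    calc _ ≤ C * (((n₁ : ℝ) + 1) / (n₁ + d + 1)) ^ a := by
          have := (hb n₁)
          have := (hb (n₁ + d))
          gcongr
      _ = (C ^ (1 / a) * (((n₁ : ℝ) + 1) / (n₁ + d + 1))) ^ a := by
          rw [Real.mul_rpow (by positivity) (by positivity), ← hCa]
      _ ≤ _ := by
          apply Real.rpow_le_rpow (by positivity) _ ha.le
          rw [← mul_div_assoc, div_le_div_iff₀ (by positivity) (by positivity)]
          have hKK : 2 * (C ^ (1 / a) * (n₁ + 1)) ≤ K := by
            rw [hK]; push_cast; linarith [Nat.cast_nonneg (α := ℝ) n₁]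
          push_cast at hnK ⊢
          have h0 : 0 ≤ C ^ (1 / a) * ((n₁ : ℝ) + 1) := by positivity
          have hm0 : (0 : ℝ) ≤ m := Nat.cast_nonneg _
          nlinarith [mul_nonneg hm0 (Nat.cast_nonneg (α := ℝ) d),
            mul_nonneg hm0 (Nat.cast_nonneg (α := ℝ) n₁)]

/-! ### A majorant for two-index recurrences -/

/-- If `g N (j + 1) ≤ q N j * g (N - 1) (j + 1) + p N j * g N j` with coefficients that increase
with `N`, then `g N j` is at most a constant times `∏_{i < j} p N i / (1 - q N i)`: that product
increases with `N`, so replacing `g (N - 1) (j + 1)` by its bound at `N` turns the recurrence into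
`(1 - q N j) g N (j + 1) ≤ p N j g N j`. The constant `D` accounts for the finitely many pairs
`(N, j)` at which the recurrence is not assumed. The predicate `R` describes the region where the
recurrence lives; outside of it, `g` vanishes. -/
lemma exists_le_mul_prod {g q p : ℕ → ℕ → ℝ} {R : ℕ → ℕ → Prop} {K : ℕ}
    (hR : ∀ N i j, i ≤ j → R N j → R N i)
    (hg0 : ∀ N, g N 0 ≤ 1)
    (hgR : ∀ N j, ¬ R N j → g N (j + 1) ≤ 0)
    (hq0 : ∀ N j, R N j → 0 ≤ q N j) (hq1 : ∀ N j, R N j → q N j < 1)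
    (hp : ∀ N j, R N j → 0 < p N j)
    (hRs : ∀ N j, R N j → R (N + 1) j)
    (hqm : ∀ N j, R N j → q N j ≤ q (N + 1) j)
    (hpm : ∀ N j, R N j → p N j ≤ p (N + 1) j)
    (step0 : ∀ j, R 0 j → K ≤ j → g 0 (j + 1) ≤ p 0 j * g 0 j)
    (step : ∀ N j, R (N + 1) j → K ≤ N + j →
      g (N + 1) (j + 1) ≤ q (N + 1) j * g N (j + 1) + p (N + 1) j * g (N + 1) j) :
    ∃ D : ℝ, 1 ≤ D ∧ ∀ N j, (∀ i < j, R N i) →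
      g N j ≤ D * ∏ i ∈ Finset.range j, p N i / (1 - q N i) := by
  set M : ℕ → ℕ → ℝ := fun N j => ∏ i ∈ Finset.range j, p N i / (1 - q N i) with hM
  have hMpos : ∀ N j, (∀ i < j, R N i) → 0 < M N j := fun N j hj =>
    Finset.prod_pos fun i hi => by
      have hi := hj i (Finset.mem_range.1 hi)
      exact div_pos (hp _ _ hi) (by linarith [hq1 _ _ hi])
  set D : ℝ := 1 + ∑ N ∈ Finset.range (K + 2), ∑ j ∈ Finset.range (K + 2), |g N j / M N j| with hD
  have hD1 : 1 ≤ D := by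
    have : 0 ≤ ∑ N ∈ Finset.range (K + 2), ∑ j ∈ Finset.range (K + 2), |g N j / M N j| :=
      Finset.sum_nonneg fun _ _ => Finset.sum_nonneg fun _ _ => abs_nonneg _
    linarith
  have hsmall : ∀ N j, N < K + 2 → j < K + 2 → (∀ i < j, R N i) → g N j ≤ D * M N j := by
    intro N j hN hj hi
    rw [← div_le_iff₀ (hMpos N j hi)]
    have h1 := Finset.single_le_sum (f := fun j => |g N j / M N j|)
      (fun i _ => abs_nonneg _) (Finset.mem_range.2 hj)
    have h2 := Finset.single_le_sum
      (f := fun N => ∑ j ∈ Finset.range (K + 2), |g N j / M N j|)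
      (fun i _ => Finset.sum_nonneg fun _ _ => abs_nonneg _) (Finset.mem_range.2 hN)
    linarith [le_abs_self (g N j / M N j)]
  refine ⟨D, hD1, fun N j => ?_⟩
  induction j generalizing N with
  | zero => intro _; simpa using (hg0 N).trans hD1
  | succ j ihj =>
    induction N with
    | zero =>
      intro hi
      have hRj := hi j (by omega)
      rcases lt_or_ge j K with hjK | hjK
      · exact hsmall 0 (j + 1) (by omega) (by omega) hi
      have hpos := hMpos 0 j fun i hij => hi i (by omega)
      have h1 := ihj 0 fun i hij => hi i (by omega)
      have hp0 := hp 0 j hRj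
      calc g 0 (j + 1) ≤ p 0 j * g 0 j := step0 j hRj hjK
        _ ≤ p 0 j * (D * M 0 j) := by gcongr
        _ ≤ p 0 j / (1 - q 0 j) * (D * M 0 j) := by
          have := hq0 0 j hRj
          have h2 := hq1 0 j hRj
          gcongr
          rw [le_div_iff₀ (by linarith)]
          nlinarith
        _ = D * M 0 (j + 1) := by simp only [hM, Finset.prod_range_succ]; ring
    | succ N ihN =>
      intro hi
      have hRj := hi j (by omega)
      rcases lt_or_ge (N + j) K with hjK | hjK
      · exact hsmall (N + 1) (j + 1) (by omega) (by omega) hi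
      have hpj := hp (N + 1) j hRj
      have hqj := hq0 (N + 1) j hRj
      have hqj1 := hq1 (N + 1) j hRj
      have hpos := hMpos (N + 1) (j + 1) hi
      have e : M (N + 1) (j + 1) = M (N + 1) j * (p (N + 1) j / (1 - q (N + 1) j)) := by
        simp only [hM, Finset.prod_range_succ]
      have h2 := ihj (N + 1) fun i hij => hi i (by omega)
      have h1 : g N (j + 1) ≤ D * M (N + 1) (j + 1) := by
        by_cases hN : R N j
        · have hN' : ∀ i < j + 1, R N i := fun i hij => hR N i j (by omega) hN
          refine (ihN hN').trans ?_
          gcongr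
          refine Finset.prod_le_prod (fun i hi => ?_) fun i hi => ?_
          · have hi := hN' i (Finset.mem_range.1 hi)
            exact div_nonneg (hp _ _ hi).le (by linarith [hq1 _ _ hi])
          · have hi := hN' i (Finset.mem_range.1 hi)
            have := (hp _ _ (hRs _ _ hi))
            have := hq1 _ _ (hRs _ _ hi)
            have := hqm _ _ hi
            exact div_le_div₀ (by linarith) (hpm _ _ hi) (by linarith) (by linarith)
        · exact (hgR N j hN).trans (by positivity)
      calc g (N + 1) (j + 1) ≤ q (N + 1) j * g N (j + 1) + p (N + 1) j * g (N + 1) j :=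
            step N j hRj hjK
        _ ≤ q (N + 1) j * (D * M (N + 1) (j + 1)) + p (N + 1) j * (D * M (N + 1) j) := by
            gcongr
        _ = D * M (N + 1) (j + 1) := by
            have : 1 - q (N + 1) j ≠ 0 := by linarith
            rw [e]; field_simp; ring

/-! ### Expanding monomials in the orthonormal polynomials -/

/-- The coefficient `a_{n,k}` of `P_k` in the expansion `x ^ n = ∑_k a_{n,k} P_k`, defined by the
recurrence `a_{n+1,k} = b_{k-1} a_{n,k-1} + b_k a_{n,k+1}` that multiplication by `x` imposes. -/
def monoCoeff (b : ℕ → ℝ) : ℕ → ℕ → ℝ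
  | 0, k => if k = 0 then 1 else 0
  | n + 1, 0 => b 0 * monoCoeff b n 1
  | n + 1, k + 1 => b k * monoCoeff b n k + b (k + 1) * monoCoeff b n (k + 2)

lemma monoCoeff_eq_zero_of_lt (b : ℕ → ℝ) {n k : ℕ} (h : n < k) : monoCoeff b n k = 0 := by
  induction n generalizing k with
  | zero => simp only [monoCoeff, if_neg (by omega : ¬ k = 0)]
  | succ n ih =>
    cases k with
    | zero => omega
    | succ k => rw [monoCoeff, ih (by omega), ih (by omega)]; simp

lemma monoCoeff_eq_zero_of_odd (b : ℕ → ℝ) {n k : ℕ} (h : (n + k) % 2 = 1) :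
    monoCoeff b n k = 0 := by
  induction n generalizing k with
  | zero => simp only [monoCoeff, if_neg (by omega : ¬ k = 0)]
  | succ n ih =>
    cases k with
    | zero => rw [monoCoeff, ih (by omega)]; simp
    | succ k => rw [monoCoeff, ih (by omega), ih (by omega)]; simp

lemma monoCoeff_nonneg {b : ℕ → ℝ} (hb : ∀ n, 0 < b n) (n k : ℕ) : 0 ≤ monoCoeff b n k := by
  induction n generalizing k with
  | zero => rw [monoCoeff]; positivity
  | succ n ih =>
    cases k with
    | zero => exact mul_nonneg (hb 0).le (ih 1)
    | succ k => exact add_nonneg (mul_nonneg (hb _).le (ih _)) (mul_nonneg (hb _).le (ih _))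

lemma monoCoeff_self (b : ℕ → ℝ) (n : ℕ) : monoCoeff b n n = ∏ i ∈ Finset.range n, b i := by
  induction n with
  | zero => simp [monoCoeff]
  | succ n ih =>
    rw [monoCoeff, ih, monoCoeff_eq_zero_of_lt b (by omega : n < n + 2), Finset.prod_range_succ]
    ring

lemma pow_mul_eq_sum_monoCoeff {b p : ℕ → ℝ} {x : ℝ} (h0 : x * p 0 = b 0 * p 1)
    (h1 : ∀ k, x * p (k + 1) = b (k + 1) * p (k + 2) + b k * p k) (n : ℕ) :
    x ^ n * p 0 = ∑ k ∈ Finset.range (n + 1), monoCoeff b n k * p k := by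
  induction n with
  | zero => simp [monoCoeff]
  | succ n ih =>
    have e1 : x * ∑ k ∈ Finset.range (n + 1), monoCoeff b n k * p k
        = ∑ k ∈ Finset.range (n + 1), b k * monoCoeff b n k * p (k + 1)
          + ∑ k ∈ Finset.range n, b k * monoCoeff b n (k + 1) * p k := by
      rw [Finset.sum_range_succ', Finset.sum_range_succ' (n := n), mul_add, Finset.mul_sum]
      have : ∀ k ∈ Finset.range n, x * (monoCoeff b n (k + 1) * p (k + 1))
          = b (k + 1) * monoCoeff b n (k + 1) * p (k + 1 + 1)
            + b k * monoCoeff b n (k + 1) * p k := fun k _ => by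
        linear_combination monoCoeff b n (k + 1) * h1 k
      rw [Finset.sum_congr rfl this, Finset.sum_add_distrib]
      linear_combination monoCoeff b n 0 * h0
    have e2 : ∑ k ∈ Finset.range (n + 2), b k * monoCoeff b n (k + 1) * p k
        = ∑ k ∈ Finset.range n, b k * monoCoeff b n (k + 1) * p k := by
      rw [Finset.sum_range_succ, Finset.sum_range_succ,
        monoCoeff_eq_zero_of_lt b (by omega : n < n + 1),
        monoCoeff_eq_zero_of_lt b (by omega : n < n + 1 + 1)]
      ring
    have e3 : ∑ k ∈ Finset.range (n + 1 + 1), monoCoeff b (n + 1) k * p k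
        = ∑ k ∈ Finset.range (n + 1), b k * monoCoeff b n k * p (k + 1)
          + ∑ k ∈ Finset.range (n + 2), b k * monoCoeff b n (k + 1) * p k := by
      rw [Finset.sum_range_succ', Finset.sum_range_succ' (n := n + 1), ← add_assoc,
        ← Finset.sum_add_distrib]
      congr 1
      refine Finset.sum_congr rfl fun k _ => ?_
      rw [monoCoeff]
      ring
    rw [e3, e2, ← e1, ← ih]
    ring

section Problem

variable {μ : Measure ℝ} {P : ℕ → ℝ[X]} {b : ℕ → ℝ}

lemma HasAllMoments.integrable_eval (h : HasAllMoments μ) (p : ℝ[X]) :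
    Integrable (fun x => p.eval x) μ := by
  induction p using Polynomial.induction_on' with
  | add p q hp hq => simp only [eval_add]; exact hp.add hq
  | monomial n a => simpa using (h n).const_mul a

lemma IsSymmetricProblem.P_zero (h : IsSymmetricProblem μ P b) : P 0 = 1 := by
  have := h.prob
  have hd := h.ortho.natDegree_eq 0
  obtain ⟨c, hc⟩ := Polynomial.natDegree_eq_zero.1 hd
  have hpos := h.ortho.leadingCoeff_pos 0
  have ho := h.ortho.orthonormal 0 0
  rw [← hc] at hpos ho ⊢
  simp at hpos ho
  have : c = 1 := by nlinarith
  rw [this, C_1]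

lemma IsSymmetricProblem.eval_rec_zero (h : IsSymmetricProblem μ P b) (x : ℝ) :
    x * (P 0).eval x = b 0 * (P 1).eval x := by
  simpa using congrArg (eval x) h.rec_zero

lemma IsSymmetricProblem.eval_rec_succ (h : IsSymmetricProblem μ P b) (x : ℝ) (k : ℕ) :
    x * (P (k + 1)).eval x = b (k + 1) * (P (k + 2)).eval x + b k * (P k).eval x := by
  simpa using congrArg (eval x) (h.rec_succ k)

lemma IsSymmetricProblem.pow_eq_sum (h : IsSymmetricProblem μ P b) (x : ℝ) (n : ℕ) :
    x ^ n = ∑ k ∈ Finset.range (n + 1), monoCoeff b n k * (P k).eval x := by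
  have := pow_mul_eq_sum_monoCoeff (p := fun k => (P k).eval x) (h.eval_rec_zero x)
    (h.eval_rec_succ x) n
  simpa [h.P_zero] using this

lemma IsSymmetricProblem.moment_add (h : IsSymmetricProblem μ P b) (m n : ℕ) :
    moment μ (m + n) = ∑ k ∈ Finset.range (m + 1), monoCoeff b m k * monoCoeff b n k := by
  have e : ∀ x : ℝ, x ^ (m + n) = ∑ i ∈ Finset.range (m + 1), ∑ j ∈ Finset.range (n + 1),
      monoCoeff b m i * monoCoeff b n j * ((P i).eval x * (P j).eval x) := fun x => by
    rw [pow_add, h.pow_eq_sum x m, h.pow_eq_sum x n, Finset.sum_mul_sum]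
    refine Finset.sum_congr rfl fun i _ => Finset.sum_congr rfl fun j _ => by ring
  have hint : ∀ i j, Integrable (fun x => (P i).eval x * (P j).eval x) μ := fun i j => by
    simpa using h.moments.integrable_eval (P i * P j)
  unfold moment
  simp_rw [e]
  rw [integral_finsetSum _ fun i _ => integrable_finsetSum _ fun j _ => (hint i j).const_mul _]
  refine Finset.sum_congr rfl fun i hi => ?_
  rw [integral_finsetSum _ fun j _ => (hint i j).const_mul _]
  simp_rw [integral_const_mul, h.ortho.orthonormal]
  simp only [mul_ite, mul_one, mul_zero, Finset.sum_ite_eq, Finset.mem_range]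
  split_ifs with hin
  · rfl
  · rw [monoCoeff_eq_zero_of_lt b (by omega : n < i), mul_zero]

lemma IsSymmetricProblem.moment_odd (h : IsSymmetricProblem μ P b) (n : ℕ) :
    moment μ (2 * n + 1) = 0 := by
  rw [show 2 * n + 1 = n + (n + 1) by ring, h.moment_add]
  refine Finset.sum_eq_zero fun k _ => ?_
  rcases Nat.mod_two_eq_zero_or_one (n + k) with h0 | h1
  · rw [monoCoeff_eq_zero_of_odd b (by omega : (n + 1 + k) % 2 = 1), mul_zero]
  · rw [monoCoeff_eq_zero_of_odd b h1, zero_mul]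

/-! ### Bounds for the coefficients -/

/-- The normalized coefficients `a_{N+j,N-j} / (b_0 ⋯ b_{N+j-1})` are governed by the number `N` of
up-steps and the number `j` of down-steps of the lattice paths that they count. -/
lemma exists_monoCoeff_le (hb : ∀ n, 0 < b n) {a : ℝ} (ha : 0 < a) {K : ℕ} (hK : 2 ≤ K)
    (hg : PowerGrowth b a K) :
    ∃ D : ℝ, 1 ≤ D ∧ ∀ N j, j ≤ N → monoCoeff b (N + j) (N - j) ≤
      (∏ i ∈ Finset.range (N + j), b i) * (D * ∏ i ∈ Finset.range j,
        (((N : ℝ) + K - (i + 1)) / (N + K + i)) ^ a /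
          (1 - (((N : ℝ) + K - (i + 1)) / (N + K + i)) ^ a)) := by
  have hBpos : ∀ n, 0 < ∏ i ∈ Finset.range n, b i := fun n => Finset.prod_pos fun i _ => hb i
  have hK' : (2 : ℝ) ≤ K := by exact_mod_cast hK
  set q : ℕ → ℕ → ℝ := fun N i => (((N : ℝ) + K - (i + 1)) / (N + K + i)) ^ a with hq
  have hlt : ∀ {N i : ℕ}, i < N → (i : ℝ) + 1 ≤ N := fun h => by exact_mod_cast h
  have hq0 : ∀ N i, i < N → 0 < q N i := fun N i hi => by
    have := hlt hi
    exact Real.rpow_pos_of_pos (div_pos (by linarith) (by positivity)) a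
  set g : ℕ → ℕ → ℝ := fun N j =>
    if j ≤ N then monoCoeff b (N + j) (N - j) / ∏ i ∈ Finset.range (N + j), b i else 0 with hgdef
  -- The two ratios of recurrence coefficients are both at most `q`.
  have hratio : ∀ N j m, m + j + 1 ≤ N → K ≤ N + j → b m / b (N + j) ≤ q N j := by
    intro N j m hm hKN
    refine (hg (N + j) hKN m (by omega)).trans ?_
    have h1 : (m : ℝ) + j + 1 ≤ N := by exact_mod_cast hm
    refine Real.rpow_le_rpow (by positivity) ?_ ha.le
    push_cast
    rw [show (N : ℝ) + j + K = N + K + j by ring]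
    gcongr
    linarith
  obtain ⟨D, hD, h⟩ := exists_le_mul_prod (g := g) (q := q) (p := q) (R := fun N j => j < N)
    (K := K) (fun N i j hij hj => lt_of_le_of_lt hij hj)
    (fun N => by simp [hgdef, monoCoeff_self, div_self (hBpos N).ne'])
    (fun N j hj => by simp only [hgdef]; rw [if_neg (by omega)])
    (fun N j hj => (hq0 N j hj).le)
    (fun N j hj => by
      have := hlt hj
      refine Real.rpow_lt_one (div_nonneg (by linarith) (by positivity)) ?_ ha
      rw [div_lt_one (by positivity)]; linarith [Nat.cast_nonneg (α := ℝ) j])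
    hq0 (fun N j hj => by omega)
    (fun N j hj => by
      have := hlt hj
      refine Real.rpow_le_rpow (div_nonneg (by linarith) (by positivity)) ?_ ha.le
      rw [div_le_div_iff₀ (by positivity) (by positivity)]
      push_cast
      nlinarith [Nat.cast_nonneg (α := ℝ) j])
    (fun N j hj => by
      have := hlt hj
      refine Real.rpow_le_rpow (div_nonneg (by linarith) (by positivity)) ?_ ha.le
      rw [div_le_div_iff₀ (by positivity) (by positivity)]
      push_cast
      nlinarith [Nat.cast_nonneg (α := ℝ) j])
    (fun j hj => by omega)
    (fun N j hj hKN => by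
      have hB := (hBpos (N + 1 + j)).ne'
      have hbn := (hb (N + 1 + j)).ne'
      have e0 : g (N + 1) (j + 1) = monoCoeff b (N + 1 + j + 1) (N - j) /
          ((∏ i ∈ Finset.range (N + 1 + j), b i) * b (N + 1 + j)) := by
        simp only [hgdef]
        rw [if_pos (by omega), ← add_assoc, Finset.prod_range_succ,
          show N + 1 - (j + 1) = N - j by omega]
      have e1 : g (N + 1) j = monoCoeff b (N + 1 + j) (N - j + 1) /
          ∏ i ∈ Finset.range (N + 1 + j), b i := by
        simp only [hgdef]
        rw [if_pos (by omega), show N + 1 - j = N - j + 1 by omega]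
      have hg1 : 0 ≤ g (N + 1) j := by
        rw [e1]; exact div_nonneg (monoCoeff_nonneg hb _ _) (hBpos _).le
      have hr := hratio (N + 1) j (N - j) (by omega) (by omega)
      rcases Nat.lt_or_ge j N with hjN | hjN
      · obtain ⟨k, hk⟩ : ∃ k, N - j = k + 1 := ⟨N - j - 1, by omega⟩
        have e2 : g N (j + 1) = monoCoeff b (N + 1 + j) k /
            ∏ i ∈ Finset.range (N + 1 + j), b i := by
          simp only [hgdef]
          rw [if_pos (by omega), show N - (j + 1) = k by omega,
            show N + (j + 1) = N + 1 + j by omega]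
        have hg2 : 0 ≤ g N (j + 1) := by
          rw [e2]; exact div_nonneg (monoCoeff_nonneg hb _ _) (hBpos _).le
        have hr2 := hratio (N + 1) j k (by omega) (by omega)
        have e : g (N + 1) (j + 1) = b k / b (N + 1 + j) * g N (j + 1)
            + b (N - j) / b (N + 1 + j) * g (N + 1) j := by
          rw [e0, e1, e2, hk, monoCoeff]
          field_simp
        rw [e]
        gcongr
      · obtain rfl : j = N := by omega
        have e2 : g j (j + 1) = 0 := by
          simp only [hgdef]; rw [if_neg (by omega)]
        have e : g (j + 1) (j + 1) = b (j - j) / b (j + 1 + j) * g (j + 1) j := by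
          rw [e0, e1, Nat.sub_self, monoCoeff]
          field_simp
        rw [e, e2, mul_zero, zero_add]
        gcongr)
  refine ⟨D, hD, fun N j hj => ?_⟩
  have := h N j fun i hi => by omega
  simp only [hgdef, if_pos hj] at this
  rwa [div_le_iff₀' (hBpos _)] at this

lemma IsSymmetricProblem.coeff_rec_zero (h : IsSymmetricProblem μ P b) (m : ℕ) :
    b (m + 1) * (P (m + 2)).coeff 0 + b m * (P m).coeff 0 = 0 := by
  have := congrArg (fun p => p.coeff 0) (h.rec_succ m)
  simpa using this.symm

lemma IsSymmetricProblem.coeff_rec_succ (h : IsSymmetricProblem μ P b) (m n : ℕ) :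
    b (m + 1) * (P (m + 2)).coeff (n + 1) + b m * (P m).coeff (n + 1) = (P (m + 1)).coeff n := by
  have := congrArg (fun p => p.coeff (n + 1)) (h.rec_succ m)
  simpa using this.symm

lemma IsSymmetricProblem.coeff_one_succ (h : IsSymmetricProblem μ P b) (n : ℕ) :
    b 0 * (P 1).coeff (n + 1) = (P 0).coeff n := by
  have := congrArg (fun p => p.coeff (n + 1)) h.rec_zero
  simpa using this.symm

lemma IsSymmetricProblem.coeff_eq_zero_of_lt (h : IsSymmetricProblem μ P b) {m n : ℕ}
    (hmn : m < n) : (P m).coeff n = 0 :=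
  coeff_eq_zero_of_natDegree_lt (by rwa [h.ortho.natDegree_eq])

lemma IsSymmetricProblem.coeff_eq_zero_of_odd (h : IsSymmetricProblem μ P b) {m n : ℕ}
    (hmn : (m + n) % 2 = 1) : (P m).coeff n = 0 := by
  induction m using Nat.strong_induction_on generalizing n with
  | _ m ih =>
    match m, ih with
    | 0, _ => rw [h.P_zero, coeff_one, if_neg (by omega)]
    | 1, ih =>
      have h0 := h.b_pos 0
      cases n with
      | zero =>
        have := congrArg (fun p => p.coeff 0) h.rec_zero
        simp at this
        exact this.resolve_left h0.ne'
      | succ n =>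
        have := h.coeff_one_succ n
        rw [ih 0 (by omega) (by omega)] at this
        exact (mul_eq_zero.1 this).resolve_left h0.ne'
    | m + 2, ih =>
      have h0 := h.b_pos (m + 1)
      cases n with
      | zero =>
        have := h.coeff_rec_zero m
        rw [ih m (by omega) (by omega)] at this
        simp at this
        exact this.resolve_left h0.ne'
      | succ n =>
        have := h.coeff_rec_succ m n
        rw [ih m (by omega) (by omega), ih (m + 1) (by omega) (by omega)] at this
        simp at this
        exact this.resolve_left h0.ne'

lemma IsSymmetricProblem.coeff_self_mul_prod (h : IsSymmetricProblem μ P b) (n : ℕ) :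
    (P n).coeff n * ∏ i ∈ Finset.range n, b i = 1 := by
  induction n with
  | zero => simp [h.P_zero]
  | succ n ih =>
    have : b n * (P (n + 1)).coeff (n + 1) = (P n).coeff n := by
      cases n with
      | zero => exact h.coeff_one_succ 0
      | succ n =>
        rw [← h.coeff_rec_succ n (n + 1), h.coeff_eq_zero_of_lt (by omega : n < n + 1 + 1)]
        ring
    rw [Finset.prod_range_succ, ← ih, ← this]
    ring

/-- The normalized coefficients `b_0 ⋯ b_{n-1} |b_{n,n+2j}|` of the orthonormal polynomials satisfy
a recurrence of the same kind as the `a_{n,k}`. -/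
lemma IsSymmetricProblem.exists_coeff_le (h : IsSymmetricProblem μ P b) {a : ℝ} (ha : 0 < a)
    {K : ℕ} (hK : 2 ≤ K) (hg : PowerGrowth b a K) :
    ∃ D : ℝ, 1 ≤ D ∧ ∀ n j, (∏ i ∈ Finset.range n, b i) * |(P (n + 2 * j)).coeff n| ≤
      D * ∏ i ∈ Finset.range j,
        (((n : ℝ) + K - 1 + 2 * i + 1) / (n + K - 1 + 2 * i + 2)) ^ a /
          (1 - (((n : ℝ) + K - 1) / (n + K - 1 + 2 * (i + 1))) ^ a) := by
  have hb := h.b_pos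
  have hBpos : ∀ n, 0 < ∏ i ∈ Finset.range n, b i := fun n => Finset.prod_pos fun i _ => hb i
  have hK' : (2 : ℝ) ≤ K := by exact_mod_cast hK
  set q : ℕ → ℕ → ℝ := fun n i => (((n : ℝ) + K - 1) / (n + K - 1 + 2 * (i + 1))) ^ a with hq
  set p : ℕ → ℕ → ℝ := fun n i =>
    (((n : ℝ) + K - 1 + 2 * i + 1) / (n + K - 1 + 2 * i + 2)) ^ a with hp
  have hT : ∀ n : ℕ, 0 < (n : ℝ) + K - 1 := fun n => by
    linarith [Nat.cast_nonneg (α := ℝ) n]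
  have hpr : ∀ n j, K ≤ n + 2 * j + 1 → b (n + 2 * j) / b (n + 2 * j + 1) ≤ p n j := by
    intro n j hn
    refine (hg _ hn _ (by omega)).trans (le_of_eq ?_)
    simp only [hp]
    push_cast
    congr 2 <;> ring
  have hqr : ∀ n j, K ≤ n + 1 + 2 * j + 1 → b n / b (n + 1 + 2 * j + 1) ≤ q (n + 1) j := by
    intro n j hn
    refine (hg _ hn _ (by omega)).trans (le_of_eq ?_)
    simp only [hq]
    push_cast
    congr 2 <;> ring
  refine exists_le_mul_prod
    (g := fun n j => (∏ i ∈ Finset.range n, b i) * |(P (n + 2 * j)).coeff n|) (q := q) (p := p)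
    (R := fun _ _ => True) (K := K) (fun _ _ _ _ _ => trivial)
    (fun n => ?_) (fun _ _ h => absurd trivial h)
    (fun n j _ => ?_) (fun n j _ => ?_) (fun n j _ => ?_) (fun _ _ _ => trivial)
    (fun n j _ => ?_) (fun n j _ => ?_) (fun j _ hj => ?_) (fun n j _ hj => ?_) |>.imp
      fun D hD => ⟨hD.1, fun n j => hD.2 n j fun _ _ => trivial⟩
  · have e := h.coeff_self_mul_prod n
    have : 0 < (P n).coeff n := by
      by_contra hneg
      nlinarith [hBpos n]
    simp only [mul_zero, add_zero]
    rw [abs_of_pos this, mul_comm, e]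
  · have := hT n
    exact Real.rpow_nonneg (by positivity) a
  · have := hT n
    refine Real.rpow_lt_one (by positivity) ?_ ha
    rw [div_lt_one (by positivity)]
    have : (0 : ℝ) ≤ j := Nat.cast_nonneg _
    linarith
  · have := hT n
    exact Real.rpow_pos_of_pos (by positivity) a
  · have := hT n
    have := hT (n + 1)
    refine Real.rpow_le_rpow (by positivity) ?_ ha.le
    rw [div_le_div_iff₀ (by positivity) (by positivity)]
    push_cast
    nlinarith [Nat.cast_nonneg (α := ℝ) j]
  · have := hT n
    have := hT (n + 1)
    refine Real.rpow_le_rpow (by positivity) ?_ ha.le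
    rw [div_le_div_iff₀ (by positivity) (by positivity)]
    push_cast
    nlinarith [Nat.cast_nonneg (α := ℝ) j]
  · have e := h.coeff_rec_zero (2 * j)
    have hb1 := hb (2 * j + 1)
    have e1 : |(P (2 * j + 2)).coeff 0| = b (2 * j) / b (2 * j + 1) * |(P (2 * j)).coeff 0| := by
      have : (P (2 * j + 2)).coeff 0 = -(b (2 * j) / b (2 * j + 1) * (P (2 * j)).coeff 0) := by
        field_simp
        linarith
      rw [this, abs_neg, abs_mul, abs_of_pos (div_pos (hb _) hb1)]
    have := hpr 0 j (by omega)
    simp only [zero_add] at this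
    simp only [Finset.range_zero, Finset.prod_empty, one_mul, zero_add]
    rw [show 2 * (j + 1) = 2 * j + 2 by ring, e1]
    gcongr
  · have e := h.coeff_rec_succ (n + 1 + 2 * j) n
    have hb1 := hb (n + 1 + 2 * j + 1)
    have hb2 := hb (n + 1 + 2 * j)
    have hpr' := hpr (n + 1) j (by omega)
    have hqr' := hqr n j (by omega)
    set c₂ := (P (n + 1 + 2 * j + 2)).coeff (n + 1)
    set c₁ := (P (n + 1 + 2 * j + 1)).coeff n
    set c₀ := (P (n + 1 + 2 * j)).coeff (n + 1)
    have e1 : |c₂| ≤ 1 / b (n + 1 + 2 * j + 1) * |c₁|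
        + b (n + 1 + 2 * j) / b (n + 1 + 2 * j + 1) * |c₀| := by
      have : c₂ = 1 / b (n + 1 + 2 * j + 1) * c₁
          - b (n + 1 + 2 * j) / b (n + 1 + 2 * j + 1) * c₀ := by
        field_simp
        linarith
      rw [this]
      refine (abs_sub _ _).trans (le_of_eq ?_)
      rw [abs_mul, abs_mul, abs_of_pos (div_pos (hb _) hb1), abs_of_pos (one_div_pos.2 hb1)]
    have hBn := hBpos n
    have hBn1 := hBpos (n + 1)
    rw [show n + 1 + 2 * (j + 1) = n + 1 + 2 * j + 2 by ring,
      show n + 2 * (j + 1) = n + 1 + 2 * j + 1 by ring]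
    calc _ ≤ (∏ i ∈ Finset.range (n + 1), b i) * (1 / b (n + 1 + 2 * j + 1) * |c₁|
        + b (n + 1 + 2 * j) / b (n + 1 + 2 * j + 1) * |c₀|) := by gcongr
      _ = b n / b (n + 1 + 2 * j + 1) * ((∏ i ∈ Finset.range n, b i) * |c₁|)
        + b (n + 1 + 2 * j) / b (n + 1 + 2 * j + 1) *
          ((∏ i ∈ Finset.range (n + 1), b i) * |c₀|) := by
          rw [Finset.prod_range_succ]; ring
      _ ≤ _ := by gcongr

end Problem

/-! ### The function `v` as a series -/

/-- `v(a) = ∑_{m ≥ 1} 1 / (m (m a - 1))`, obtained by integrating the power series of the logarithm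
term by term; the summation index is `m - 1`. -/
noncomputable def vTerm (a : ℝ) (m : ℕ) : ℝ := 1 / (((m : ℝ) + 1) * ((m + 1) * a - 1))

lemma mul_sub_one_le {a : ℝ} (m : ℕ) : ((m : ℝ) + 1) * (a - 1) ≤ (m + 1) * a - 1 := by
  nlinarith [Nat.cast_nonneg (α := ℝ) m]

lemma mul_sub_one_pos {a : ℝ} (ha : 1 < a) (m : ℕ) : 0 < ((m : ℝ) + 1) * a - 1 :=
  lt_of_lt_of_le (mul_pos (by positivity) (by linarith)) (mul_sub_one_le m)

lemma vTerm_nonneg {a : ℝ} (ha : 1 < a) (m : ℕ) : 0 ≤ vTerm a m := by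
  have := mul_sub_one_pos ha m
  unfold vTerm
  positivity

lemma vTerm_le {a : ℝ} (ha : 1 < a) (m : ℕ) :
    vTerm a m ≤ 1 / (a - 1) * (1 / ((m + 1 : ℕ) : ℝ) ^ 2) := by
  have h2 := mul_sub_one_pos ha m
  have h3 := mul_sub_one_le (a := a) m
  have h4 : 0 < a - 1 := by linarith
  unfold vTerm
  rw [one_div_mul_one_div]
  apply one_div_le_one_div_of_le (by positivity)
  push_cast
  nlinarith [Nat.cast_nonneg (α := ℝ) m]

lemma summable_one_div_succ_sq : Summable fun m : ℕ => 1 / ((m + 1 : ℕ) : ℝ) ^ 2 :=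
  (summable_nat_add_iff 1).2 (Real.summable_one_div_nat_pow.2 one_lt_two)

lemma summable_vTerm {a : ℝ} (ha : 1 < a) : Summable (vTerm a) :=
  Summable.of_nonneg_of_le (vTerm_nonneg ha) (vTerm_le ha) (summable_one_div_succ_sq.mul_left _)

lemma tsum_vTerm_le_div {a : ℝ} (ha : 1 < a) :
    ∑' m, vTerm a m ≤ 1 / (a - 1) * ∑' m : ℕ, 1 / ((m + 1 : ℕ) : ℝ) ^ 2 := by
  rw [← tsum_mul_left]
  exact (summable_vTerm ha).tsum_le_tsum (vTerm_le ha) (summable_one_div_succ_sq.mul_left _)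

lemma vReal_eq_tsum {a : ℝ} (ha : 1 < a) : vReal a = ENNReal.ofReal (∑' m, vTerm a m) := by
  have hint : ∀ m : ℕ, ∫⁻ x in Set.Ioi (1 : ℝ), ENNReal.ofReal ((x ^ (-a)) ^ (m + 1) / (m + 1))
      = ENNReal.ofReal (vTerm a m) := by
    intro m
    have hs : -a * ((m + 1 : ℕ) : ℝ) < -1 := by
      have := mul_sub_one_pos ha m
      push_cast
      linarith
    have e : ∀ x ∈ Set.Ioi (1 : ℝ), ENNReal.ofReal ((x ^ (-a)) ^ (m + 1) / (m + 1))
        = ENNReal.ofReal (x ^ (-a * ((m + 1 : ℕ) : ℝ)) / (m + 1)) := fun x hx => by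
      rw [Real.rpow_mul_natCast (by linarith [Set.mem_Ioi.1 hx])]
    rw [setLIntegral_congr_fun measurableSet_Ioi e, ← ofReal_integral_eq_lintegral_ofReal]
    · rw [integral_div, integral_Ioi_rpow_of_lt hs zero_lt_one]
      congr 1
      have := mul_sub_one_pos ha m
      unfold vTerm
      rw [Real.one_rpow]
      push_cast
      have h2 : -a * ((m : ℝ) + 1) + 1 = -((m + 1) * a - 1) := by ring
      rw [h2]
      field_simp
    · exact (integrableOn_Ioi_rpow_of_lt hs zero_lt_one).div_const _
    · refine (ae_restrict_mem measurableSet_Ioi).mono fun x hx => ?_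
      have : (0 : ℝ) < x := lt_trans zero_lt_one hx
      positivity
  have e : ∀ x ∈ Set.Ioi (1 : ℝ), ENNReal.ofReal (Real.log (1 - x ^ (-a))⁻¹)
      = ∑' m : ℕ, ENNReal.ofReal ((x ^ (-a)) ^ (m + 1) / (m + 1)) := by
    intro x hx
    have hx0 : (0 : ℝ) < x := lt_trans zero_lt_one hx
    have h0 : 0 < x ^ (-a) := Real.rpow_pos_of_pos hx0 _
    have h1 : x ^ (-a) < 1 := Real.rpow_lt_one_of_one_lt_of_neg hx (by linarith)
    have hs := Real.hasSum_pow_div_log_of_abs_lt_one (x := x ^ (-a)) (by rwa [abs_of_pos h0])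
    rw [Real.log_inv, ← hs.tsum_eq, ENNReal.ofReal_tsum_of_nonneg _ hs.summable]
    intro m
    positivity
  unfold vReal
  rw [setLIntegral_congr_fun measurableSet_Ioi e, lintegral_tsum]
  · simp_rw [hint]
    rw [ENNReal.ofReal_tsum_of_nonneg (vTerm_nonneg ha) (summable_vTerm ha)]
  · intro m
    refine AEMeasurable.ennreal_ofReal ?_
    exact (((measurable_id.pow_const (-a)).pow_const (m + 1)).div_const _).aemeasurable

lemma vReal_one : vReal 1 = ⊤ := by
  have h : ∫⁻ x in Set.Ioi (1 : ℝ), ENNReal.ofReal x⁻¹ = ⊤ := by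
    by_contra hne
    refine not_integrableOn_Ioi_inv (a := 1) ⟨by fun_prop, ?_⟩
    rw [hasFiniteIntegral_iff_ofReal]
    · exact lt_top_iff_ne_top.2 hne
    · exact (ae_restrict_mem measurableSet_Ioi).mono fun x hx =>
        inv_nonneg.2 (zero_le_one.trans (le_of_lt hx))
  refine top_le_iff.1 (h.symm.le.trans ?_)
  refine setLIntegral_mono' measurableSet_Ioi fun x hx => ENNReal.ofReal_le_ofReal ?_
  have hx1 : (1 : ℝ) < x := hx
  have h1 : 0 < 1 - x⁻¹ := by
    have := inv_lt_one_of_one_lt₀ hx1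
    linarith
  rw [Real.rpow_neg_one, Real.log_inv]
  have := Real.log_le_sub_one_of_pos h1
  linarith

/-- Since `(m a - 1) / (m a' - 1)` decreases with `m` when `a' ≤ a`, the function `v` is continuous
from the left. -/
lemma tsum_vTerm_le {a a' : ℝ} (ha' : 1 < a') (h : a' ≤ a) :
    ∑' m, vTerm a' m ≤ (a - 1) / (a' - 1) * ∑' m, vTerm a m := by
  have ha : 1 < a := by linarith
  rw [← tsum_mul_left]
  refine (summable_vTerm ha').tsum_le_tsum (fun m => ?_) ((summable_vTerm ha).mul_left _)
  have h1 := mul_sub_one_pos ha m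
  have h2 := mul_sub_one_pos ha' m
  have h3 : 0 < a' - 1 := by linarith
  unfold vTerm
  rw [div_mul_div_comm, div_le_div_iff₀ (by positivity) (by positivity)]
  have h4 : (a' - 1) * (((m : ℝ) + 1) * a - 1) ≤ (a - 1) * ((m + 1) * a' - 1) := by
    nlinarith [Nat.cast_nonneg (α := ℝ) m,
      mul_nonneg (Nat.cast_nonneg (α := ℝ) m) (sub_nonneg.2 h)]
  nlinarith [Nat.cast_nonneg (α := ℝ) m]

/-! ### The bound for `V` -/

/-- A telescoping form of the comparison of the sum with `∫ (T / (T + 2 x)) ^ s dx`. -/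
lemma sum_rpow_le {T s : ℝ} (hT : 0 < T) (hs : 1 < s) (j : ℕ) :
    ∑ i ∈ Finset.range j, (T / (T + 2 * ((i : ℝ) + 1))) ^ s ≤ T / (2 * (s - 1)) := by
  have key : ∀ i : ℕ, (T / (T + 2 * ((i : ℝ) + 1))) ^ s ≤ T / (2 * (s - 1)) *
      ((T / (T + 2 * i)) ^ (s - 1) - (T / (T + 2 * ((i : ℝ) + 1))) ^ (s - 1)) := by
    intro i
    set A : ℝ := T + 2 * i with hA
    have hA0 : 0 < A := by positivity
    have hB : T + 2 * ((i : ℝ) + 1) = A + 2 := by rw [hA]; ring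
    rw [hB]
    have hs1 : 0 < s - 1 := by linarith
    have e1 : (T / A) ^ (s - 1) = (T / (A + 2)) ^ (s - 1) * ((A + 2) / A) ^ (s - 1) := by
      rw [← Real.mul_rpow (by positivity) (by positivity)]
      congr 1
      field_simp
    have e2 : (T / (A + 2)) ^ s = (T / (A + 2)) ^ (s - 1) * (T / (A + 2)) := by
      rw [← Real.rpow_add_one (by positivity)]
      congr 1
      ring
    have h1 : 1 + (s - 1) * (2 / (A + 2)) ≤ ((A + 2) / A) ^ (s - 1) := by
      rw [Real.rpow_def_of_pos (by positivity)]
      have h2 := Real.one_sub_inv_le_log_of_pos (x := (A + 2) / A) (by positivity)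
      have h3 : 1 - ((A + 2) / A)⁻¹ = 2 / (A + 2) := by field_simp; ring
      rw [h3] at h2
      have h4 := Real.add_one_le_exp (Real.log ((A + 2) / A) * (s - 1))
      nlinarith
    rw [e1, e2]
    have h5 : T / (A + 2) ≤ T / (2 * (s - 1)) * (((A + 2) / A) ^ (s - 1) - 1) := by
      calc T / (A + 2) = T / (2 * (s - 1)) * ((s - 1) * (2 / (A + 2))) := by field_simp
        _ ≤ _ := by gcongr; linarith
    have h6 : 0 < (T / (A + 2)) ^ (s - 1) := by positivity
    nlinarith
  refine (Finset.sum_le_sum fun i _ => key i).trans ?_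
  rw [← Finset.mul_sum]
  have := Finset.sum_range_sub' (fun i : ℕ => (T / (T + 2 * (i : ℝ))) ^ (s - 1)) j
  push_cast at this
  rw [this]
  have h1 : (T / (T + 2 * 0)) ^ (s - 1) = 1 := by
    rw [mul_zero, add_zero, div_self hT.ne', Real.one_rpow]
  rw [h1]
  have h2 : 0 ≤ (T / (T + 2 * (j : ℝ))) ^ (s - 1) := by positivity
  have h3 : 0 < T / (2 * (s - 1)) := div_pos hT (by linarith)
  nlinarith

lemma prod_inv_one_sub_le {T a : ℝ} (hT : 0 < T) (ha : 1 < a) (j : ℕ) :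
    ∏ i ∈ Finset.range j, (1 - (T / (T + 2 * ((i : ℝ) + 1))) ^ a)⁻¹
      ≤ Real.exp (T / 2 * ∑' m, vTerm a m) := by
  set q : ℕ → ℝ := fun i => (T / (T + 2 * ((i : ℝ) + 1))) ^ a with hq
  have hq0 : ∀ i, 0 < q i := fun i => by positivity
  have hq1 : ∀ i, q i < 1 := fun i => by
    refine Real.rpow_lt_one (by positivity) ?_ (by linarith)
    rw [div_lt_one (by positivity)]
    linarith [Nat.cast_nonneg (α := ℝ) i]
  have hpos : ∀ i, 0 < (1 - q i)⁻¹ := fun i => inv_pos.2 (by linarith [hq1 i])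
  rw [← Real.log_le_iff_le_exp (Finset.prod_pos fun i _ => hpos i),
    Real.log_prod fun i _ => (hpos i).ne']
  simp_rw [Real.log_inv]
  have hs : HasSum (fun m : ℕ => ∑ i ∈ Finset.range j, q i ^ (m + 1) / ((m : ℝ) + 1))
      (∑ i ∈ Finset.range j, -Real.log (1 - q i)) :=
    hasSum_sum fun i _ => Real.hasSum_pow_div_log_of_abs_lt_one
      (by rw [abs_of_pos (hq0 i)]; exact hq1 i)
  refine hasSum_le (fun m => ?_) hs ((summable_vTerm ha).hasSum.mul_left (T / 2))
  rw [← Finset.sum_div]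
  have e : ∀ i ∈ Finset.range j, q i ^ (m + 1)
      = (T / (T + 2 * ((i : ℝ) + 1))) ^ (((m : ℝ) + 1) * a) := fun i _ => by
    rw [hq]
    simp only
    rw [← Real.rpow_mul_natCast (by positivity), mul_comm a]
    push_cast
    rfl
  rw [Finset.sum_congr rfl e]
  have h1 := mul_sub_one_pos ha m
  have h2 := sum_rpow_le hT (s := ((m : ℝ) + 1) * a) (by linarith) j
  unfold vTerm
  calc _ ≤ T / (2 * (((m : ℝ) + 1) * a - 1)) / (m + 1) := by gcongr
    _ = _ := by field_simp

lemma prod_rpow_sq_le {T a : ℝ} (hT : 0 < T) (ha : 0 < a) (j : ℕ) :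
    (∏ i ∈ Finset.range j, ((T + 2 * (i : ℝ) + 1) / (T + 2 * i + 2)) ^ a) ^ 2
      ≤ ((T + 1) / (T + 1 + 2 * j)) ^ a := by
  induction j with
  | zero =>
    have : T + 1 ≠ 0 := by positivity
    simp [div_self this]
  | succ j ih =>
    rw [Finset.prod_range_succ, mul_pow]
    calc _ ≤ ((T + 1) / (T + 1 + 2 * j)) ^ a *
          (((T + 2 * (j : ℝ) + 1) / (T + 2 * j + 2)) ^ a) ^ 2 := by
          gcongr
      _ = ((T + 1) / (T + 1 + 2 * j) * ((T + 2 * (j : ℝ) + 1) / (T + 2 * j + 2)) ^ 2) ^ a := by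
          rw [Real.mul_rpow (by positivity) (by positivity), Real.rpow_pow_comm (by positivity)]
      _ ≤ _ := by
          refine Real.rpow_le_rpow (by positivity) ?_ ha.le
          push_cast
          have e : T + 1 + 2 * ((j : ℝ) + 1) = T + 2 * j + 3 := by ring
          have e' : T + 1 + 2 * (j : ℝ) = T + 2 * j + 1 := by ring
          rw [e, e', div_pow, div_mul_div_comm, div_le_div_iff₀ (by positivity) (by positivity)]
          have hx : 0 < T + 2 * (j : ℝ) := by positivity
          set x := T + 2 * (j : ℝ)
          have h3 : (x + 1) ^ 2 * (x + 3) ≤ (x + 1) * (x + 2) ^ 2 := by nlinarith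
          nlinarith

/-- A bound for the sums `∑_n b_{k,n} ^ 2` in terms of `v`. -/
lemma IsSymmetricProblem.exists_sum_coeff_sq_le {μ : Measure ℝ} {P : ℕ → ℝ[X]} {b : ℕ → ℝ}
    (h : IsSymmetricProblem μ P b) {a : ℝ} (ha : 1 < a) {K : ℕ} (hK : 2 ≤ K)
    (hg : PowerGrowth b a K) :
    ∃ D : ℝ, 1 ≤ D ∧ ∀ n J, ∑ j ∈ Finset.range J, (P (n + 2 * j)).coeff n ^ 2 ≤
      (D * (1 + (n + K) / (2 * (a - 1))) * Real.exp ((n + K) / 2 * ∑' m, vTerm a m)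
        / ∏ i ∈ Finset.range n, b i) ^ 2 := by
  obtain ⟨D, hD, hle⟩ := h.exists_coeff_le (by linarith) hK hg
  refine ⟨D, hD, fun n J => ?_⟩
  have hK' : (2 : ℝ) ≤ K := by exact_mod_cast hK
  have hn : (0 : ℝ) ≤ n := Nat.cast_nonneg _
  have hB : 0 < ∏ i ∈ Finset.range n, b i := Finset.prod_pos fun i _ => h.b_pos i
  set B := ∏ i ∈ Finset.range n, b i
  set T : ℝ := n + K - 1 with hT
  have hT0 : 0 < T := by linarith
  have hv : 0 ≤ ∑' m, vTerm a m := tsum_nonneg (vTerm_nonneg ha)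
  set v := ∑' m, vTerm a m
  have hterm : ∀ j, (P (n + 2 * j)).coeff n ^ 2 ≤
      (D * Real.exp (T / 2 * v) / B) ^ 2 * ((T + 1) / (T + 1 + 2 * j)) ^ a := by
    intro j
    have h1 := hle n j
    simp_rw [← hT, div_eq_mul_inv (_ ^ a), Finset.prod_mul_distrib] at h1
    have h2 := prod_inv_one_sub_le hT0 ha j
    have h3 := prod_rpow_sq_le hT0 (by linarith : 0 < a) j
    set A := ∏ i ∈ Finset.range j, ((T + 2 * (i : ℝ) + 1) / (T + 2 * i + 2)) ^ a
    have hA : 0 ≤ A := Finset.prod_nonneg fun i _ => by positivity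
    have h4 : B * |(P (n + 2 * j)).coeff n| ≤ D * (A * Real.exp (T / 2 * v)) :=
      h1.trans (by gcongr)
    have h5 : |(P (n + 2 * j)).coeff n| ≤ D * Real.exp (T / 2 * v) / B * A := by
      rw [div_mul_eq_mul_div, le_div_iff₀ hB]
      linarith
    calc _ = |(P (n + 2 * j)).coeff n| ^ 2 := (sq_abs _).symm
      _ ≤ (D * Real.exp (T / 2 * v) / B * A) ^ 2 := by gcongr
      _ ≤ _ := by rw [mul_pow]; gcongr
  have hsum : ∑ j ∈ Finset.range J, ((T + 1) / (T + 1 + 2 * (j : ℝ))) ^ a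
      ≤ 1 + (n + K) / (2 * (a - 1)) := by
    have hT1 : 0 < T + 1 := by linarith
    have e : T + 1 = n + K := by rw [hT]; ring
    calc _ ≤ ∑ j ∈ Finset.range (J + 1), ((T + 1) / (T + 1 + 2 * (j : ℝ))) ^ a := by
          refine Finset.sum_le_sum_of_subset_of_nonneg (Finset.range_mono (by omega))
            fun i _ _ => by positivity
      _ ≤ _ := by
          rw [Finset.sum_range_succ']
          have h1 := sum_rpow_le hT1 ha J
          have h2 : ((T + 1) / (T + 1 + 2 * ((0 : ℕ) : ℝ))) ^ a = 1 := by
            simp [div_self hT1.ne']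
          rw [h2, ← e]
          push_cast
          linarith
  have ha1 : 0 < a - 1 := by linarith
  have hS : 1 ≤ 1 + ((n : ℝ) + K) / (2 * (a - 1)) := by
    have : 0 ≤ ((n : ℝ) + K) / (2 * (a - 1)) := by positivity
    linarith
  set S := 1 + ((n : ℝ) + K) / (2 * (a - 1))
  calc _ ≤ ∑ j ∈ Finset.range J, (D * Real.exp (T / 2 * v) / B) ^ 2 *
        ((T + 1) / (T + 1 + 2 * (j : ℝ))) ^ a := Finset.sum_le_sum fun j _ => hterm j
    _ = (D * Real.exp (T / 2 * v) / B) ^ 2 *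
        ∑ j ∈ Finset.range J, ((T + 1) / (T + 1 + 2 * (j : ℝ))) ^ a := by rw [Finset.mul_sum]
    _ ≤ (D * Real.exp ((n + K) / 2 * v) / B) ^ 2 * S ^ 2 := by
        gcongr
        · linarith
        · exact hsum.trans (by nlinarith)
    _ = _ := by ring

lemma IsSymmetricProblem.tsum_coeff_sq_le {μ : Measure ℝ} {P : ℕ → ℝ[X]} {b : ℕ → ℝ}
    (h : IsSymmetricProblem μ P b) {n : ℕ} {E : ℝ}
    (hE : ∀ J, ∑ j ∈ Finset.range J, (P (n + 2 * j)).coeff n ^ 2 ≤ E) :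
    ∑' m, ENNReal.ofReal ((P m).coeff n ^ 2) ≤ ENNReal.ofReal E := by
  have hinj : Function.Injective fun j : ℕ => n + 2 * j := fun i j hij => by
    simp only at hij
    omega
  rw [← hinj.tsum_eq (f := fun m => ENNReal.ofReal ((P m).coeff n ^ 2))]
  · refine ENNReal.tsum_le_of_sum_range_le fun J => ?_
    rw [← ENNReal.ofReal_sum_of_nonneg fun i _ => sq_nonneg _]
    exact ENNReal.ofReal_le_ofReal (hE J)
  · intro m hm
    by_contra hne
    refine hm ?_
    have : (P m).coeff n = 0 := by
      rcases lt_or_ge m n with hlt | hge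
      · exact h.coeff_eq_zero_of_lt hlt
      · refine h.coeff_eq_zero_of_odd ?_
        by_contra hpar
        exact hne ⟨(m - n) / 2, by simp only; omega⟩
    simp [this]

/-- An explicit bound for `V_n`, of exponential order `e ^ (v(a) n / 2)`. -/
lemma IsSymmetricProblem.exists_V_le {μ : Measure ℝ} {P : ℕ → ℝ[X]} {b : ℕ → ℝ}
    (h : IsSymmetricProblem μ P b) {a : ℝ} (ha : 1 < a) {K : ℕ} (hK : 2 ≤ K)
    (hg : PowerGrowth b a K) :
    ∃ D : ℝ, 1 ≤ D ∧ ∀ n, V P b n ≤ ENNReal.ofReal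
      (D * (1 + (n + K) / (2 * (a - 1))) * Real.exp ((n + K) / 2 * ∑' m, vTerm a m)) := by
  obtain ⟨D, hD, hle⟩ := h.exists_sum_coeff_sq_le ha hK hg
  refine ⟨D, hD, fun n => ?_⟩
  have hB : 0 < ∏ i ∈ Finset.range n, b i := Finset.prod_pos fun i _ => h.b_pos i
  have ha1 : 0 < a - 1 := by linarith
  set E := D * (1 + (n + K) / (2 * (a - 1))) * Real.exp ((n + K) / 2 * ∑' m, vTerm a m) with hE
  have hE0 : 0 ≤ E := by positivity
  have h1 : c P n ≤ ENNReal.ofReal (E / ∏ i ∈ Finset.range n, b i) := by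
    unfold c
    refine (ENNReal.rpow_le_rpow (h.tsum_coeff_sq_le (hle n)) (by norm_num)).trans (le_of_eq ?_)
    rw [ENNReal.ofReal_rpow_of_nonneg (by positivity) (by norm_num), ← Real.sqrt_eq_rpow,
      Real.sqrt_sq (by positivity)]
  unfold V
  refine (mul_le_mul_right h1 _).trans (le_of_eq ?_)
  rw [← ENNReal.ofReal_mul hB.le]
  congr 1
  field_simp

/-! ### The function `u` -/

/-- The function `log (y ^ a / (1 - y ^ a))` in the definition of `u`; it increases from `-∞` to `∞`
on `(0, 1)` and vanishes at `2 ^ (-1 / a)`. -/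
noncomputable def logOdds (a y : ℝ) : ℝ := Real.log (y ^ a / (1 - y ^ a))

/-- The function of `x` whose maximum defines `u(a)`. -/
noncomputable def uFun (a x : ℝ) : ℝ := (x + 1) * ∫ y in x..1, logOdds a y / (1 + y) ^ 2

lemma uReal_eq (a : ℝ) :
    uReal a = sSup (uFun a '' Set.Icc ((2 : ℝ) ^ (-1 / a)) 1) := rfl

lemma rpow_mem_Ioo {a y : ℝ} (ha : 0 < a) (hy : y ∈ Set.Ioo (0 : ℝ) 1) :
    y ^ a ∈ Set.Ioo (0 : ℝ) 1 :=
  ⟨Real.rpow_pos_of_pos hy.1 a, Real.rpow_lt_one hy.1.le hy.2 ha⟩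

lemma logOdds_mono {a x y : ℝ} (ha : 0 < a) (hx : 0 < x) (hxy : x ≤ y) (hy : y < 1) :
    logOdds a x ≤ logOdds a y := by
  have h1 := rpow_mem_Ioo ha ⟨hx, hxy.trans_lt hy⟩
  have h2 := rpow_mem_Ioo ha ⟨hx.trans_le hxy, hy⟩
  have h3 := Real.rpow_le_rpow hx.le hxy ha.le
  unfold logOdds
  exact Real.log_le_log (div_pos h1.1 (by linarith [h1.2]))
    (div_le_div₀ h2.1.le h3 (by linarith [h2.2]) (by linarith))

lemma two_rpow_mem {a : ℝ} (ha : 0 < a) : (2 : ℝ) ^ (-1 / a) ∈ Set.Ioo (0 : ℝ) 1 :=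
  ⟨by positivity, Real.rpow_lt_one_of_one_lt_of_neg one_lt_two
    (div_neg_of_neg_of_pos (by norm_num) ha)⟩

lemma logOdds_two_rpow {a : ℝ} (ha : 0 < a) : logOdds a ((2 : ℝ) ^ (-1 / a)) = 0 := by
  unfold logOdds
  rw [← Real.rpow_mul zero_le_two, div_mul_cancel₀ _ ha.ne', Real.rpow_neg_one]
  norm_num

/-- Bernoulli's inequality for `1 - y ^ a`. -/
lemma min_mul_one_sub_le {a y : ℝ} (ha : 0 < a) (hy : y ∈ Set.Icc (0 : ℝ) 1) :
    min 1 a * (1 - y) ≤ 1 - y ^ a := by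
  rcases le_total 1 a with h | h
  · rw [min_eq_left h]
    have := Real.rpow_le_rpow_of_exponent_ge' hy.1 hy.2 zero_le_one h
    rw [Real.rpow_one] at this
    linarith
  · rw [min_eq_right h]
    have := rpow_one_add_le_one_add_mul_self (s := y - 1) (by linarith [hy.1]) ha.le h
    rw [show 1 + (y - 1) = y by ring] at this
    linarith

lemma abs_logOdds_le {a y : ℝ} (ha : 0 < a) (hy : y ∈ Set.Ioo (0 : ℝ) 1) :
    |logOdds a y| ≤ a * |Real.log y| + (|Real.log (1 - y)| + |Real.log (min 1 a)|) := by
  have h1 := rpow_mem_Ioo ha hy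
  have hm : 0 < min 1 a := lt_min one_pos ha
  have h2 := min_mul_one_sub_le ha ⟨hy.1.le, hy.2.le⟩
  have h3 : 0 < 1 - y := by linarith [hy.2]
  unfold logOdds
  rw [Real.log_div h1.1.ne' (by linarith [h1.2]), Real.log_rpow hy.1]
  refine (abs_sub _ _).trans ?_
  rw [abs_mul, abs_of_pos ha]
  gcongr
  have h4 := Real.log_le_log (by positivity) h2
  rw [Real.log_mul hm.ne' h3.ne'] at h4
  have h5 : Real.log (1 - y ^ a) ≤ 0 := Real.log_nonpos (by linarith [h1.2]) (by linarith [h1.1])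
  rw [abs_of_nonpos h5]
  linarith [neg_abs_le (Real.log (1 - y)), neg_abs_le (Real.log (min 1 a))]

lemma intervalIntegrable_logOdds {a x z : ℝ} (ha : 0 < a) (hx : 0 < x) (hxz : x ≤ z)
    (hz : z ≤ 1) : IntervalIntegrable (fun y => logOdds a y / (1 + y) ^ 2) volume x z := by
  have h1 : IntervalIntegrable (fun y : ℝ => Real.log (1 - y)) volume x z := by
    have := (intervalIntegral.intervalIntegrable_log' (a := 1 - x) (b := 1 - z)).comp_sub_left 1
    simpa using this
  have hg : IntervalIntegrable (fun y => a * |Real.log y| +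
      (|Real.log (1 - y)| + |Real.log (min 1 a)|)) volume x z :=
    (intervalIntegral.intervalIntegrable_log'.norm.const_mul a).add
      (h1.norm.add intervalIntegrable_const)
  rw [intervalIntegrable_iff_integrableOn_Ioo_of_le hxz] at hg ⊢
  refine Integrable.mono' hg ?_ ?_
  · unfold logOdds
    exact ((Real.measurable_log.comp (by fun_prop)).div (by fun_prop)).aestronglyMeasurable
  · refine (ae_restrict_mem measurableSet_Ioo).mono fun y hy => ?_
    have hy' : y ∈ Set.Ioo (0 : ℝ) 1 := ⟨hx.trans hy.1, hy.2.trans_le hz⟩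
    have := abs_logOdds_le ha hy'
    rw [Real.norm_eq_abs, abs_div, abs_of_nonneg (sq_nonneg (1 + y))]
    refine (div_le_self (abs_nonneg _) ?_).trans this
    nlinarith [hy'.1]

lemma integral_one_div_sq {x z : ℝ} (hx : 0 < x) (hxz : x ≤ z) :
    ∫ y in x..z, 1 / (1 + y) ^ 2 = 1 / (1 + x) - 1 / (1 + z) := by
  have hne : ∀ y ∈ Set.uIcc x z, 1 + y ≠ 0 := fun y hy => by
    rw [Set.uIcc_of_le hxz] at hy
    linarith [hy.1]
  rw [intervalIntegral.integral_eq_sub_of_hasDerivAt (f := fun y => -(1 / (1 + y)))]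
  · ring
  · intro y hy
    have h := ((hasDerivAt_id y).const_add 1).inv (hne y hy)
    have h2 := h.neg
    simp only [id, ← one_div] at h2
    convert! h2 using 1
    ring
  · refine ContinuousOn.intervalIntegrable ?_
    exact continuousOn_const.div (by fun_prop) fun y hy => pow_ne_zero 2 (hne y hy)

lemma intervalIntegrable_one_div_sq {x z : ℝ} (hx : 0 < x) (hxz : x ≤ z) :
    IntervalIntegrable (fun y : ℝ => 1 / (1 + y) ^ 2) volume x z := by
  refine ContinuousOn.intervalIntegrable ?_
  refine continuousOn_const.div (by fun_prop) fun y hy => pow_ne_zero 2 ?_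
  rw [Set.uIcc_of_le hxz] at hy
  linarith [hy.1]

/-- The weight `1 / (1 + y) ^ 2` turns bounds of `logOdds` into bounds of its integrals. -/
lemma integral_logOdds_le {a x z L : ℝ} (ha : 0 < a) (hx : 0 < x) (hxz : x ≤ z) (hz : z ≤ 1)
    (hL : ∀ y ∈ Set.Ioo x z, logOdds a y ≤ L) :
    ∫ y in x..z, logOdds a y / (1 + y) ^ 2 ≤ L * (1 / (1 + x) - 1 / (1 + z)) := by
  rw [← integral_one_div_sq hx hxz, ← intervalIntegral.integral_const_mul]
  refine intervalIntegral.integral_mono_on_of_le_Ioo hxz (intervalIntegrable_logOdds ha hx hxz hz)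
    ((intervalIntegrable_one_div_sq hx hxz).const_mul L) fun y hy => ?_
  rw [mul_one_div]
  gcongr
  exact hL y hy

lemma le_integral_logOdds {a x z L : ℝ} (ha : 0 < a) (hx : 0 < x) (hxz : x ≤ z) (hz : z ≤ 1)
    (hL : ∀ y ∈ Set.Ioo x z, L ≤ logOdds a y) :
    L * (1 / (1 + x) - 1 / (1 + z)) ≤ ∫ y in x..z, logOdds a y / (1 + y) ^ 2 := by
  rw [← integral_one_div_sq hx hxz, ← intervalIntegral.integral_const_mul]
  refine intervalIntegral.integral_mono_on_of_le_Ioo hxz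
    ((intervalIntegrable_one_div_sq hx hxz).const_mul L)
    (intervalIntegrable_logOdds ha hx hxz hz) fun y hy => ?_
  rw [mul_one_div]
  gcongr
  exact hL y hy

lemma integral_logOdds_add {a x z : ℝ} (ha : 0 < a) (hx : 0 < x) (hxz : x ≤ z) (hz : z ≤ 1) :
    ∫ y in x..1, logOdds a y / (1 + y) ^ 2 = (∫ y in x..z, logOdds a y / (1 + y) ^ 2)
      + ∫ y in z..1, logOdds a y / (1 + y) ^ 2 :=
  (intervalIntegral.integral_add_adjacent_intervals (intervalIntegrable_logOdds ha hx hxz hz)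
    (intervalIntegrable_logOdds ha (hx.trans_le hxz) hz le_rfl)).symm

lemma integral_logOdds_nonneg {a x z : ℝ} (ha : 0 < a) (hx : (2 : ℝ) ^ (-1 / a) ≤ x)
    (hxz : x ≤ z) (hz : z ≤ 1) : 0 ≤ ∫ y in x..z, logOdds a y / (1 + y) ^ 2 := by
  have h0 := (two_rpow_mem ha).1
  have := le_integral_logOdds ha (h0.trans_le hx) hxz hz (L := 0) fun y hy => by
    rw [← logOdds_two_rpow ha]
    exact logOdds_mono ha h0 (hx.trans hy.1.le) (hy.2.trans_le hz)
  simpa using this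

lemma bddAbove_uFun {a : ℝ} (ha : 0 < a) :
    BddAbove (uFun a '' Set.Icc ((2 : ℝ) ^ (-1 / a)) 1) := by
  have h0 := two_rpow_mem ha
  refine ⟨2 * ∫ y in ((2 : ℝ) ^ (-1 / a))..1, logOdds a y / (1 + y) ^ 2, ?_⟩
  rintro _ ⟨x, hx, rfl⟩
  have h1 := integral_logOdds_nonneg ha hx.1 hx.2 le_rfl
  have h2 := integral_logOdds_nonneg ha le_rfl hx.1 hx.2
  rw [integral_logOdds_add ha h0.1 hx.1 hx.2]
  unfold uFun
  nlinarith [hx.2]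

lemma uReal_nonneg {a : ℝ} (ha : 0 < a) : 0 ≤ uReal a := by
  rw [uReal_eq]
  refine le_csSup (bddAbove_uFun ha) ⟨1, ⟨(two_rpow_mem ha).2.le, le_rfl⟩, ?_⟩
  simp [uFun]

/-- The restriction to `x ≥ 2 ^ (-1 / a)` in the maximum is immaterial, as the integrand is negative
to the left of that point. -/
lemma uFun_le_uReal {a x : ℝ} (ha : 0 < a) (hx : 0 < x) (hx1 : x ≤ 1) : uFun a x ≤ uReal a := by
  have h0 := two_rpow_mem ha
  rcases le_total ((2 : ℝ) ^ (-1 / a)) x with h | h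
  · exact le_csSup (bddAbove_uFun ha) ⟨x, ⟨h, hx1⟩, rfl⟩
  · refine le_trans ?_ (le_csSup (bddAbove_uFun ha) ⟨(2 : ℝ) ^ (-1 / a), ⟨le_rfl, h0.2.le⟩, rfl⟩)
    have h1 := integral_logOdds_nonneg ha le_rfl h0.2.le le_rfl
    have h2 := integral_logOdds_le ha hx h h0.2.le (L := 0) fun y hy => by
      rw [← logOdds_two_rpow ha]
      exact logOdds_mono ha (hx.trans hy.1) hy.2.le h0.2
    change uFun a x ≤ uFun a _
    unfold uFun
    rw [integral_logOdds_add ha hx h h0.2.le]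
    rw [zero_mul] at h2
    nlinarith

/-- A form of the left continuity of `u`. -/
lemma uReal_le_add {a a' : ℝ} (ha' : 0 < a') (h : a' ≤ a) :
    uReal a' ≤ uReal a + (Real.log (a / a') + (a - a') * (Real.log 2 / a')) := by
  have ha : 0 < a := ha'.trans_le h
  have h0 := two_rpow_mem ha'
  set L := Real.log (a / a') + (a - a') * (Real.log 2 / a') with hL
  have hL0 : 0 ≤ L := by
    have h1 : 0 ≤ Real.log (a / a') := Real.log_nonneg ((one_le_div ha').2 h)
    have h2 : 0 ≤ Real.log 2 := Real.log_nonneg one_le_two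
    have h3 : 0 ≤ a - a' := by linarith
    positivity
  rw [uReal_eq a']
  refine csSup_le ⟨_, ⟨1, ⟨h0.2.le, le_rfl⟩, rfl⟩⟩ ?_
  rintro _ ⟨x, hx, rfl⟩
  have hx0 : 0 < x := h0.1.trans_le hx.1
  have hpt : ∀ y ∈ Set.Ioo x 1, logOdds a' y / (1 + y) ^ 2 ≤
      logOdds a y / (1 + y) ^ 2 + L * (1 / (1 + y) ^ 2) := by
    intro y hy
    have hy' : y ∈ Set.Ioo (0 : ℝ) 1 := ⟨hx0.trans hy.1, hy.2⟩
    have h1 := rpow_mem_Ioo ha hy'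
    have h2 := rpow_mem_Ioo ha' hy'
    have hlog : -Real.log y ≤ Real.log 2 / a' := by
      have := Real.log_le_log h0.1 (hx.1.trans hy.1.le)
      rw [Real.log_rpow zero_lt_two] at this
      have e : -1 / a' * Real.log 2 = -(Real.log 2 / a') := by ring
      linarith
    have hb : 1 - y ^ a ≤ a / a' * (1 - y ^ a') := by
      have := one_add_mul_self_le_rpow_one_add (s := y ^ a' - 1) (by linarith [h2.1])
        (p := a / a') ((one_le_div ha').2 h)
      rw [show 1 + (y ^ a' - 1) = y ^ a' by ring, ← Real.rpow_mul hy'.1.le,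
        mul_div_cancel₀ _ ha'.ne'] at this
      linarith
    have h3 : 0 < 1 - y ^ a := by linarith [h1.2]
    have h4 : 0 < 1 - y ^ a' := by linarith [h2.2]
    have hlb := Real.log_le_log h3 hb
    rw [Real.log_mul (by positivity) h4.ne'] at hlb
    have : logOdds a' y ≤ logOdds a y + L := by
      unfold logOdds
      rw [Real.log_div h1.1.ne' h3.ne', Real.log_div h2.1.ne' h4.ne', Real.log_rpow hy'.1,
        Real.log_rpow hy'.1, hL]
      nlinarith
    rw [mul_one_div, ← add_div]
    gcongr
  have hint : ∫ y in x..1, logOdds a' y / (1 + y) ^ 2 ≤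
      (∫ y in x..1, logOdds a y / (1 + y) ^ 2) + L * (1 / (1 + x) - 1 / (1 + 1)) := by
    rw [← integral_one_div_sq hx0 hx.2, ← intervalIntegral.integral_const_mul,
      ← intervalIntegral.integral_add (intervalIntegrable_logOdds ha hx0 hx.2 le_rfl)
        ((intervalIntegrable_one_div_sq hx0 hx.2).const_mul L)]
    exact intervalIntegral.integral_mono_on_of_le_Ioo hx.2
      (intervalIntegrable_logOdds ha' hx0 hx.2 le_rfl)
      ((intervalIntegrable_logOdds ha hx0 hx.2 le_rfl).add
        ((intervalIntegrable_one_div_sq hx0 hx.2).const_mul L)) hpt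
  have hF := uFun_le_uReal ha hx0 hx.2
  unfold uFun at hF ⊢
  have e : (x + 1) * (1 / (1 + x) - 1 / (1 + 1)) ≤ 1 := by
    have : (x + 1) * (1 / (1 + x) - 1 / (1 + 1)) = (1 - x) / 2 := by field_simp; ring
    rw [this]; linarith
  calc _ ≤ (x + 1) * ((∫ y in x..1, logOdds a y / (1 + y) ^ 2)
        + L * (1 / (1 + x) - 1 / (1 + 1))) := by gcongr
    _ = (x + 1) * (∫ y in x..1, logOdds a y / (1 + y) ^ 2)
        + L * ((x + 1) * (1 / (1 + x) - 1 / (1 + 1))) := by ring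
    _ ≤ _ := by nlinarith

/-! ### The bound for `U` -/

/-- The points `y_i = (S - (i + 1)) / (S + i)` split `(0, 1)` into intervals of equal mass with
respect to `(1 + y) ^ (-2) dy`, so the sum of the increasing function `logOdds a` over them is
controlled by its integral. -/
lemma sum_logOdds_le {a S : ℝ} (ha : 0 < a) (hS : 1 ≤ S) (j : ℕ) (hj : (j : ℝ) + 1 < S) :
    ∑ i ∈ Finset.range (j + 1), logOdds a ((S - (i + 1)) / (S + i)) ≤
      logOdds a ((S - 1) / S) +
        (2 * S - 1) * ∫ y in ((S - (j + 1)) / (S + j))..((S - 1) / S),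
          logOdds a y / (1 + y) ^ 2 := by
  induction j with
  | zero => simp
  | succ j ih =>
    push_cast at hj
    have hj0 : (0 : ℝ) ≤ j := Nat.cast_nonneg j
    have ih := ih (by linarith)
    set y₀ := (S - 1) / S with hy0
    set y₁ := (S - ((j : ℝ) + 1)) / (S + j) with hy1
    set y₂ := (S - (((j + 1 : ℕ) : ℝ) + 1)) / (S + ((j + 1 : ℕ) : ℝ)) with hy2
    have hy2pos : 0 < y₂ := by
      rw [hy2]; push_cast; exact div_pos (by linarith) (by linarith)
    have hy21 : y₂ ≤ y₁ := by
      rw [hy2, hy1, div_le_div_iff₀ (by positivity) (by positivity)]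
      push_cast
      nlinarith
    have hy10 : y₁ ≤ y₀ := by
      rw [hy1, hy0, div_le_div_iff₀ (by positivity) (by positivity)]
      nlinarith
    have hy01 : y₀ ≤ 1 := by
      rw [hy0, div_le_one (by positivity)]; linarith
    have hstep := le_integral_logOdds ha hy2pos hy21 (hy10.trans hy01) (L := logOdds a y₂)
      fun y hy => logOdds_mono ha hy2pos hy.1.le (hy.2.trans_le (hy10.trans hy01))
    have hw : (2 * S - 1) * (1 / (1 + y₂) - 1 / (1 + y₁)) = 1 := by
      have h1 : 1 + y₁ = (2 * S - 1) / (S + j) := by rw [hy1]; field_simp; ring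
      have h2 : 1 + y₂ = (2 * S - 1) / (S + j + 1) := by
        rw [hy2]; push_cast; rw [← add_assoc]
        have : S + (j : ℝ) + 1 ≠ 0 := by positivity
        field_simp; ring
      have h3 : 2 * S - 1 ≠ 0 := by linarith
      rw [h1, h2]
      field_simp
      ring
    have hadd := intervalIntegral.integral_add_adjacent_intervals
      (intervalIntegrable_logOdds ha hy2pos hy21 (hy10.trans hy01))
      (intervalIntegrable_logOdds ha (hy2pos.trans_le hy21) hy10 hy01)
    rw [Finset.sum_range_succ, ← hadd]
    have h5 : (2 * S - 1) * (logOdds a y₂ * (1 / (1 + y₂) - 1 / (1 + y₁))) = logOdds a y₂ := by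
      rw [mul_left_comm, hw, mul_one]
    have h6 : 0 ≤ 2 * S - 1 := by linarith
    nlinarith [mul_le_mul_of_nonneg_left hstep h6]

lemma prod_odds_le {a S : ℝ} (ha : 0 < a) (hS : 1 ≤ S) (j : ℕ) (hj : (j : ℝ) < S) :
    ∏ i ∈ Finset.range j, ((S - ((i : ℝ) + 1)) / (S + i)) ^ a /
      (1 - ((S - ((i : ℝ) + 1)) / (S + i)) ^ a) ≤
      S / min 1 a * Real.exp ((S + j) * uReal a) := by
  have hm : 0 < min 1 a := lt_min one_pos ha
  have hu := uReal_nonneg ha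
  have hSm : 1 ≤ S / min 1 a := by
    rw [one_le_div hm]; exact (min_le_left _ _).trans hS
  have hexp : 1 ≤ Real.exp ((S + j) * uReal a) := Real.one_le_exp (by positivity)
  cases j with
  | zero => simpa using one_le_mul_of_one_le_of_one_le hSm (by simpa using hexp)
  | succ j =>
    push_cast at hj
    have hj0 : (0 : ℝ) ≤ j := Nat.cast_nonneg j
    have hmem : ∀ i ∈ Finset.range (j + 1),
        (S - ((i : ℝ) + 1)) / (S + i) ∈ Set.Ioo (0 : ℝ) 1 := by
      intro i hi
      have hi : (i : ℝ) ≤ j := by exact_mod_cast Nat.lt_succ_iff.1 (Finset.mem_range.1 hi)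
      have hi0 : (0 : ℝ) ≤ i := Nat.cast_nonneg i
      refine ⟨div_pos (by linarith) (by linarith), ?_⟩
      rw [div_lt_one (by linarith)]
      linarith
    have hfac : ∀ i ∈ Finset.range (j + 1), 0 < ((S - ((i : ℝ) + 1)) / (S + i)) ^ a /
        (1 - ((S - ((i : ℝ) + 1)) / (S + i)) ^ a) := fun i hi => by
      have := rpow_mem_Ioo ha (hmem i hi)
      exact div_pos this.1 (by linarith [this.2])
    have hprod : ∏ i ∈ Finset.range (j + 1), ((S - ((i : ℝ) + 1)) / (S + i)) ^ a /
        (1 - ((S - ((i : ℝ) + 1)) / (S + i)) ^ a) = Real.exp (∑ i ∈ Finset.range (j + 1),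
          logOdds a ((S - (i + 1)) / (S + i))) := by
      rw [Real.exp_sum]
      exact Finset.prod_congr rfl fun i hi => (Real.exp_log (hfac i hi)).symm
    rw [hprod]
    have h0 := two_rpow_mem ha
    have hy0 : (S - 1) / S ∈ Set.Ioo (0 : ℝ) 1 := by
      have := hmem 0 (by simp)
      simpa using this
    rcases le_total ((2 : ℝ) ^ (-1 / a)) ((S - 1) / S) with hc | hc
    · have hsum := sum_logOdds_le ha hS j hj
      have hyj := hmem j (by simp)
      set y₁ := (S - ((j : ℝ) + 1)) / (S + j) with hy1
      have hle : y₁ ≤ (S - 1) / S := by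
        rw [hy1, div_le_div_iff₀ (by positivity) (by positivity)]
        nlinarith
      have h1 := integral_logOdds_add ha hyj.1 hle hy0.2.le
      have h2 := integral_logOdds_nonneg ha hc hy0.2.le le_rfl
      have h3 := uFun_le_uReal ha hyj.1 hyj.2.le
      have h4 : (2 * S - 1) * ∫ y in y₁..((S - 1) / S), logOdds a y / (1 + y) ^ 2 ≤
          (S + j) * uFun a y₁ := by
        have e : (S + j) * uFun a y₁ = (2 * S - 1) * ∫ y in y₁..1, logOdds a y / (1 + y) ^ 2 := by
          unfold uFun
          rw [← mul_assoc]
          congr 1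
          rw [hy1]
          field_simp
          ring
        rw [e]
        have : 0 ≤ 2 * S - 1 := by linarith
        gcongr
        linarith
      have h5 : logOdds a ((S - 1) / S) ≤ Real.log (S / min 1 a) := by
        have hb := min_mul_one_sub_le ha ⟨hy0.1.le, hy0.2.le⟩
        have hr := rpow_mem_Ioo ha hy0
        have e : 1 - (S - 1) / S = 1 / S := by field_simp; ring
        rw [e] at hb
        unfold logOdds
        refine Real.log_le_log (div_pos hr.1 (by linarith [hr.2])) ?_
        calc _ ≤ 1 / (min 1 a * (1 / S)) :=
              div_le_div₀ zero_le_one hr.2.le (by positivity) hb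
          _ = S / min 1 a := by field_simp
      calc _ ≤ Real.exp (Real.log (S / min 1 a) + (S + j) * uReal a) := by
            rw [Real.exp_le_exp]
            have : (S + j) * uFun a y₁ ≤ (S + j) * uReal a := by gcongr
            linarith
        _ ≤ _ := by
            rw [Real.exp_add, Real.exp_log (by positivity)]
            gcongr
            linarith
    · have hle : ∑ i ∈ Finset.range (j + 1), logOdds a ((S - (i + 1)) / (S + i)) ≤ 0 := by
        refine Finset.sum_nonpos fun i hi => ?_
        rw [← logOdds_two_rpow ha]
        refine logOdds_mono ha (hmem i hi).1 (le_trans ?_ hc) h0.2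
        have hi0 : (0 : ℝ) ≤ i := Nat.cast_nonneg i
        rw [div_le_div_iff₀ (by positivity) (by positivity)]
        nlinarith
      calc _ ≤ 1 := Real.exp_le_one_iff.2 hle
        _ ≤ _ := one_le_mul_of_one_le_of_one_le hSm hexp

/-- An explicit bound for `U_n`, of exponential order `e ^ (2 u(a) n)`. -/
lemma IsSymmetricProblem.exists_U_le {μ : Measure ℝ} {P : ℕ → ℝ[X]} {b : ℕ → ℝ}
    (h : IsSymmetricProblem μ P b) {a : ℝ} (ha : 0 < a) {K : ℕ} (hK : 2 ≤ K)
    (hg : PowerGrowth b a K) :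
    ∃ D : ℝ, 1 ≤ D ∧ ∀ n, U μ b n ≤
      (n + 1) * (D * ((n + K) / min 1 a) * Real.exp ((n + K) * uReal a)) ^ 2 := by
  obtain ⟨D, hD, hle⟩ := exists_monoCoeff_le h.b_pos ha hK hg
  refine ⟨D, hD, fun n => ?_⟩
  have hm : 0 < min 1 a := lt_min one_pos ha
  have hK' : (2 : ℝ) ≤ K := by exact_mod_cast hK
  have hB : 0 < ∏ i ∈ Finset.range n, b i := Finset.prod_pos fun i _ => h.b_pos i
  set B := ∏ i ∈ Finset.range n, b i with hBdef
  set E := D * ((n + K) / min 1 a) * Real.exp ((n + K) * uReal a) with hE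
  have hE0 : 0 ≤ E := by positivity
  have hcoef : ∀ k ∈ Finset.range (n + 1), monoCoeff b n k * monoCoeff b n k ≤ (B * E) ^ 2 := by
    intro k hk
    have hk := Finset.mem_range.1 hk
    have hnn := monoCoeff_nonneg h.b_pos n k
    suffices hs : monoCoeff b n k ≤ B * E by nlinarith
    rcases Nat.mod_two_eq_zero_or_one (n + k) with h0 | h1
    · obtain ⟨j, hj⟩ : ∃ j, n = k + 2 * j := ⟨(n - k) / 2, by omega⟩
      have h1 := hle (k + j) j (by omega)
      rw [show k + j + j = n by omega, show k + j - j = k by omega] at h1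
      refine h1.trans ?_
      rw [← hBdef, hE, mul_assoc D]
      have h2 := prod_odds_le ha (S := ((k + j : ℕ) : ℝ) + K)
        (by linarith [Nat.cast_nonneg (α := ℝ) (k + j)]) j
        (by push_cast; linarith [Nat.cast_nonneg (α := ℝ) k])
      have e : ((k + j : ℕ) : ℝ) + K + j = n + K := by rw [hj]; push_cast; ring
      rw [e] at h2
      have h3 : ((k + j : ℕ) : ℝ) + K ≤ n + K := by
        have : k + j ≤ n := by omega
        gcongr
      gcongr
      refine h2.trans ?_
      gcongr
    · rw [monoCoeff_eq_zero_of_odd b h1]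
      positivity
  unfold U
  rw [two_mul, h.moment_add, div_le_iff₀ (by positivity)]
  calc _ ≤ ∑ k ∈ Finset.range (n + 1), (B * E) ^ 2 := Finset.sum_le_sum hcoef
    _ = _ := by
      rw [Finset.sum_const, Finset.card_range, nsmul_eq_mul]
      push_cast
      ring

/-! ### Upper bounds for `u` -/

lemma logOdds_exp_neg {a w : ℝ} (ha : 0 < a) (hw : 0 < w) :
    logOdds a (Real.exp (-(w / a))) = -Real.log (Real.exp w - 1) := by
  have h1 : 1 < Real.exp w := Real.one_lt_exp_iff.2 hw
  unfold logOdds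
  rw [← Real.exp_mul, neg_mul, div_mul_cancel₀ _ ha.ne', ← Real.log_inv, Real.exp_neg]
  congr 1
  have : Real.exp w - 1 ≠ 0 := by linarith
  field_simp

lemma hasDerivAt_logOdds {a y : ℝ} (ha : 0 < a) (hy : y ∈ Set.Ioo (0 : ℝ) 1) :
    HasDerivAt (logOdds a) (a / (y * (1 - y ^ a))) y := by
  have hya := rpow_mem_Ioo ha hy
  have h1 : 1 - y ^ a ≠ 0 := by linarith [hya.2]
  have hd : HasDerivAt (fun y : ℝ => a * Real.log y - Real.log (1 - y ^ a))
      (a * y⁻¹ - (-(a * y ^ (a - 1))) / (1 - y ^ a)) y :=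
    ((Real.hasDerivAt_log hy.1.ne').const_mul a).sub
      (((Real.hasDerivAt_rpow_const (Or.inl hy.1.ne')).const_sub 1).log h1)
  have he : logOdds a =ᶠ[𝓝 y] fun y : ℝ => a * Real.log y - Real.log (1 - y ^ a) := by
    filter_upwards [isOpen_Ioo.mem_nhds hy] with z hz
    have hza := rpow_mem_Ioo ha hz
    unfold logOdds
    rw [Real.log_div hza.1.ne' (by linarith [hza.2]), Real.log_rpow hz.1]
  refine (hd.congr_of_eventuallyEq he).congr_deriv ?_
  rw [Real.rpow_sub_one hy.1.ne']
  have := hy.1.ne'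
  field_simp
  ring

lemma hasDerivAt_weight {y : ℝ} (hy : 0 < y) :
    HasDerivAt (fun y : ℝ => (y - 1) / (2 * (1 + y))) (1 / (1 + y) ^ 2) y := by
  have h := ((hasDerivAt_id y).sub_const 1).div (((hasDerivAt_id y).const_add 1).const_mul 2)
    (by simp only [id]; positivity)
  refine h.congr_deriv ?_
  simp only [id]
  field_simp
  ring

/-- The singularity of `logOdds` at `1` is cancelled by the zero of the weight. -/
lemma continuousOn_logOdds_mul {a p : ℝ} (ha : 0 < a) (hp : 0 < p) :
    ContinuousOn (fun y => logOdds a y * ((y - 1) / (2 * (1 + y)))) (Set.Icc p 1) := by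
  intro y hy
  rcases hy.2.lt_or_eq with hlt | rfl
  · have hy' : y ∈ Set.Ioo (0 : ℝ) 1 := ⟨hp.trans_le hy.1, hlt⟩
    exact ((hasDerivAt_logOdds ha hy').continuousAt.mul
      (hasDerivAt_weight hy'.1).continuousAt).continuousWithinAt
  · set B : ℝ → ℝ := fun y => a * |Real.log y| * |1 - y| + |(1 - y) * Real.log (1 - y)|
      + |Real.log (min 1 a)| * |1 - y| with hB
    have hBc : ContinuousAt B 1 := by
      have h1 : ContinuousAt (fun y : ℝ => a * |Real.log y| * |1 - y|) 1 :=
        ((Real.continuousAt_log one_ne_zero).abs.const_mul a).mul (by fun_prop)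
      have h2 : ContinuousAt (fun y : ℝ => |(1 - y) * Real.log (1 - y)|) 1 :=
        ((Real.continuous_mul_log.comp (continuous_const.sub continuous_id)).abs).continuousAt
      exact (h1.add h2).add (by fun_prop)
    have hB1 : B 1 = 0 := by simp [hB]
    have ht : Tendsto B (𝓝[Set.Icc p 1] 1) (𝓝 0) := by
      rw [← hB1]; exact hBc.continuousWithinAt
    unfold ContinuousWithinAt
    have h1 : logOdds a 1 * (((1 : ℝ) - 1) / (2 * (1 + 1))) = 0 := by simp
    change Tendsto _ _ (𝓝 (logOdds a 1 * (((1 : ℝ) - 1) / (2 * (1 + 1)))))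
    rw [h1]
    refine squeeze_zero_norm' ?_ ht
    filter_upwards [self_mem_nhdsWithin] with y hy
    rcases hy.2.lt_or_eq with hlt | rfl
    · have hy' : y ∈ Set.Ioo (0 : ℝ) 1 := ⟨hp.trans_le hy.1, hlt⟩
      have h1 := abs_logOdds_le ha hy'
      have h2 : |(y - 1) / (2 * (1 + y))| ≤ |1 - y| := by
        rw [abs_div, abs_sub_comm]
        refine div_le_self (abs_nonneg _) ?_
        rw [abs_of_pos (by linarith [hy'.1])]
        linarith [hy'.1]
      rw [Real.norm_eq_abs, abs_mul]
      calc _ ≤ (a * |Real.log y| + (|Real.log (1 - y)| + |Real.log (min 1 a)|)) * |1 - y| := by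
            gcongr
        _ = B y := by rw [hB]; simp only [abs_mul]; ring
    · simp [hB1]

/-- An upper bound for `u`. The maximum of `uFun a` is at most `L` as soon as
`∫ (h - L)⁺ (1 + y) ^ (-2) dy ≤ L / 2` with `h = logOdds a`. For `L = h(p)`, `p = e ^ (-w / a)`, an
integration by parts and the substitution `y = e ^ (-s / a)` turn this condition into
`∫_0^w tanh (s / (2 a)) / (1 - e ^ (-s)) ds ≤ L`; here `Q` is a majorant of that integral. -/
lemma uReal_le_of_majorant {a w : ℝ} (ha : 0 < a) (hw : 0 < w) {Q Q' : ℝ → ℝ} (hQ0 : Q 0 = 0)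
    (hQ : ∀ s, HasDerivAt Q (Q' s) s)
    (hQ' : ∀ s ∈ Set.Ioo 0 w, (1 - Real.exp (-(s / a))) / (1 + Real.exp (-(s / a)))
      / (1 - Real.exp (-s)) ≤ Q' s)
    (hQw : Q w ≤ -Real.log (Real.exp w - 1)) : uReal a ≤ -Real.log (Real.exp w - 1) := by
  set p := Real.exp (-(w / a)) with hp
  have hp0 : 0 < p := Real.exp_pos _
  have hp1 : p < 1 := by
    rw [hp, Real.exp_lt_one_iff]
    have : 0 < w / a := div_pos hw ha
    linarith
  rw [← logOdds_exp_neg ha hw, ← hp] at hQw ⊢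
  set L := logOdds a p with hL
  have hlogp : -(a * Real.log p) = w := by
    rw [hp, Real.log_exp]
    field_simp
  have hmain : ∫ y in p..1, logOdds a y / (1 + y) ^ 2 ≤ L / (1 + p) := by
    have h1 := intervalIntegral.integral_le_sub_of_hasDeriv_right_of_le
      (g := fun y => logOdds a y * ((y - 1) / (2 * (1 + y))) - Q (-(a * Real.log y)) / 2)
      (g' := fun y => a / (y * (1 - y ^ a)) * ((y - 1) / (2 * (1 + y)))
        + logOdds a y * (1 / (1 + y) ^ 2) - Q' (-(a * Real.log y)) * -(a * y⁻¹) / 2)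
      (φ := fun y => logOdds a y / (1 + y) ^ 2) hp1.le
      (by
        refine (continuousOn_logOdds_mul ha hp0).sub (ContinuousOn.div_const ?_ 2)
        have hQc : Continuous Q := continuous_iff_continuousAt.2 fun s => (hQ s).continuousAt
        refine hQc.comp_continuousOn
          ((ContinuousOn.log continuousOn_id fun y hy => ?_).const_mul a).neg
        exact (hp0.trans_le hy.1).ne')
      (fun y hy => by
        have hy' : y ∈ Set.Ioo (0 : ℝ) 1 := ⟨hp0.trans hy.1, hy.2⟩
        have hs : HasDerivAt (fun y : ℝ => -(a * Real.log y)) (-(a * y⁻¹)) y :=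
          ((Real.hasDerivAt_log hy'.1.ne').const_mul a).neg
        exact (((hasDerivAt_logOdds ha hy').mul (hasDerivAt_weight hy'.1)).sub
          (((hQ _).comp y hs).div_const 2)).hasDerivWithinAt)
      (by
        have := intervalIntegrable_logOdds ha hp0 hp1.le le_rfl
        rwa [intervalIntegrable_iff_integrableOn_Icc_of_le hp1.le] at this)
      (fun y hy => by
        have hy' : y ∈ Set.Ioo (0 : ℝ) 1 := ⟨hp0.trans hy.1, hy.2⟩
        have hya := rpow_mem_Ioo ha hy'
        set s := -(a * Real.log y) with hs
        have hsy : Real.exp (-(s / a)) = y := by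
          rw [hs, neg_div, neg_neg, mul_div_cancel_left₀ _ ha.ne', Real.exp_log hy'.1]
        have hsa : Real.exp (-s) = y ^ a := by
          rw [hs, neg_neg, Real.rpow_def_of_pos hy'.1, mul_comm]
        have hs0 : 0 < s := by
          have := Real.log_neg hy'.1 hy'.2
          rw [hs]
          nlinarith
        have hsw : s < w := by
          have := Real.log_lt_log hp0 hy.1
          rw [← hlogp, hs]
          nlinarith
        have h2 := hQ' s ⟨hs0, hsw⟩
        rw [hsy, hsa] at h2
        have hy0 := hy'.1
        have h3 : 0 < 1 - y ^ a := by linarith [hya.2]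
        have e : a / (y * (1 - y ^ a)) * ((y - 1) / (2 * (1 + y)))
            + logOdds a y * (1 / (1 + y) ^ 2) - Q' s * -(a * y⁻¹) / 2
            = logOdds a y / (1 + y) ^ 2
              + a / (2 * y) * (Q' s - (1 - y) / (1 + y) / (1 - y ^ a)) := by
          field_simp
          ring
        have h4 : 0 ≤ a / (2 * y) * (Q' s - (1 - y) / (1 + y) / (1 - y ^ a)) :=
          mul_nonneg (by positivity) (by linarith)
        rw [e]
        linarith)
    refine h1.trans ?_
    have e1 : (1 : ℝ) - 1 = 0 := by ring
    rw [hlogp, e1, Real.log_one, mul_zero, neg_zero, hQ0, zero_div, mul_zero, zero_div, sub_zero,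
      zero_sub, ← hL]
    have e2 : L / (1 + p) = -(L * ((p - 1) / (2 * (1 + p))) - L / 2) := by
      field_simp
      ring
    rw [e2]
    linarith
  rw [uReal_eq]
  refine csSup_le ⟨_, ⟨1, ⟨(two_rpow_mem ha).2.le, le_rfl⟩, rfl⟩⟩ ?_
  rintro _ ⟨x, hx, rfl⟩
  have hx0 : 0 < x := (two_rpow_mem ha).1.trans_le hx.1
  have hG : ∫ y in x..1, logOdds a y / (1 + y) ^ 2 ≤ L * (1 / (1 + x)) := by
    rw [← mul_one_div] at hmain
    rcases le_total x p with h | h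
    · rw [integral_logOdds_add ha hx0 h hp1.le]
      have := integral_logOdds_le ha hx0 h hp1.le (L := L) fun y hy =>
        logOdds_mono ha (hx0.trans hy.1) hy.2.le hp1
      linarith
    · rw [integral_logOdds_add ha hp0 h hx.2] at hmain
      have := le_integral_logOdds ha hp0 h hx.2 (L := L) fun y hy =>
        logOdds_mono ha hp0 hy.1.le (hy.2.trans_le hx.2)
      linarith
  unfold uFun
  calc _ ≤ (x + 1) * (L * (1 / (1 + x))) := by gcongr
    _ = L := by field_simp; ring

lemma uReal_le_of_large {ε a : ℝ} (hε : 0 < ε) (ha : 2 / ε ≤ a) : uReal a ≤ ε := by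
  have ha0 : 0 < a := lt_of_lt_of_le (by positivity) ha
  set w := Real.log (1 + Real.exp (-ε)) with hw
  have he : 0 < Real.exp (-ε) := Real.exp_pos _
  have hw0 : 0 < w := Real.log_pos (by linarith)
  have hw1 : w < 1 := by
    have h1 : Real.exp (-ε) < 1 := Real.exp_lt_one_iff.2 (by linarith)
    have h2 := Real.log_le_sub_one_of_pos (show 0 < 1 + Real.exp (-ε) by linarith)
    linarith
  have hL : -Real.log (Real.exp w - 1) = ε := by
    rw [hw, Real.exp_log (by linarith), add_sub_cancel_left, Real.log_exp, neg_neg]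
  rw [← hL]
  refine uReal_le_of_majorant ha0 hw0 (Q := fun s => 2 / a * s) (Q' := fun _ => 2 / a) (by simp)
    (fun s => by simpa using (hasDerivAt_id s).const_mul (2 / a)) (fun s hs => ?_) ?_
  · have hs0 := hs.1
    have h1 : 1 - Real.exp (-(s / a)) ≤ s / a := by
      linarith [Real.add_one_le_exp (-(s / a))]
    have h2 : s / (1 + s) ≤ 1 - Real.exp (-s) := by
      have h3 : Real.exp (-s) ≤ (1 + s)⁻¹ := by
        rw [Real.exp_neg]
        exact inv_anti₀ (by linarith) (by linarith [Real.add_one_le_exp s])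
      have e : s / (1 + s) = 1 - (1 + s)⁻¹ := by field_simp; ring
      linarith
    have h4 : (1 - Real.exp (-(s / a))) / (1 + Real.exp (-(s / a))) ≤ s / a := by
      have h5 := Real.exp_pos (-(s / a))
      rw [div_le_iff₀ (by linarith)]
      have : 0 < s / a := by positivity
      nlinarith
    calc _ ≤ (s / a) / (s / (1 + s)) :=
          div_le_div₀ (by positivity) h4 (by positivity) h2
      _ = (1 + s) / a := by field_simp
      _ ≤ 2 / a := by gcongr; linarith [hs.2]
  · rw [hL]
    rw [div_le_iff₀ hε] at ha
    rw [div_mul_eq_mul_div, div_le_iff₀ ha0]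
    nlinarith

/-! ### Numerical bounds -/

/-- The fifth Taylor polynomial of `tanh` is an upper bound. -/
lemma tanh_le_taylor {z : ℝ} (hz : 0 ≤ z) (hz1 : z ≤ 1 / 5) :
    (1 - Real.exp (-(2 * z))) / (1 + Real.exp (-(2 * z))) ≤ z - z ^ 3 / 3 + 2 * z ^ 5 / 15 := by
  have hE := Real.exp_bound (x := -(2 * z)) (by rw [abs_neg, abs_of_nonneg (by linarith)]; linarith)
    (n := 8) (by norm_num)
  rw [abs_le] at hE
  have h1 := hE.1
  rw [abs_neg, abs_of_nonneg (by linarith)] at h1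
  simp only [Finset.sum_range_succ, Finset.sum_range_zero, Nat.factorial] at h1
  norm_num at h1
  have h0 := Real.exp_pos (-(2 * z))
  set E := Real.exp (-(2 * z))
  rw [div_le_iff₀ (by linarith)]
  have hR : 0 ≤ 1 + (z - z ^ 3 / 3 + 2 * z ^ 5 / 15) := by
    have : z ^ 3 ≤ 1 := pow_le_one₀ hz (by linarith)
    have : 0 ≤ z ^ 5 := by positivity
    linarith
  have hS : 1 - 2 * z + 2 * z ^ 2 - 4 / 3 * z ^ 3 + 2 / 3 * z ^ 4 - 4 / 15 * z ^ 5
      + 4 / 45 * z ^ 6 - 8 / 315 * z ^ 7 - 1 / 140 * z ^ 8 ≤ E := by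
    linarith
  have hq : 0 ≤ z ^ 7 * (34 / 315 - 17 / 140 * z + 197 / 3780 * z ^ 2 - 128 / 4725 * z ^ 3
      + 269 / 18900 * z ^ 4 - 16 / 4725 * z ^ 5 - 1 / 1050 * z ^ 6) := by
    have hp : ∀ n ≠ 0, z ^ n ≤ 1 / 5 := fun n hn =>
      (pow_le_of_le_one hz (by linarith) hn).trans hz1
    have h3 := hp 3 (by norm_num)
    have h5 := hp 5 (by norm_num)
    have h6 := hp 6 (by norm_num)
    have h2 : 0 ≤ z ^ 2 := by positivity
    have h4 : 0 ≤ z ^ 4 := by positivity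
    refine mul_nonneg (by positivity) (by linarith)
  have h3 := mul_le_mul_of_nonneg_right hS hR
  linarith

lemma inv_one_sub_exp_neg_le {s : ℝ} (hs : 0 < s) (hs1 : s ≤ 1) :
    1 / (1 - Real.exp (-s)) ≤ (1 + s / 2 + s ^ 2 / 12) / s := by
  have h1 := Real.sum_le_exp_of_nonneg hs.le 6
  simp only [Finset.sum_range_succ, Finset.sum_range_zero, Nat.factorial] at h1
  norm_num at h1
  have hE : 1 < Real.exp s := Real.one_lt_exp_iff.2 hs
  have e : 1 - Real.exp (-s) = (Real.exp s - 1) / Real.exp s := by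
    rw [Real.exp_neg]; field_simp
  set E := Real.exp s
  rw [e, one_div_div, div_le_div_iff₀ (by linarith) hs]
  have h2 : 0 ≤ 1 - s / 2 + s ^ 2 / 12 := by nlinarith
  have h3 := mul_le_mul_of_nonneg_right h1 h2
  have h4 : 0 ≤ s ^ 5 * (1 / 720 - s / 1440 + s ^ 2 / 1440) := by
    have : 0 ≤ 1 / 720 - s / 1440 + s ^ 2 / 1440 := by nlinarith
    positivity
  nlinarith

/-- The point `w = 0.596327` is close to the solution of
`∫_0^w tanh (s / (2 a)) / (1 - e ^ (-s)) ds = -log (e ^ w - 1)` for `a = 1.68746`, where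
`u(a) = 0.204021…`. -/
lemma uReal_le_numeric {a : ℝ} (ha : 1.68746 ≤ a) : uReal a ≤ 0.204031 := by
  have ha0 : 0 < a := by linarith
  obtain ⟨w, hw⟩ : ∃ w : ℝ, w = 0.596327 := ⟨_, rfl⟩
  -- `g` is slightly larger than `1 / (2 * 1.68746)`.
  obtain ⟨g, hg⟩ : ∃ g : ℝ, g = 0.296304 := ⟨_, rfl⟩
  obtain ⟨A, hA⟩ : ∃ A : ℝ, A = g ^ 2 / 3 := ⟨_, rfl⟩
  obtain ⟨C, hC⟩ : ∃ C : ℝ, C = 2 * g ^ 4 / 15 := ⟨_, rfl⟩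
  have hw0 : 0 < w := by norm_num [hw]
  have hX1 : Real.exp w ≤ 1.8154385 := by
    refine (Real.exp_bound' hw0.le (by norm_num [hw]) (n := 11) (by norm_num)).trans ?_
    simp only [Finset.sum_range_succ, Finset.sum_range_zero, Nat.factorial]
    norm_num [hw]
  have hX2 : 1.8154384 ≤ Real.exp w := by
    refine le_trans ?_ (Real.sum_le_exp_of_nonneg hw0.le 11)
    simp only [Finset.sum_range_succ, Finset.sum_range_zero, Nat.factorial]
    norm_num [hw]
  have hq1 : Real.exp 0.204027 ≤ 1.226332 := by
    refine (Real.exp_bound' (by norm_num) (by norm_num) (n := 8) (by norm_num)).trans ?_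
    simp only [Finset.sum_range_succ, Finset.sum_range_zero, Nat.factorial]
    norm_num
  have hq2 : 1.226336 ≤ Real.exp 0.204031 := by
    refine le_trans ?_ (Real.sum_le_exp_of_nonneg (by norm_num) 8)
    simp only [Finset.sum_range_succ, Finset.sum_range_zero, Nat.factorial]
    norm_num
  have hX0 : 0 < Real.exp w - 1 := by linarith
  refine le_trans (uReal_le_of_majorant ha0 hw0
    (Q := fun s => g * (s + s ^ 2 / 4 + (1 / 12 - A) * s ^ 3 / 3 - A * s ^ 4 / 8
      + (C - A / 12) * s ^ 5 / 5 + C * s ^ 6 / 12 + C * s ^ 7 / 84))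
    (Q' := fun s => g * (1 - A * s ^ 2 + C * s ^ 4) * (1 + s / 2 + s ^ 2 / 12)) (by simp)
    (fun s => ?_) (fun s hs => ?_) ?_) ?_
  · have hp : ∀ n : ℕ, HasDerivAt (fun s : ℝ => s ^ n) (n * s ^ (n - 1)) s :=
      fun n => hasDerivAt_pow n s
    refine (((((((hasDerivAt_id s).add ((hp 2).div_const 4)).add
      (((hp 3).const_mul (1 / 12 - A)).div_const 3)).sub (((hp 4).const_mul A).div_const 8)).add
      (((hp 5).const_mul (C - A / 12)).div_const 5)).add (((hp 6).const_mul C).div_const 12)).add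
      (((hp 7).const_mul C).div_const 84)).const_mul g |>.congr_deriv ?_
    norm_num
    ring
  · have hs0 := hs.1
    have hs1 : s < 0.596327 := hw ▸ hs.2
    have h1 : Real.exp (-(2 * (g * s))) ≤ Real.exp (-(s / a)) := by
      rw [Real.exp_le_exp, neg_le_neg_iff, div_le_iff₀ ha0]
      have : 1 ≤ 2 * g * a := by rw [hg]; linarith
      nlinarith
    have h2 := tanh_le_taylor (z := g * s) (by rw [hg]; positivity) (by rw [hg]; linarith)
    have h3 := inv_one_sub_exp_neg_le hs0 (by linarith)
    have h4 : (1 - Real.exp (-(s / a))) / (1 + Real.exp (-(s / a))) ≤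
        (1 - Real.exp (-(2 * (g * s)))) / (1 + Real.exp (-(2 * (g * s)))) := by
      have := Real.exp_pos (-(2 * (g * s)))
      have := Real.exp_pos (-(s / a))
      rw [div_le_div_iff₀ (by linarith) (by linarith)]
      nlinarith
    have h5 : 0 ≤ 1 / (1 - Real.exp (-s)) := by
      have : Real.exp (-s) < 1 := Real.exp_lt_one_iff.2 (by linarith)
      exact one_div_nonneg.2 (by linarith)
    have h6 : 0 ≤ g * s - (g * s) ^ 3 / 3 + 2 * (g * s) ^ 5 / 15 := by
      refine le_trans (div_nonneg ?_ ?_) h2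
      · have : Real.exp (-(2 * (g * s))) ≤ 1 := Real.exp_le_one_iff.2 (by rw [hg]; linarith)
        linarith
      · positivity
    calc _ = (1 - Real.exp (-(s / a))) / (1 + Real.exp (-(s / a)))
          * (1 / (1 - Real.exp (-s))) := by rw [mul_one_div]
      _ ≤ (g * s - (g * s) ^ 3 / 3 + 2 * (g * s) ^ 5 / 15)
          * ((1 + s / 2 + s ^ 2 / 12) / s) := mul_le_mul (h4.trans h2) h3 h5 h6
      _ = _ := by
          rw [hA, hC]
          field_simp
  · have hQ : g * (w + w ^ 2 / 4 + (1 / 12 - A) * w ^ 3 / 3 - A * w ^ 4 / 8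
        + (C - A / 12) * w ^ 5 / 5 + C * w ^ 6 / 12 + C * w ^ 7 / 84) ≤ 0.204027 := by
      rw [hA, hC, hg, hw]; norm_num
    refine hQ.trans ?_
    rw [le_neg, Real.log_le_iff_le_exp hX0, Real.exp_neg, le_inv_comm₀ hX0 (Real.exp_pos _)]
    refine hq1.trans ?_
    rw [le_inv_comm₀ (by norm_num) hX0]
    refine le_trans (by linarith) (show (0.8154385 : ℝ) ≤ _ by norm_num)
  · rw [neg_le, Real.le_log_iff_exp_le hX0, Real.exp_neg]
    refine (inv_anti₀ (by norm_num) hq2).trans ?_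
    refine le_trans (show _ ≤ (0.8154384 : ℝ) by norm_num) (by linarith)

lemma vTerm_le_telescope {a : ℝ} (ha : 1 < a) (m : ℕ) :
    vTerm a m ≤ 1 / (((m : ℝ) + 1 / 2) * a - 1 / 2) - 1 / (((m : ℝ) + 1 + 1 / 2) * a - 1 / 2) := by
  have hm : (0 : ℝ) ≤ m := Nat.cast_nonneg m
  have h1 : 0 < ((m : ℝ) + 1 / 2) * a - 1 / 2 := by nlinarith
  have h2 : 0 < ((m : ℝ) + 1 + 1 / 2) * a - 1 / 2 := by nlinarith
  have h3 := mul_sub_one_pos ha m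
  unfold vTerm
  rw [div_sub_div _ _ h1.ne' h2.ne', div_le_div_iff₀ (by positivity) (by positivity)]
  nlinarith

lemma tsum_vTerm_le_sum {a : ℝ} (ha : 1 < a) (M : ℕ) :
    ∑' m, vTerm a m ≤ ∑ m ∈ Finset.range M, vTerm a m + 1 / (((M : ℝ) + 1 / 2) * a - 1 / 2) := by
  refine Real.tsum_le_of_sum_range_le (vTerm_nonneg ha) fun n => ?_
  have hpos : ∀ k : ℕ, 0 < 1 / (((k : ℝ) + 1 / 2) * a - 1 / 2) := fun k => by
    have hk : (0 : ℝ) ≤ k := Nat.cast_nonneg k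
    exact one_div_pos.2 (by nlinarith)
  have hind : ∀ d : ℕ, ∑ m ∈ Finset.range (M + d), vTerm a m ≤ ∑ m ∈ Finset.range M, vTerm a m
      + (1 / (((M : ℝ) + 1 / 2) * a - 1 / 2) - 1 / ((((M + d : ℕ) : ℝ) + 1 / 2) * a - 1 / 2)) := by
    intro d
    induction d with
    | zero => simp
    | succ d ih =>
      rw [← add_assoc, Finset.sum_range_succ]
      have := vTerm_le_telescope ha (M + d)
      push_cast at this ih ⊢
      linarith
  have h1 : ∑ m ∈ Finset.range n, vTerm a m ≤ ∑ m ∈ Finset.range (M + n), vTerm a m :=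
    Finset.sum_le_sum_of_subset_of_nonneg (Finset.range_mono (by omega))
      fun i _ _ => vTerm_nonneg ha i
  linarith [hind n, hpos (M + n)]

lemma tsum_vTerm_le_numeric {a : ℝ} (ha : 1.68746 ≤ a) : ∑' m, vTerm a m ≤ 1.931247 := by
  have h1 : (1 : ℝ) < 1.68746 := by norm_num
  calc ∑' m, vTerm a m ≤ ∑' m, vTerm 1.68746 m := by
        refine (summable_vTerm (by linarith)).tsum_le_tsum (fun m => ?_) (summable_vTerm h1)
        have h2 := mul_sub_one_pos h1 m
        unfold vTerm
        gcongr
    _ ≤ _ := tsum_vTerm_le_sum h1 30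
    _ ≤ _ := by
        simp only [Finset.sum_range_succ, Finset.sum_range_zero, vTerm]
        norm_num

/-- The inequality `log k(a) < 0` for `a ≥ 1.68746`. -/
lemma two_mul_uReal_add_lt {a : ℝ} (ha : 1.68746 ≤ a) :
    2 * uReal a + ∑' m, vTerm a m < a * Real.log 4 := by
  have h1 := uReal_le_numeric ha
  have h2 := tsum_vTerm_le_numeric ha
  have h3 : Real.log 4 = 2 * Real.log 2 := by
    rw [show (4 : ℝ) = 2 ^ 2 by norm_num, Real.log_pow]
    norm_num
  have h4 := Real.log_two_gt_d9
  rw [h3]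
  nlinarith

/-! ### Finite Jacobi matrices -/

/-- The `(n + 1) × (n + 1)` section of the Jacobi matrix with off-diagonal entries `b_i`, with the
last diagonal entry replaced by `t`. -/
noncomputable def jacobi (b : ℕ → ℝ) (t : ℝ) (n : ℕ) : Matrix (Fin (n + 1)) (Fin (n + 1)) ℝ :=
  Matrix.of fun i j => (if (j : ℕ) = i + 1 then b i else 0) + (if (i : ℕ) = j + 1 then b j else 0)
    + (if (i : ℕ) = n ∧ (j : ℕ) = n then t else 0)

lemma jacobi_isHermitian (b : ℕ → ℝ) (t : ℝ) (n : ℕ) : (jacobi b t n).IsHermitian := by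
  ext i j
  simp only [jacobi, Matrix.conjTranspose_apply, Matrix.of_apply, star_trivial]
  rw [add_comm (ite _ _ _) (ite _ _ _)]
  simp only [and_comm]

lemma jacobi_mulVec (b : ℕ → ℝ) (t : ℝ) (n : ℕ) (x : ℕ → ℝ) (i : Fin (n + 1)) :
    (jacobi b t n).mulVec (fun j => x j) i = (if (i : ℕ) < n then b i * x (i + 1) else 0)
      + (if (i : ℕ) = 0 then 0 else b (i - 1) * x (i - 1))
      + (if (i : ℕ) = n then t * x n else 0) := by
  have e : (jacobi b t n).mulVec (fun j => x j) i = ∑ j ∈ Finset.range (n + 1),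
      ((if j = (i : ℕ) + 1 then b i else 0) + (if (i : ℕ) = j + 1 then b j else 0)
        + (if (i : ℕ) = n ∧ j = n then t else 0)) * x j := by
    rw [← Fin.sum_univ_eq_sum_range (fun j => ((if j = (i : ℕ) + 1 then b i else 0)
      + (if (i : ℕ) = j + 1 then b j else 0) + (if (i : ℕ) = n ∧ j = n then t else 0)) * x j)]
    rfl
  rw [e]
  simp only [add_mul, Finset.sum_add_distrib, ite_mul, zero_mul]
  congr 1
  · congr 1
    · rw [Finset.sum_ite_eq']
      simp
    · obtain ⟨i, hi⟩ := i
      cases i with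
      | zero => simp
      | succ i =>
        simp only [add_left_inj, Finset.sum_ite_eq, Finset.mem_range]
        rw [if_pos (by omega)]
        simp
  · by_cases h : (i : ℕ) = n
    · simp [h]
    · simp [h]

/-- The spectral theorem for a real symmetric matrix, in coordinates. -/
lemma exists_spectral {m : ℕ} {A : Matrix (Fin m) (Fin m) ℝ} (hA : A.IsHermitian) :
    ∃ (l : Fin m → ℝ) (e : Fin m → Fin m → ℝ),
      (∀ i y, e i ⬝ᵥ A.mulVec y = l i * (e i ⬝ᵥ y)) ∧
      ∀ x y, ∑ i, (e i ⬝ᵥ x) * (e i ⬝ᵥ y) = x ⬝ᵥ y := by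
  refine ⟨hA.eigenvalues, fun i => WithLp.ofLp (hA.eigenvectorBasis i), fun i y => ?_,
    fun x y => ?_⟩
  · rw [Matrix.dotProduct_mulVec, ← Matrix.mulVec_transpose]
    have hT : A.transpose = A := by
      have := hA.eq
      rwa [Matrix.conjTranspose_eq_transpose_of_trivial] at this
    rw [hT, hA.mulVec_eigenvectorBasis, smul_dotProduct, smul_eq_mul]
  · have h := hA.eigenvectorBasis.sum_inner_mul_inner (WithLp.toLp 2 x) (WithLp.toLp 2 y)
    simp only [EuclideanSpace.inner_eq_star_dotProduct, star_trivial] at h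
    rw [dotProduct_comm, ← h]
    refine Finset.sum_congr rfl fun i _ => ?_
    rw [dotProduct_comm y]

/-- A Gauss-type quadrature with a prescribed node `x₀`: the spectral measure of a finite Jacobi
matrix whose last diagonal entry is chosen so that `(P_0(x₀), …, P_n(x₀))` is an eigenvector. By the
Cauchy--Schwarz inequality, its mass at `x₀` is at least `1 / ∑_{j ≤ n} P_j(x₀) ^ 2`. -/
lemma IsSymmetricProblem.exists_quadrature {μ : Measure ℝ} {P : ℕ → ℝ[X]} {b : ℕ → ℝ}
    (h : IsSymmetricProblem μ P b) {n : ℕ} (hn : n ≠ 0) {x₀ : ℝ} (hx₀ : (P n).eval x₀ ≠ 0) :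
    ∃ ν : ProbabilityMeasure ℝ, (∀ k ≤ n, Integrable (fun x => x ^ k) (ν : Measure ℝ) ∧
      ∫ x, x ^ k ∂(ν : Measure ℝ) = moment μ k) ∧
      ENNReal.ofReal (1 / ∑ j ∈ Finset.range (n + 1), (P j).eval x₀ ^ 2)
        ≤ (ν : Measure ℝ) {x₀} := by
  have := h.prob
  set t : ℝ := (x₀ * (P n).eval x₀ - b (n - 1) * (P (n - 1)).eval x₀) / (P n).eval x₀ with ht
  obtain ⟨l, e, he, hpars⟩ := exists_spectral (jacobi_isHermitian b t n)
  set u : ℕ → Fin (n + 1) → ℝ := fun k j => monoCoeff b k j with hu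
  set p : Fin (n + 1) → ℝ := fun j => (P j).eval x₀ with hp
  have hu_succ : ∀ k < n, (jacobi b t n).mulVec (u k) = u (k + 1) := by
    intro k hk
    ext ⟨i, hi⟩
    rw [hu, jacobi_mulVec b t n (monoCoeff b k)]
    simp only
    have h3 : (if i = n then t * monoCoeff b k n else 0) = 0 := by
      rw [monoCoeff_eq_zero_of_lt b hk]; simp
    rw [h3, add_zero]
    have h1 : (if i < n then b i * monoCoeff b k (i + 1) else 0) = b i * monoCoeff b k (i + 1) := by
      split_ifs with hin
      · rfl
      · rw [monoCoeff_eq_zero_of_lt b (by omega), mul_zero]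
    rw [h1]
    cases i with
    | zero => simp [monoCoeff]
    | succ i => simp [monoCoeff]; ring
  have hp_eig : (jacobi b t n).mulVec p = x₀ • p := by
    ext ⟨i, hi⟩
    rw [hp, jacobi_mulVec b t n fun j => (P j).eval x₀]
    simp only [Pi.smul_apply, smul_eq_mul]
    rcases (Nat.lt_succ_iff.1 hi).lt_or_eq with hlt | rfl
    · rw [if_pos hlt, if_neg hlt.ne, add_zero]
      cases i with
      | zero => simp [h.eval_rec_zero]
      | succ i => simp [h.eval_rec_succ]
    · rw [if_neg (lt_irrefl _), if_neg hn, if_pos rfl, ht]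
      field_simp
      ring
  have hlam : ∀ k ≤ n, ∀ i, e i ⬝ᵥ u k = l i ^ k * (e i ⬝ᵥ u 0) := by
    intro k
    induction k with
    | zero => intro _ i; simp
    | succ k ih =>
      intro hk i
      rw [← hu_succ k (by omega), he, ih (by omega), pow_succ]
      ring
  have hl : ∀ i, l i ≠ x₀ → e i ⬝ᵥ p = 0 := by
    intro i hi
    have h1 := he i p
    rw [hp_eig, dotProduct_smul, smul_eq_mul] at h1
    have h2 : (x₀ - l i) * (e i ⬝ᵥ p) = 0 := by linarith
    exact (mul_eq_zero.1 h2).resolve_left (sub_ne_zero.2 (Ne.symm hi))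
  set w : Fin (n + 1) → ℝ := fun i => (e i ⬝ᵥ u 0) ^ 2 with hw
  have hwnn : ∀ i, 0 ≤ w i := fun i => sq_nonneg _
  set ν : Measure ℝ := ∑ i, ENNReal.ofReal (w i) • Measure.dirac (l i) with hν
  have hint : ∀ k : ℕ, Integrable (fun x : ℝ => x ^ k) ν := by
    intro k
    rw [hν, integrable_finsetSum_measure]
    exact fun i _ => (integrable_dirac (by simp)).smul_measure ENNReal.ofReal_ne_top
  have hmom : ∀ k ≤ n, ∫ x, x ^ k ∂ν = moment μ k := by
    intro k hk
    rw [hν, integral_finsetSum_measure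
      fun i _ => (integrable_dirac (by simp)).smul_measure ENNReal.ofReal_ne_top]
    simp only [integral_smul_measure, integral_dirac, ENNReal.toReal_ofReal (sq_nonneg _), hw,
      smul_eq_mul]
    have h1 : ∀ i, (e i ⬝ᵥ u 0) ^ 2 * l i ^ k = (e i ⬝ᵥ u 0) * (e i ⬝ᵥ u k) := fun i => by
      rw [hlam k hk i]; ring
    simp_rw [h1]
    rw [hpars]
    have h2 := h.moment_add 0 k
    rw [zero_add] at h2
    rw [h2]
    simp [dotProduct, hu, monoCoeff]
  have hprob : IsProbabilityMeasure ν := by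
    have h1 : ν Set.univ = ENNReal.ofReal (∑ i, w i) := by
      rw [hν, Measure.finsetSum_apply, ENNReal.ofReal_sum_of_nonneg fun i _ => hwnn i]
      simp
    refine ⟨?_⟩
    have h2 : ∑ i, w i = 1 := by
      have := hpars (u 0) (u 0)
      simp_rw [← sq] at this
      rw [hw, this]
      simp [dotProduct, hu, monoCoeff]
    rw [h1, h2, ENNReal.ofReal_one]
  refine ⟨⟨ν, hprob⟩, fun k hk => ⟨hint k, hmom k hk⟩, ?_⟩
  change _ ≤ ν {x₀}
  have hmass : ν {x₀} = ENNReal.ofReal (∑ i with l i = x₀, w i) := by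
    rw [hν, Measure.finsetSum_apply, ENNReal.ofReal_sum_of_nonneg fun i _ => hwnn i,
      Finset.sum_filter]
    refine Finset.sum_congr rfl fun i _ => ?_
    simp only [Measure.smul_apply, smul_eq_mul, Measure.dirac_apply, Set.indicator_apply,
      Set.mem_singleton_iff, Pi.one_apply, mul_ite, mul_one, mul_zero]
  rw [hmass]
  refine ENNReal.ofReal_le_ofReal ?_
  have hone : ∑ i with l i = x₀, (e i ⬝ᵥ u 0) * (e i ⬝ᵥ p) = 1 := by
    rw [Finset.sum_filter_of_ne fun i _ hi => by
      by_contra hne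
      rw [hl i hne, mul_zero] at hi
      exact hi rfl, hpars]
    simp [dotProduct, hu, hp, monoCoeff, h.P_zero]
  have hcs := Finset.sum_mul_sq_le_sq_mul_sq (Finset.univ.filter fun i => l i = x₀)
    (fun i => e i ⬝ᵥ u 0) (fun i => e i ⬝ᵥ p)
  rw [hone] at hcs
  have hpp : ∑ i with l i = x₀, (e i ⬝ᵥ p) ^ 2 ≤ ∑ j ∈ Finset.range (n + 1), (P j).eval x₀ ^ 2 := by
    calc _ ≤ ∑ i, (e i ⬝ᵥ p) ^ 2 :=
          Finset.sum_le_sum_of_subset_of_nonneg (Finset.filter_subset _ _) fun _ _ _ => sq_nonneg _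
      _ = p ⬝ᵥ p := by simp_rw [sq]; exact hpars p p
      _ = _ := by
          rw [← Fin.sum_univ_eq_sum_range (fun j => (P j).eval x₀ ^ 2)]
          simp [dotProduct, hp, sq]
  have hw0 : 0 ≤ ∑ i with l i = x₀, w i := Finset.sum_nonneg fun _ _ => sq_nonneg _
  have hpos : 0 < ∑ j ∈ Finset.range (n + 1), (P j).eval x₀ ^ 2 :=
    Finset.sum_pos' (fun _ _ => sq_nonneg _) ⟨n, by simp, by positivity⟩
  rw [div_le_iff₀ hpos]
  nlinarith

/-! ### Weak limits with prescribed moments -/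

lemma isTightMeasureSet_of_second_moment {S : Set (ProbabilityMeasure ℝ)} {s₂ : ℝ}
    (hS : ∀ ν ∈ S, Integrable (fun x => x ^ 2) (ν : Measure ℝ) ∧
      ∫ x, x ^ 2 ∂(ν : Measure ℝ) = s₂) :
    IsTightMeasureSet {((ν : ProbabilityMeasure ℝ) : Measure ℝ) | ν ∈ S} := by
  refine isTightMeasureSet_of_tendsto_measure_norm_gt ?_
  have hlim : Tendsto (fun r : ℝ => ENNReal.ofReal (s₂ / r ^ 2)) atTop (𝓝 0) := by
    rw [← ENNReal.ofReal_zero]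
    exact (ENNReal.continuous_ofReal.tendsto 0).comp
      (tendsto_const_nhds.div_atTop (tendsto_pow_atTop two_ne_zero))
  refine tendsto_of_tendsto_of_tendsto_of_le_of_le' tendsto_const_nhds hlim
    (Eventually.of_forall fun _ => zero_le) ?_
  filter_upwards [eventually_gt_atTop 0] with r hr
  refine iSup₂_le ?_
  rintro _ ⟨ν, hν, rfl⟩
  have h1 := mul_meas_ge_le_integral_of_nonneg (μ := (ν : Measure ℝ))
    (Eventually.of_forall fun x : ℝ => sq_nonneg x) (hS ν hν).1 (r ^ 2)
  rw [(hS ν hν).2] at h1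
  have h2 : (ν : Measure ℝ) {x | r < ‖x‖} ≤ (ν : Measure ℝ) {x | r ^ 2 ≤ x ^ 2} :=
    measure_mono fun x hx => by
      have hx : r < |x| := hx
      change r ^ 2 ≤ x ^ 2
      rw [← sq_abs x]
      gcongr
  refine h2.trans ?_
  rw [← ENNReal.ofReal_toReal (measure_ne_top (ν : Measure ℝ) _)]
  refine ENNReal.ofReal_le_ofReal ?_
  rw [le_div_iff₀ (by positivity), mul_comm]
  exact h1

/-- A sequence of probability measures whose moments of each order are eventually those of a
sequence `s` has a weak limit point with moments `s`; masses at a point pass to the limit. -/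
lemma exists_limit_measure {s : ℕ → ℝ} {ν : ℕ → ProbabilityMeasure ℝ} {x₀ : ℝ} {ρ : ℝ≥0∞}
    (hν : ∀ n, ∀ k ≤ n + 2, Integrable (fun x => x ^ k) (ν n : Measure ℝ) ∧
      ∫ x, x ^ k ∂(ν n : Measure ℝ) = s k)
    (hρ : ∀ n, ρ ≤ (ν n : Measure ℝ) {x₀}) :
    ∃ ν' : Measure ℝ, HasAllMoments ν' ∧ (∀ k, moment ν' k = s k) ∧ ρ ≤ ν' {x₀} := by
  have hcomp := isCompact_closure_of_isTightMeasureSet (isTightMeasureSet_of_second_moment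
    (S := Set.range ν) (s₂ := s 2) (by rintro _ ⟨n, rfl⟩; exact hν n 2 (by omega)))
  obtain ⟨ν', -, hlim⟩ := hcomp.ultrafilter_le_nhds' (Ultrafilter.map ν (hyperfilter ℕ))
    (mem_of_superset (by
      change Set.range ν ∈ Filter.map ν _
      exact Filter.range_mem_map) subset_closure)
  have hlim : Tendsto ν (hyperfilter ℕ : Filter ℕ) (𝓝 ν') := hlim
  have hle : (hyperfilter ℕ : Filter ℕ) ≤ atTop := by
    rw [← Nat.cofinite_eq_atTop]; exact hyperfilter_le_cofinite
  have hweak := ProbabilityMeasure.tendsto_iff_forall_integral_tendsto.1 hlim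
  -- The truncations of `x ^ k` at height `R` have integrals within `s_{2k} / R` of `s_k`.
  have hclamp : ∀ x R : ℝ, 0 < R → |max (-R) (min x R) - x| ≤ x ^ 2 / R := by
    intro x R hR
    rw [le_div_iff₀ hR]
    rcases le_total x R with h1 | h1
    · rw [min_eq_left h1]
      rcases le_total (-R) x with h2 | h2
      · rw [max_eq_right h2, sub_self, abs_zero, zero_mul]; positivity
      · rw [max_eq_left h2, abs_of_nonneg (by linarith)]; nlinarith
    · rw [min_eq_right h1, max_eq_right (by linarith), abs_of_nonpos (by linarith)]; nlinarith
  have hgb : ∀ x R : ℝ, 0 < R → ‖max (-R) (min x R)‖ ≤ R := by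
    intro x R hR
    rw [Real.norm_eq_abs, abs_le]
    exact ⟨le_max_left _ _, max_le (by linarith) (min_le_right _ _)⟩
  have hcl : ∀ (m : Measure ℝ) [IsFiniteMeasure m] (k : ℕ) (R : ℝ), 0 < R →
      Integrable (fun x : ℝ => max (-R) (min (x ^ k) R)) m := fun m _ k R hR =>
    Integrable.of_bound (Continuous.aestronglyMeasurable (by fun_prop)) R
      (Eventually.of_forall fun x => hgb _ R hR)
  have hdist : ∀ (m : Measure ℝ) [IsFiniteMeasure m] (k : ℕ) (R : ℝ), 0 < R →
      Integrable (fun x : ℝ => x ^ k) m → Integrable (fun x : ℝ => x ^ (2 * k)) m →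
      |∫ x, max (-R) (min (x ^ k) R) ∂m - ∫ x, x ^ k ∂m| ≤ (∫ x, x ^ (2 * k) ∂m) / R := by
    intro m _ k R hR h1 h2
    rw [← integral_sub (hcl m k R hR) h1, ← integral_div]
    refine (abs_integral_le_integral_abs).trans ?_
    refine integral_mono ((hcl m k R hR).sub h1).abs (h2.div_const R) fun x => ?_
    simp only
    rw [mul_comm 2 k, pow_mul]
    exact hclamp _ R hR
  have hconv : ∀ (k : ℕ) (R : ℝ), 0 < R →
      Tendsto (fun n => ∫ x, max (-R) (min (x ^ k) R) ∂(ν n : Measure ℝ))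
        (hyperfilter ℕ : Filter ℕ) (𝓝 (∫ x, max (-R) (min (x ^ k) R) ∂(ν' : Measure ℝ))) :=
    fun k R hR => hweak (BoundedContinuousFunction.ofNormedAddCommGroup
      (fun x : ℝ => max (-R) (min (x ^ k) R)) (by fun_prop) R fun x => hgb _ R hR)
  have heven : ∀ k, Integrable (fun x : ℝ => x ^ (2 * k)) (ν' : Measure ℝ) := by
    intro k
    refine ⟨by fun_prop, ?_⟩
    have hnn : ∀ x : ℝ, 0 ≤ x ^ (2 * k) := fun x => by rw [mul_comm, pow_mul]; positivity
    rw [hasFiniteIntegral_iff_ofReal (Eventually.of_forall hnn)]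
    have hbound : ∀ N : ℕ, ∫⁻ x, ENNReal.ofReal (max (-((N : ℝ) + 1))
        (min (x ^ (2 * k)) (N + 1))) ∂(ν' : Measure ℝ) ≤ ENNReal.ofReal (s (2 * k)) := by
      intro N
      have hN : (0 : ℝ) < N + 1 := by positivity
      rw [← ofReal_integral_eq_lintegral_ofReal (hcl _ _ _ hN) (Eventually.of_forall fun x =>
        le_max_of_le_right (le_min (hnn x) hN.le))]
      refine ENNReal.ofReal_le_ofReal (le_of_tendsto (hconv (2 * k) _ hN) ?_)
      filter_upwards [hle (eventually_ge_atTop (2 * k))] with n hn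
      have hn2 := hν n (2 * k) (by omega)
      rw [← hn2.2]
      refine integral_mono (hcl _ _ _ hN) hn2.1 fun x => ?_
      exact max_le (by linarith [hnn x]) (min_le_left _ _)
    refine lt_of_le_of_lt ?_ (ENNReal.ofReal_lt_top (r := s (2 * k)))
    have hpt : ∀ x : ℝ, ENNReal.ofReal (x ^ (2 * k)) = liminf (fun N : ℕ =>
        ENNReal.ofReal (max (-((N : ℝ) + 1)) (min (x ^ (2 * k)) (N + 1)))) atTop := by
      intro x
      refine (Tendsto.liminf_eq (tendsto_const_nhds.congr' ?_)).symm
      filter_upwards [eventually_ge_atTop ⌈x ^ (2 * k)⌉₊] with N hN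
      have h1 : x ^ (2 * k) ≤ N := (Nat.le_ceil _).trans (by exact_mod_cast hN)
      rw [min_eq_left (by linarith), max_eq_right]
      linarith [hnn x, Nat.cast_nonneg (α := ℝ) N]
    calc _ = ∫⁻ x, liminf (fun N : ℕ => ENNReal.ofReal (max (-((N : ℝ) + 1))
          (min (x ^ (2 * k)) (N + 1)))) atTop ∂(ν' : Measure ℝ) := by
          refine lintegral_congr fun x => hpt x
      _ ≤ liminf (fun N : ℕ => ∫⁻ x, ENNReal.ofReal (max (-((N : ℝ) + 1))
          (min (x ^ (2 * k)) (N + 1))) ∂(ν' : Measure ℝ)) atTop :=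
          lintegral_liminf_le fun N => by fun_prop
      _ ≤ _ := liminf_le_of_le (by isBoundedDefault) fun c hc => by
          obtain ⟨N, hN⟩ := hc.exists
          exact hN.trans (hbound N)
  have hall : HasAllMoments (ν' : Measure ℝ) := by
    intro k
    refine Integrable.mono' ((integrable_const (1 : ℝ)).add (heven k)) (by fun_prop)
      (Eventually.of_forall fun x => ?_)
    simp only [Pi.add_apply]
    rw [Real.norm_eq_abs, mul_comm 2 k, pow_mul, ← sq_abs]
    nlinarith [sq_nonneg (|x ^ k| - 1), abs_nonneg (x ^ k)]
  refine ⟨ν', hall, fun k => ?_, ?_⟩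
  · have hR : ∀ R : ℝ, 0 < R → |moment ν' k - s k| ≤ (s (2 * k) + moment ν' (2 * k)) / R := by
      intro R hR
      have h1 := hdist ν' k R hR (hall k) (heven k)
      have h2 : |∫ x, max (-R) (min (x ^ k) R) ∂(ν' : Measure ℝ) - s k| ≤ s (2 * k) / R := by
        refine le_of_tendsto ((hconv k R hR).sub_const (s k)).abs ?_
        filter_upwards [hle (eventually_ge_atTop (2 * k))] with n hn
        have hk := hν n k (by omega)
        have h2k := hν n (2 * k) (by omega)
        have := hdist (ν n) k R hR hk.1 h2k.1
        rwa [hk.2, h2k.2] at this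
      unfold moment
      rw [add_div]
      rw [abs_le] at h1 h2 ⊢
      constructor <;> linarith [h1.1, h1.2, h2.1, h2.2]
    have hlim0 : Tendsto (fun R : ℝ => (s (2 * k) + moment ν' (2 * k)) / R) atTop (𝓝 0) :=
      tendsto_const_nhds.div_atTop tendsto_id
    have h0 : |moment ν' k - s k| ≤ 0 := ge_of_tendsto hlim0
      ((eventually_gt_atTop 0).mono fun R hR0 => hR R hR0)
    exact sub_eq_zero.1 (abs_nonpos_iff.1 h0)
  · refine le_trans ?_ (ProbabilityMeasure.limsup_measure_closed_le_of_tendsto hlim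
      (isClosed_singleton (x := x₀)))
    exact le_limsup_of_frequently_le (Eventually.of_forall hρ).frequently

/-! ### Indeterminacy -/

lemma IsSymmetricProblem.eval_ne_zero_or {μ : Measure ℝ} {P : ℕ → ℝ[X]} {b : ℕ → ℝ}
    (h : IsSymmetricProblem μ P b) (x : ℝ) (n : ℕ) :
    (P n).eval x ≠ 0 ∨ (P (n + 1)).eval x ≠ 0 := by
  induction n with
  | zero => left; simp [h.P_zero]
  | succ n ih =>
    by_contra hne
    push Not at hne
    have h1 := h.eval_rec_succ x n
    rw [hne.1, hne.2, mul_zero, mul_zero, zero_add] at h1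
    rcases ih with h2 | h2
    · exact mul_ne_zero (h.b_pos n).ne' h2 h1.symm
    · exact h2 hne.1

/-- If `∑ P_n(x) ^ 2` converges for all `x` near `0`, then for each such `x` there is a measure with
the moments of `μ` and an atom at `x`. These measures cannot all be equal to `μ`, as `μ` has only
countably many atoms. -/
lemma IsSymmetricProblem.indeterminate_of_summable {μ : Measure ℝ} {P : ℕ → ℝ[X]} {b : ℕ → ℝ}
    (h : IsSymmetricProblem μ P b) {r : ℝ} (hr : 0 < r)
    (hs : ∀ x, |x| < r → Summable fun n => (P n).eval x ^ 2) : Indeterminate μ := by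
  have := h.prob
  by_contra hdet
  have hpos : ∀ x, |x| < r → 0 < μ {x} := by
    intro x hx
    have hφ : ∀ n : ℕ, ∃ m, n + 2 ≤ m ∧ (P m).eval x ≠ 0 := fun n => by
      rcases h.eval_ne_zero_or x (n + 2) with h1 | h1
      · exact ⟨_, le_rfl, h1⟩
      · exact ⟨_, by omega, h1⟩
    choose φ hφ1 hφ2 using hφ
    choose ν hν1 hν2 using fun n => h.exists_quadrature (by have := hφ1 n; omega) (hφ2 n)
    have hS : 0 < ∑' n, (P n).eval x ^ 2 :=
      (hs x hx).tsum_pos (fun _ => sq_nonneg _) 0 (by simp [h.P_zero])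
    obtain ⟨ν', hm1, hm2, hm3⟩ := exists_limit_measure (s := moment μ) (ν := ν) (x₀ := x)
      (ρ := ENNReal.ofReal (1 / ∑' n, (P n).eval x ^ 2))
      (fun n k hk => hν1 n k (hk.trans (hφ1 n)))
      (fun n => by
        refine le_trans (ENNReal.ofReal_le_ofReal ?_) (hν2 n)
        refine one_div_le_one_div_of_le ?_ ((hs x hx).sum_le_tsum _ fun _ _ => sq_nonneg _)
        exact Finset.sum_pos' (fun _ _ => sq_nonneg _) ⟨0, by simp, by simp [h.P_zero]⟩)
    have hνμ : ν' = μ := by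
      by_contra hne
      exact hdet ⟨ν', hne, hm1, hm2⟩
    rw [← hνμ]
    exact (ENNReal.ofReal_pos.2 (one_div_pos.2 hS)).trans_le hm3
  have hc : Set.Countable {x : ℝ | 0 < μ {x}} :=
    Measure.countable_meas_pos_of_disjoint_iUnion (fun x => measurableSet_singleton x)
      fun x y hxy => Set.disjoint_singleton.2 hxy
  have hsub : Set.Ioo (-r) r ⊆ {x : ℝ | 0 < μ {x}} := fun x hx => hpos x (abs_lt.2 hx)
  have h0 := (hc.mono hsub).measure_zero volume
  rw [Real.volume_Ioo, ENNReal.ofReal_eq_zero] at h0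
  linarith

section Rates

variable {μ : Measure ℝ} {P : ℕ → ℝ[X]} {b : ℕ → ℝ}

lemma PowerGrowth.exists_pos_le (hb : ∀ n, 0 < b n) {a : ℝ} (ha : 0 < a) {K : ℕ} (hK : 2 ≤ K)
    (hg : PowerGrowth b a K) : ∃ δ, 0 < δ ∧ ∀ n, δ ≤ b n := by
  obtain ⟨i, hi, hmin⟩ := Finset.exists_min_image (Finset.range (K + 1)) b ⟨0, by simp⟩
  refine ⟨b i, hb i, fun n => ?_⟩
  rcases lt_or_ge K n with h | h
  · have hin : i ≤ n := by have := Finset.mem_range.1 hi; omega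
    have h1 := hg n h.le i hin
    have h2 : (((i : ℝ) + K) / (n + K)) ^ a ≤ 1 := by
      refine Real.rpow_le_one (by positivity) ?_ ha.le
      have hK' : (2 : ℝ) ≤ K := by exact_mod_cast hK
      rw [div_le_one (by positivity)]
      gcongr
    exact (div_le_one (hb n)).1 (h1.trans h2)
  · exact hmin n (Finset.mem_range.2 (by omega))

/-- Power growth with exponent larger than `1` implies indeterminacy: the bound for `c_k` and the
Cauchy--Schwarz inequality give the convergence of `∑ P_n(x) ^ 2` for small `x`. -/
lemma IsSymmetricProblem.indeterminate (h : IsSymmetricProblem μ P b) {a : ℝ} (ha : 1 < a) {K : ℕ}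
    (hK : 2 ≤ K) (hg : PowerGrowth b a K) : Indeterminate μ := by
  obtain ⟨D, hD, hle⟩ := h.exists_sum_coeff_sq_le ha hK hg
  obtain ⟨δ, hδ, hδb⟩ := hg.exists_pos_le h.b_pos (by linarith) hK
  have ha1 : 0 < a - 1 := by linarith
  set v := ∑' m, vTerm a m with hv
  set κ : ℝ := 1 / (2 * (a - 1)) + v / 2 with hκ
  set C : ℝ := D * Real.exp (K * κ) with hC
  have hC0 : 0 < C := by positivity
  set q : ℝ := Real.exp κ with hq
  have hq0 : 0 < q := Real.exp_pos _
  have hcoef : ∀ k N, ∑ n ∈ Finset.range N, (P n).coeff k ^ 2 ≤ (C * (q / δ) ^ k) ^ 2 := by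
    intro k N
    have h1 := h.tsum_coeff_sq_le (hle k)
    have h2 : ENNReal.ofReal (∑ n ∈ Finset.range N, (P n).coeff k ^ 2) ≤ ENNReal.ofReal
        ((D * (1 + (k + K) / (2 * (a - 1))) * Real.exp ((k + K) / 2 * v)
          / ∏ i ∈ Finset.range k, b i) ^ 2) := by
      rw [ENNReal.ofReal_sum_of_nonneg fun i _ => sq_nonneg _]
      exact (ENNReal.sum_le_tsum _).trans h1
    have h3 := (ENNReal.ofReal_le_ofReal_iff (by positivity)).1 h2
    refine h3.trans ?_
    have hB : δ ^ k ≤ ∏ i ∈ Finset.range k, b i := by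
      calc δ ^ k = ∏ _i ∈ Finset.range k, δ := by simp
        _ ≤ _ := Finset.prod_le_prod (fun _ _ => hδ.le) fun i _ => hδb i
    have hpos : 0 < ∏ i ∈ Finset.range k, b i := Finset.prod_pos fun i _ => h.b_pos i
    have h4 : D * (1 + (k + K) / (2 * (a - 1))) * Real.exp ((k + K) / 2 * v) ≤ C * q ^ k := by
      have h5 : 1 + ((k : ℝ) + K) / (2 * (a - 1)) ≤ Real.exp (((k : ℝ) + K) / (2 * (a - 1))) := by
        linarith [Real.add_one_le_exp (((k : ℝ) + K) / (2 * (a - 1)))]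
      calc _ ≤ D * Real.exp (((k : ℝ) + K) / (2 * (a - 1))) * Real.exp ((k + K) / 2 * v) := by
            gcongr
        _ = _ := by
            rw [hC, hq, ← Real.exp_nat_mul, mul_assoc, mul_assoc, ← Real.exp_add, ← Real.exp_add]
            congr 2
            rw [hκ]
            field_simp
            ring
    rw [div_pow q, ← mul_div_assoc]
    gcongr
  set r : ℝ := δ / (4 * q) with hr
  have hr0 : 0 < r := by positivity
  refine h.indeterminate_of_summable hr0 fun x hx => ?_
  -- Cauchy--Schwarz with the weights `(2 r) ^ k`.
  have hgeo : ∀ N : ℕ, ∑ k ∈ Finset.range N, ((1 : ℝ) / 4) ^ k ≤ 2 := fun N => by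
    have h1 := (summable_geometric_of_lt_one (r := (1 : ℝ) / 4) (by norm_num)
      (by norm_num)).sum_le_tsum (Finset.range N) fun k _ => by positivity
    rw [tsum_geometric_of_lt_one (by norm_num) (by norm_num)] at h1
    norm_num at h1 ⊢
    linarith
  refine summable_of_sum_range_le (c := 4 * C ^ 2) (fun _ => sq_nonneg _) fun N => ?_
  have hP : ∀ n ∈ Finset.range N, (P n).eval x ^ 2 ≤
      2 * ∑ k ∈ Finset.range N, ((2 * r) ^ k) ^ 2 * (P n).coeff k ^ 2 := by
    intro n hn
    have hn := Finset.mem_range.1 hn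
    have e : (P n).eval x =
        ∑ k ∈ Finset.range N, ((2 * r) ^ k * (P n).coeff k) * (x / (2 * r)) ^ k := by
      rw [eval_eq_sum_range' (n := N) (by rw [h.ortho.natDegree_eq]; exact hn)]
      refine Finset.sum_congr rfl fun k _ => ?_
      rw [div_pow]
      field_simp
    have hcs := Finset.sum_mul_sq_le_sq_mul_sq (Finset.range N)
      (fun k => (2 * r) ^ k * (P n).coeff k) (fun k => (x / (2 * r)) ^ k)
    rw [← e] at hcs
    have h2 : ∑ k ∈ Finset.range N, ((x / (2 * r)) ^ k) ^ 2 ≤ 2 := by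
      refine (Finset.sum_le_sum fun k _ => ?_).trans (hgeo N)
      rw [← pow_mul, mul_comm k, pow_mul]
      refine pow_le_pow_left₀ (sq_nonneg _) ?_ k
      rw [← sq_abs, abs_div, abs_of_pos (by positivity : 0 < 2 * r)]
      have : |x| / (2 * r) ≤ 1 / 2 := by
        rw [div_le_div_iff₀ (by positivity) (by norm_num)]
        linarith
      have h0 : 0 ≤ |x| / (2 * r) := by positivity
      nlinarith
    have h3 : 0 ≤ ∑ k ∈ Finset.range N, ((2 * r) ^ k * (P n).coeff k) ^ 2 :=
      Finset.sum_nonneg fun _ _ => sq_nonneg _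
    simp_rw [← mul_pow]
    nlinarith
  calc _ ≤ ∑ n ∈ Finset.range N, 2 * ∑ k ∈ Finset.range N, ((2 * r) ^ k) ^ 2 * (P n).coeff k ^ 2 :=
        Finset.sum_le_sum hP
    _ = 2 * ∑ k ∈ Finset.range N, ((2 * r) ^ k) ^ 2 * ∑ n ∈ Finset.range N, (P n).coeff k ^ 2 := by
        rw [← Finset.mul_sum, Finset.sum_comm]
        simp_rw [Finset.mul_sum]
    _ ≤ 2 * ∑ k ∈ Finset.range N, ((2 * r) ^ k) ^ 2 * (C * (q / δ) ^ k) ^ 2 := by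
        gcongr with k _
        exact hcoef k N
    _ = 2 * (C ^ 2 * ∑ k ∈ Finset.range N, ((1 : ℝ) / 4) ^ k) := by
        rw [Finset.mul_sum (a := C ^ 2)]
        congr 1
        refine Finset.sum_congr rfl fun k _ => ?_
        have e : 2 * r * (q / δ) = 1 / 2 := by rw [hr]; field_simp; norm_num
        calc _ = C ^ 2 * ((2 * r * (q / δ)) ^ 2) ^ k := by
              rw [← pow_mul (2 * r * (q / δ)), mul_comm 2 k, pow_mul, mul_pow (2 * r)]
              ring
          _ = _ := by rw [e]; norm_num
    _ ≤ 2 * (C ^ 2 * 2) := by gcongr; exact hgeo N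
    _ = _ := by ring

/-! ### Exponential rates -/

lemma eventually_mul_pow_le_exp (C K : ℝ) (d : ℕ) {δ : ℝ} (hδ : 0 < δ) :
    ∀ᶠ n : ℕ in atTop, C * ((n : ℝ) + K) ^ d ≤ Real.exp (δ * n) := by
  have h1 : Tendsto (fun n : ℕ => C * ((n : ℝ) + K) ^ d * Real.exp (-(δ * n))) atTop (𝓝 0) := by
    have h2 : Tendsto (fun x : ℝ => x ^ d * Real.exp (-δ * x)) atTop (𝓝 0) := by
      simpa using tendsto_rpow_mul_exp_neg_mul_atTop_nhds_zero (d : ℝ) δ hδ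
    have h3 : Tendsto (fun n : ℕ => (n : ℝ) + K) atTop atTop :=
      tendsto_atTop_add_const_right _ _ tendsto_natCast_atTop_atTop
    have h4 := (h2.comp h3).const_mul (C * Real.exp (δ * K))
    rw [mul_zero] at h4
    refine h4.congr fun n => ?_
    have e : Real.exp (-(δ * n)) = Real.exp (δ * K) * Real.exp (-δ * (n + K)) := by
      rw [← Real.exp_add]; congr 1; ring
    simp only [Function.comp]
    rw [e]
    ring
  filter_upwards [h1.eventually (gt_mem_nhds zero_lt_one)] with n hn
  rw [Real.exp_neg, ← div_eq_mul_inv, div_lt_one (Real.exp_pos _)] at hn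
  exact hn.le

lemma limsup_rpow_le {x : ℕ → ℝ≥0∞} {r : ℝ}
    (h : ∀ L, r < L → ∀ᶠ n : ℕ in atTop, x n ≤ ENNReal.ofReal (Real.exp (n * L))) :
    limsup (fun n : ℕ => x n ^ (1 / (n : ℝ))) atTop ≤ ENNReal.ofReal (Real.exp r) := by
  have h1 : ∀ L, r < L →
      limsup (fun n : ℕ => x n ^ (1 / (n : ℝ))) atTop ≤ ENNReal.ofReal (Real.exp L) := by
    intro L hL
    refine limsup_le_of_le (by isBoundedDefault) ?_
    filter_upwards [h L hL, eventually_gt_atTop 0] with n hn hn0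
    have hn0' : (0 : ℝ) < n := by exact_mod_cast hn0
    refine (ENNReal.rpow_le_rpow hn (by positivity)).trans (le_of_eq ?_)
    rw [ENNReal.ofReal_rpow_of_pos (Real.exp_pos _), ← Real.exp_mul]
    congr 2
    field_simp
  have hc : Tendsto (fun L : ℝ => ENNReal.ofReal (Real.exp L)) (𝓝[>] r)
      (𝓝 (ENNReal.ofReal (Real.exp r))) :=
    ((ENNReal.continuous_ofReal.comp Real.continuous_exp).tendsto r).mono_left nhdsWithin_le_nhds
  exact ge_of_tendsto hc (eventually_mem_nhdsWithin.mono fun L hL => h1 L hL)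

lemma IsSymmetricProblem.eventually_U_le (h : IsSymmetricProblem μ P b) {a : ℝ} (ha : 0 < a)
    {K : ℕ} (hK : 2 ≤ K) (hg : PowerGrowth b a K) {L : ℝ} (hL : 2 * uReal a < L) :
    ∀ᶠ n : ℕ in atTop, U μ b n ≤ Real.exp (n * L) := by
  obtain ⟨D, hD, hle⟩ := h.exists_U_le ha hK hg
  have hm : 0 < min 1 a := lt_min one_pos ha
  have hK' : (2 : ℝ) ≤ K := by exact_mod_cast hK
  filter_upwards [eventually_mul_pow_le_exp
    ((D / min 1 a * Real.exp (K * uReal a)) ^ 2) K 3 (sub_pos.2 hL)] with n hn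
  refine (hle n).trans ?_
  have e : Real.exp (n * L) = Real.exp ((L - 2 * uReal a) * n) * Real.exp (n * uReal a) ^ 2 := by
    rw [← Real.exp_nat_mul, ← Real.exp_add]
    congr 1
    push_cast
    ring
  have e2 : Real.exp ((n + K) * uReal a) = Real.exp (K * uReal a) * Real.exp (n * uReal a) := by
    rw [← Real.exp_add]; congr 1; ring
  rw [e, e2]
  calc _ = (D / min 1 a * Real.exp (K * uReal a)) ^ 2 * ((n + 1) * ((n : ℝ) + K) ^ 2)
        * Real.exp (n * uReal a) ^ 2 := by ring
    _ ≤ (D / min 1 a * Real.exp (K * uReal a)) ^ 2 * ((n : ℝ) + K) ^ 3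
        * Real.exp (n * uReal a) ^ 2 := by
        gcongr
        rw [pow_succ' _ 2]
        gcongr
        linarith
    _ ≤ _ := by gcongr

lemma eventually_mul_exp_le {D s K v L : ℝ} (hs : 0 < s) (hL : v / 2 < L) :
    ∀ᶠ n : ℕ in atTop, D * (1 + (n + K) / s) * Real.exp ((n + K) / 2 * v) ≤ Real.exp (n * L) := by
  filter_upwards [eventually_mul_pow_le_exp (D * (1 / s) * Real.exp (K / 2 * v)) (K + s) 1
    (sub_pos.2 hL)] with n hn
  have e : Real.exp (n * L) = Real.exp ((L - v / 2) * n) * Real.exp (n / 2 * v) := by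
    rw [← Real.exp_add]; congr 1; ring
  have e2 : Real.exp ((n + K) / 2 * v) = Real.exp (K / 2 * v) * Real.exp (n / 2 * v) := by
    rw [← Real.exp_add]; congr 1; ring
  rw [e, e2, ← mul_assoc]
  refine mul_le_mul_of_nonneg_right (le_trans (le_of_eq ?_) hn) (Real.exp_pos _).le
  field_simp
  ring

lemma IsSymmetricProblem.eventually_V_le (h : IsSymmetricProblem μ P b) {a : ℝ} (ha : 1 < a)
    {K : ℕ} (hK : 2 ≤ K) (hg : PowerGrowth b a K) {L : ℝ} (hL : (∑' m, vTerm a m) / 2 < L) :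
    ∀ᶠ n : ℕ in atTop, V P b n ≤ ENNReal.ofReal (Real.exp (n * L)) := by
  obtain ⟨D, hD, hle⟩ := h.exists_V_le ha hK hg
  filter_upwards [eventually_mul_exp_le (D := D) (s := 2 * (a - 1)) (K := K)
    (by linarith : 0 < 2 * (a - 1)) hL] with n hn
  exact (hle n).trans (ENNReal.ofReal_le_ofReal hn)

/-! ### Property (cs*) -/

lemma tsum_lt_top_of_eventually_le {g : ℕ → ℝ≥0∞} {T : ℕ → ℝ} (hT : Summable T)
    (hg : ∀ n, g n ≠ ⊤) (h : ∀ᶠ n in atTop, g n ≤ ENNReal.ofReal (T n)) : ∑' n, g n < ⊤ := by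
  obtain ⟨N, hN⟩ := eventually_atTop.1 h
  rw [← ENNReal.summable.sum_add_tsum_nat_add' (k := N)]
  refine ENNReal.add_lt_top.2 ⟨ENNReal.sum_lt_top.2 fun i _ => (hg i).lt_top, ?_⟩
  refine lt_of_le_of_lt (ENNReal.tsum_le_tsum fun i => hN (i + N) (by omega)) ?_
  exact ((summable_nat_add_iff N).2 hT).tsum_ofReal_lt_top

/-- The products `∏_{t < d} (t + M) / (d + t + M)` decay like `4 ^ (-d)`: consecutive ones have the
ratio `(d + M) ^ 2 / ((2 d + M) (2 d + M + 1))`. -/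
lemma summable_mul_prod_rpow {a M L C : ℝ} (hM : 0 < M) (hC : 0 < C)
    (hL : L < a * Real.log 4) :
    Summable fun d : ℕ => C * Real.exp (d * L)
      * (∏ t ∈ Finset.range d, ((t : ℝ) + M) / (d + t + M)) ^ a := by
  set R : ℕ → ℝ := fun d => ∏ t ∈ Finset.range d, ((t : ℝ) + M) / (d + t + M) with hR
  set ρ : ℕ → ℝ := fun d => ((d : ℝ) + M) ^ 2 / ((2 * d + M) * (2 * d + M + 1)) with hρ
  have hRpos : ∀ d, 0 < R d := fun d => Finset.prod_pos fun t _ => by positivity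
  have hρpos : ∀ d, 0 < ρ d := fun d => by positivity
  have hratio : ∀ d, R (d + 1) = R d * ρ d := by
    intro d
    have hden : ∀ d : ℕ, 0 < ∏ t ∈ Finset.range d, ((d : ℝ) + t + M) := fun d =>
      Finset.prod_pos fun t _ => by positivity
    have h1 : (∏ t ∈ Finset.range (d + 1 + 1), ((d : ℝ) + t + M))
        = (∏ t ∈ Finset.range (d + 1), (((d + 1 : ℕ) : ℝ) + t + M)) * (d + M) := by
      rw [Finset.prod_range_succ']
      congr 1
      · refine Finset.prod_congr rfl fun t _ => ?_
        push_cast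
        ring
      · simp
    rw [Finset.prod_range_succ, Finset.prod_range_succ] at h1
    have hd := hden d
    have hd1 := hden (d + 1)
    simp only [hR, hρ, Finset.prod_div_distrib]
    rw [Finset.prod_range_succ (fun t : ℕ => (t : ℝ) + M)]
    set A := ∏ t ∈ Finset.range d, ((d : ℝ) + t + M)
    set B := ∏ t ∈ Finset.range (d + 1), (((d + 1 : ℕ) : ℝ) + t + M)
    push_cast at h1
    have h2 : A * ((2 * d + M) * (2 * d + M + 1)) = B * (d + M) := by
      rw [← h1]; ring
    rw [div_mul_div_comm, div_eq_div_iff hd1.ne' (by positivity), h2]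
    ring
  have hρlim : Tendsto ρ atTop (𝓝 (1 / 4)) := by
    have h0 : ∀ c : ℝ, Tendsto (fun d : ℕ => c / (d : ℝ)) atTop (𝓝 0) := fun c =>
      tendsto_const_div_atTop_nhds_zero_nat c
    have h1 : Tendsto (fun d : ℕ => (1 + M / (d : ℝ)) ^ 2
        / ((2 + M / d) * (2 + (M + 1) / d))) atTop (𝓝 ((1 + 0) ^ 2 / ((2 + 0) * (2 + 0)))) :=
      ((h0 M).const_add 1 |>.pow 2).div (((h0 M).const_add 2).mul ((h0 (M + 1)).const_add 2))
        (by norm_num)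
    have e : ((1 : ℝ) + 0) ^ 2 / ((2 + 0) * (2 + 0)) = 1 / 4 := by norm_num
    rw [e] at h1
    refine h1.congr' ?_
    filter_upwards [eventually_gt_atTop 0] with d hd
    have hd' : (0 : ℝ) < d := by exact_mod_cast hd
    simp only [hρ]
    field_simp
    ring
  refine summable_of_ratio_test_tendsto_lt_one (l := Real.exp L * (1 / 4) ^ a) ?_
    (Eventually.of_forall fun d => (mul_pos (mul_pos hC (Real.exp_pos _))
      (Real.rpow_pos_of_pos (hRpos d) a)).ne') ?_
  · rw [Real.rpow_def_of_pos (by norm_num), ← Real.exp_add, Real.exp_lt_one_iff, one_div,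
      Real.log_inv]
    linarith
  · have h1 := (hρlim.rpow_const (p := a) (Or.inl (by norm_num))).const_mul (Real.exp L)
    refine h1.congr fun d => ?_
    have h2 := Real.rpow_pos_of_pos (hRpos d) a
    change _ = ‖C * Real.exp ((d + 1 : ℕ) * L) * R (d + 1) ^ a‖ / ‖C * Real.exp (d * L) * R d ^ a‖
    rw [Real.norm_of_nonneg (by have := hRpos (d + 1); positivity),
      Real.norm_of_nonneg (by have := hRpos d; positivity), hratio d,
      Real.mul_rpow (hRpos d).le (hρpos d).le]
    have e : Real.exp ((d + 1 : ℕ) * L) = Real.exp (d * L) * Real.exp L := by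
      rw [← Real.exp_add]; congr 1; push_cast; ring
    rw [e]
    field_simp

lemma IsSymmetricProblem.c_ne_top (h : IsSymmetricProblem μ P b) {a : ℝ} (ha : 1 < a)
    {K : ℕ} (hK : 2 ≤ K) (hg : PowerGrowth b a K) (n : ℕ) : c P n ≠ ⊤ := by
  obtain ⟨D, hD, hle⟩ := h.exists_V_le ha hK hg
  have hB : 0 < ∏ i ∈ Finset.range n, b i := Finset.prod_pos fun i _ => h.b_pos i
  intro htop
  have := hle n
  unfold V at this
  rw [htop, ENNReal.mul_top (ENNReal.ofReal_pos.2 hB).ne', top_le_iff] at this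
  exact ENNReal.ofReal_ne_top this

/-- The ratio `(b_0 ⋯ b_{n-1}) ^ 2 / (b_0 ⋯ b_{l-1})` with `n = d + m` and `l = 2 d + m` reduces to
`b_0 ⋯ b_{m-1}` times `d` factors `b_{m+t} / b_{n+t}`. No upper bound for `b` is needed. -/
lemma PowerGrowth.prod_sq_div_le (hb : ∀ n, 0 < b n) {a : ℝ} {K : ℕ} (hK : 2 ≤ K)
    (hg : PowerGrowth b a K) {d m : ℕ} (hd : K ≤ d) :
    (∏ i ∈ Finset.range (d + m), b i) ^ 2 / ∏ i ∈ Finset.range (2 * d + m), b i ≤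
      (∏ i ∈ Finset.range m, b i) *
        (∏ t ∈ Finset.range d, ((t : ℝ) + (m + K)) / (d + t + (m + K))) ^ a := by
  have hBpos : ∀ n, 0 < ∏ i ∈ Finset.range n, b i := fun n => Finset.prod_pos fun i _ => hb i
  have hK' : (2 : ℝ) ≤ K := by exact_mod_cast hK
  have e1 : ∏ i ∈ Finset.range (d + m), b i
      = (∏ i ∈ Finset.range m, b i) * ∏ t ∈ Finset.range d, b (m + t) := by
    rw [add_comm d m, Finset.prod_range_add]
  have e2 : ∏ i ∈ Finset.range (2 * d + m), b i
      = (∏ i ∈ Finset.range (d + m), b i) * ∏ t ∈ Finset.range d, b (d + m + t) := by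
    rw [show 2 * d + m = d + m + d by ring, Finset.prod_range_add]
  have hD : 0 < ∏ t ∈ Finset.range d, b (d + m + t) := Finset.prod_pos fun i _ => hb _
  have e3 : (∏ i ∈ Finset.range (d + m), b i) ^ 2 / ∏ i ∈ Finset.range (2 * d + m), b i
      = (∏ i ∈ Finset.range m, b i) * ∏ t ∈ Finset.range d, b (m + t) / b (d + m + t) := by
    rw [e2, sq, mul_div_mul_left _ _ (hBpos (d + m)).ne', e1, Finset.prod_div_distrib,
      mul_div_assoc]
  rw [e3, ← Real.finsetProd_rpow _ _ fun t _ => by positivity]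
  refine mul_le_mul_of_nonneg_left (Finset.prod_le_prod (fun t _ =>
    (div_pos (hb _) (hb _)).le) fun t _ => ?_) (hBpos m).le
  refine (hg (d + m + t) (by omega) (m + t) (by omega)).trans (le_of_eq ?_)
  push_cast
  congr 2 <;> ring

lemma IsSymmetricProblem.propertyCSStar (h : IsSymmetricProblem μ P b) {a : ℝ} (ha : 1 < a)
    {K : ℕ} (hK : 2 ≤ K) (hg : PowerGrowth b a K) {Lu Lv : ℝ}
    (hU : ∀ᶠ n : ℕ in atTop, U μ b n ≤ Real.exp (n * Lu))
    (hV : ∀ᶠ n : ℕ in atTop, V P b n ≤ ENNReal.ofReal (Real.exp (n * Lv)))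
    (hL : Lu + 2 * Lv < a * Real.log 4) : PropertyCSStar μ P := by
  refine ⟨h.indeterminate ha hK hg, fun m => ?_⟩
  have hBpos : ∀ n, 0 < ∏ i ∈ Finset.range n, b i := fun n => Finset.prod_pos fun i _ => h.b_pos i
  have hK' : (2 : ℝ) ≤ K := by exact_mod_cast hK
  set g : ℕ → ℝ≥0∞ := fun l => c P l * ENNReal.ofReal |moment μ (l + m)| with hgdef
  have hgtop : ∀ l, g l ≠ ⊤ := fun l =>
    ENNReal.mul_ne_top (h.c_ne_top ha hK hg l) ENNReal.ofReal_ne_top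
  rw [← ENNReal.summable.sum_add_tsum_nat_add' (k := m)]
  refine ENNReal.add_lt_top.2 ⟨ENNReal.sum_lt_top.2 fun i _ => (hgtop i).lt_top, ?_⟩
  have hinj : Function.Injective fun d : ℕ => 2 * d := fun i j hij => by
    simp only at hij
    omega
  rw [← hinj.tsum_eq (f := fun j => g (j + m))]
  swap
  · intro j hj
    by_contra hne
    refine hj ?_
    have hodd : j % 2 = 1 := by
      by_contra hpar
      exact hne ⟨j / 2, by simp only; omega⟩
    have : moment μ (j + m + m) = 0 := by
      rw [show j + m + m = 2 * (j / 2 + m) + 1 by omega]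
      exact h.moment_odd _
    simp [hgdef, this]
  have hS := summable_mul_prod_rpow (a := a) (M := m + K) (L := Lu + 2 * Lv)
    (C := Real.exp (m * (Lu + Lv)) * ∏ i ∈ Finset.range m, b i) (by positivity)
    (mul_pos (Real.exp_pos _) (hBpos m)) hL
  refine tsum_lt_top_of_eventually_le hS (fun d => hgtop _) ?_
  have ht1 : Tendsto (fun d : ℕ => d + m) atTop atTop := tendsto_add_atTop_nat m
  have ht2 : Tendsto (fun d : ℕ => 2 * d + m) atTop atTop :=
    tendsto_atTop_mono (fun d => by simp only [id]; omega) tendsto_id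
  filter_upwards [ht1.eventually hU, ht2.eventually hV, eventually_ge_atTop K] with d h1 h2 h3
  have hs : moment μ (2 * d + m + m) = U μ b (d + m) * (∏ i ∈ Finset.range (d + m), b i) ^ 2 := by
    unfold U
    rw [div_mul_cancel₀ _ (pow_pos (hBpos _) 2).ne', show 2 * d + m + m = 2 * (d + m) by ring]
  have hs0 : 0 ≤ moment μ (2 * d + m + m) := by
    rw [show 2 * d + m + m = (d + m) + (d + m) by ring, h.moment_add]
    exact Finset.sum_nonneg fun _ _ => mul_self_nonneg _
  set B := ∏ i ∈ Finset.range (2 * d + m), b i with hB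
  have hBp : 0 < B := hBpos _
  have hpr := hg.prod_sq_div_le h.b_pos hK (m := m) h3
  have e : g (2 * d + m) = V P b (2 * d + m) * ENNReal.ofReal (moment μ (2 * d + m + m) / B) := by
    simp only [hgdef, V]
    rw [abs_of_nonneg hs0, mul_right_comm, ← ENNReal.ofReal_mul hBp.le, mul_div_cancel₀ _ hBp.ne',
      mul_comm]
  rw [e]
  calc _ ≤ ENNReal.ofReal (Real.exp ((2 * d + m : ℕ) * Lv))
        * ENNReal.ofReal (moment μ (2 * d + m + m) / B) := by gcongr
    _ = ENNReal.ofReal (Real.exp ((2 * d + m : ℕ) * Lv) * (moment μ (2 * d + m + m) / B)) :=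
        (ENNReal.ofReal_mul (Real.exp_pos _).le).symm
    _ ≤ _ := by
        refine ENNReal.ofReal_le_ofReal ?_
        rw [hs, mul_div_assoc]
        have e2 : Real.exp (m * (Lu + Lv)) * Real.exp (d * (Lu + 2 * Lv))
            = Real.exp ((2 * d + m : ℕ) * Lv) * Real.exp ((d + m : ℕ) * Lu) := by
          rw [← Real.exp_add, ← Real.exp_add]
          congr 1
          push_cast
          ring
        calc _ ≤ Real.exp ((2 * d + m : ℕ) * Lv) * (Real.exp ((d + m : ℕ) * Lu) *
              ((∏ i ∈ Finset.range m, b i) *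
                (∏ t ∈ Finset.range d, ((t : ℝ) + (m + K)) / (d + t + (m + K))) ^ a)) := by
              gcongr
          _ = _ := by
              rw [← mul_assoc, ← e2]
              ring

end Rates

/-! ### The limiting exponent -/

lemma exists_powerGrowth_of_lt_liminf {b : ℕ → ℝ} (hb0 : ∀ n, 0 < b n) {f : ℕ → ℝ} {n₀ : ℕ}
    (hb : ∀ n, n₀ ≤ n → b (n - 1) / b n ≤ Real.exp (-f n)) {a : ℝ} (ha : 0 < a)
    (h : (a : EReal) < liminf (fun n : ℕ => (((n : ℝ) * f n : ℝ) : EReal)) atTop) :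
    ∃ K, 2 ≤ K ∧ PowerGrowth b a K := by
  obtain ⟨N, hN⟩ := eventually_atTop.1 (eventually_lt_of_lt_liminf h)
  refine exists_powerGrowth hb0 ha (n₁ := max (max N n₀) 1) fun n hn => ?_
  have hn1 : 1 ≤ n := (le_max_right _ _).trans hn
  have hn0 : n₀ ≤ n := (le_max_right _ _).trans ((le_max_left _ _).trans hn)
  have hnN : N ≤ n := (le_max_left _ _).trans ((le_max_left _ _).trans hn)
  have h1 : a < n * f n := EReal.coe_lt_coe_iff.1 (hN n hnN)
  have hn' : (0 : ℝ) < n := by exact_mod_cast hn1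
  refine (hb n hn0).trans (Real.exp_le_exp.2 ?_)
  rw [neg_le_neg_iff, div_le_iff₀ hn']
  linarith

lemma exists_lt_uReal_lt {r L : ℝ} (hr : 0 < r) (hL : 2 * uReal r < L) :
    ∃ a, 0 < a ∧ a < r ∧ 2 * uReal a < L := by
  have hc : Tendsto (fun a => 2 * (uReal r + (Real.log (r / a) + (r - a) * (Real.log 2 / a))))
      (𝓝[<] r) (𝓝 (2 * uReal r)) := by
    have h1 : ContinuousAt
        (fun a => 2 * (uReal r + (Real.log (r / a) + (r - a) * (Real.log 2 / a)))) r := by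
      have h2 : ContinuousAt (fun a => r / a) r := continuousAt_const.div continuousAt_id hr.ne'
      have h3 : ContinuousAt (fun a => Real.log 2 / a) r :=
        continuousAt_const.div continuousAt_id hr.ne'
      have h4 : ContinuousAt (fun a => Real.log (r / a)) r :=
        h2.log (by rw [div_self hr.ne']; norm_num)
      exact continuousAt_const.mul (continuousAt_const.add
        (h4.add ((continuousAt_const.sub continuousAt_id).mul h3)))
    have h5 := h1.tendsto
    simp only [div_self hr.ne', Real.log_one, sub_self, zero_mul, add_zero] at h5
    exact h5.mono_left nhdsWithin_le_nhds
  have hev := hc.eventually (gt_mem_nhds hL)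
  have hpos : ∀ᶠ a in 𝓝[<] r, 0 < a := nhdsWithin_le_nhds (lt_mem_nhds hr)
  obtain ⟨a, h1, h2, h3⟩ := (hev.and (hpos.and eventually_mem_nhdsWithin)).exists
  refine ⟨a, h2, h3, lt_of_le_of_lt ?_ h1⟩
  have := uReal_le_add h2 (le_of_lt h3)
  linarith

lemma exists_lt_tsum_vTerm_lt {r L : ℝ} (hr : 1 < r) (hL : (∑' m, vTerm r m) / 2 < L) :
    ∃ a, 1 < a ∧ a < r ∧ (∑' m, vTerm a m) / 2 < L := by
  have hr1 : r - 1 ≠ 0 := by linarith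
  have hc : Tendsto (fun a => (r - 1) / (a - 1) * (∑' m, vTerm r m) / 2)
      (𝓝[<] r) (𝓝 ((∑' m, vTerm r m) / 2)) := by
    have h1 : ContinuousAt (fun a => (r - 1) / (a - 1) * (∑' m, vTerm r m) / 2) r :=
      ((continuousAt_const.div (continuousAt_id.sub continuousAt_const) hr1).mul
        continuousAt_const).div_const 2
    have h2 := h1.tendsto
    simp only [div_self hr1, one_mul] at h2
    exact h2.mono_left nhdsWithin_le_nhds
  have hev := hc.eventually (gt_mem_nhds hL)
  have hpos : ∀ᶠ a in 𝓝[<] r, 1 < a := nhdsWithin_le_nhds (lt_mem_nhds hr)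
  obtain ⟨a, h1, h2, h3⟩ := (hev.and (hpos.and eventually_mem_nhdsWithin)).exists
  refine ⟨a, h2, h3, lt_of_le_of_lt ?_ h1⟩
  have := tsum_vTerm_le h2 (le_of_lt h3)
  linarith

section LimitingExponent

variable {μ : Measure ℝ} {P : ℕ → ℝ[X]} {b : ℕ → ℝ} {α : EReal}

lemma u_top : u ⊤ = 0 := by simp [u]

lemma u_coe {r : ℝ} (hr : 0 < r) : u (r : EReal) = (uReal r : EReal) := by
  have h1 : ¬ ((r : EReal) ≤ 0) := not_le.2 (by exact_mod_cast hr)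
  simp [u, h1]

lemma u_of_nonpos (h : α ≤ 0) : u α = ⊤ := by
  have h1 : α ≠ ⊤ := ne_top_of_le_ne_top EReal.zero_ne_top h
  simp [u, h1, h]

lemma v_top : v ⊤ = 0 := by simp [v]

lemma v_coe {r : ℝ} (hr : 1 < r) : v (r : EReal) = ((∑' m, vTerm r m : ℝ) : EReal) := by
  have h0 : 0 ≤ ∑' m, vTerm r m := tsum_nonneg (vTerm_nonneg hr)
  simp [v, vReal_eq_tsum hr, h0]

lemma v_one : v 1 = ⊤ := by
  unfold v
  rw [if_neg (show (1 : EReal) ≠ ⊤ from EReal.coe_ne_top 1),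
    show (1 : EReal).toReal = 1 from EReal.toReal_coe 1, vReal_one]
  rfl

lemma two_mul_coe (x : ℝ) : (2 : EReal) * (x : EReal) = ((2 * x : ℝ) : EReal) := by
  rw [EReal.coe_mul]; rfl

lemma coe_div_two (x : ℝ) : (x : EReal) / 2 = ((x / 2 : ℝ) : EReal) := by
  rw [EReal.coe_div]; rfl

lemma k_coe {r : ℝ} (hr : 1 < r) : k (r : EReal) =
    ENNReal.ofReal (Real.exp (2 * uReal r + ∑' m, vTerm r m - r * Real.log 4)) := by
  have h0 : (0 : ℝ) < r := by linarith
  unfold k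
  rw [if_neg (EReal.coe_ne_top r), u_coe h0, v_coe hr, two_mul_coe, ← EReal.coe_add,
    EReal.exp_coe, ← ENNReal.ofReal_mul (by positivity), EReal.toReal_coe,
    Real.rpow_def_of_pos (by norm_num), ← Real.exp_add]
  congr 2
  ring

/-- The exponential rate of `U_n` at the limiting exponent `α`. -/
lemma eventually_U_le_of_lt (h : IsSymmetricProblem μ P b)
    (hG : ∀ a : ℝ, 0 < a → (a : EReal) < α → ∃ K, 2 ≤ K ∧ PowerGrowth b a K)
    {L : ℝ} (hL : 2 * u α < L) : ∀ᶠ n : ℕ in atTop, U μ b n ≤ Real.exp (n * L) := by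
  induction α with
  | bot =>
    rw [u_of_nonpos bot_le, EReal.mul_top_of_pos (by norm_num)] at hL
    exact absurd hL not_top_lt
  | top =>
    rw [u_top, mul_zero] at hL
    have hL0 : 0 < L := by exact_mod_cast hL
    have ha : 0 < 2 / (L / 4) := by positivity
    obtain ⟨K, hK, hg⟩ := hG _ ha (EReal.coe_lt_top _)
    refine h.eventually_U_le ha hK hg ?_
    have := uReal_le_of_large (by positivity : 0 < L / 4) le_rfl
    linarith
  | coe r =>
    rcases le_or_gt r 0 with hr | hr
    · rw [u_of_nonpos (by exact_mod_cast hr), EReal.mul_top_of_pos (by norm_num)] at hL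
      exact absurd hL not_top_lt
    · rw [u_coe hr, two_mul_coe, EReal.coe_lt_coe_iff] at hL
      obtain ⟨a, ha, har, haL⟩ := exists_lt_uReal_lt hr hL
      obtain ⟨K, hK, hg⟩ := hG a ha (EReal.coe_lt_coe_iff.2 har)
      exact h.eventually_U_le ha hK hg haL

/-- The exponential rate of `V_n` at the limiting exponent `α`. -/
lemma eventually_V_le_of_lt (h : IsSymmetricProblem μ P b)
    (hG : ∀ a : ℝ, 0 < a → (a : EReal) < α → ∃ K, 2 ≤ K ∧ PowerGrowth b a K) (hα : 1 < α)
    {L : ℝ} (hL : v α / 2 < L) :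
    ∀ᶠ n : ℕ in atTop, V P b n ≤ ENNReal.ofReal (Real.exp (n * L)) := by
  induction α with
  | bot => simp at hα
  | top =>
    rw [v_top, EReal.zero_div] at hL
    have hL0 : 0 < L := by exact_mod_cast hL
    set S := ∑' m : ℕ, 1 / ((m + 1 : ℕ) : ℝ) ^ 2 with hS
    have hS0 : 0 ≤ S := tsum_nonneg fun m => by positivity
    have ha : 1 < 1 + (S + 1) / L := by
      have : 0 < (S + 1) / L := by positivity
      linarith
    obtain ⟨K, hK, hg⟩ := hG (1 + (S + 1) / L) (by linarith) (EReal.coe_lt_top _)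
    refine h.eventually_V_le ha hK hg ?_
    have h1 := tsum_vTerm_le_div ha
    rw [← hS, add_sub_cancel_left, one_div_div, div_mul_eq_mul_div] at h1
    have h2 : L * S / (S + 1) ≤ L := by
      rw [div_le_iff₀ (by positivity)]
      nlinarith
    linarith
  | coe r =>
    have hr : 1 < r := by exact_mod_cast hα
    rw [v_coe hr, coe_div_two, EReal.coe_lt_coe_iff] at hL
    obtain ⟨a, ha, har, haL⟩ := exists_lt_tsum_vTerm_lt hr hL
    obtain ⟨K, hK, hg⟩ := hG a (by linarith) (EReal.coe_lt_coe_iff.2 har)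
    exact h.eventually_V_le ha hK hg haL

lemma limsup_rpow_le_exp {x : ℕ → ℝ≥0∞} {r : EReal} (hr : r ≠ ⊥)
    (h : ∀ L : ℝ, r < L → ∀ᶠ n : ℕ in atTop, x n ≤ ENNReal.ofReal (Real.exp (n * L))) :
    limsup (fun n : ℕ => x n ^ (1 / (n : ℝ))) atTop ≤ EReal.exp r := by
  induction r with
  | bot => exact absurd rfl hr
  | top => simp
  | coe r =>
    rw [EReal.exp_coe]
    exact limsup_rpow_le fun L hL => h L (EReal.coe_lt_coe_iff.2 hL)

lemma two_mul_u_ne_bot (hα : 0 ≤ α) : 2 * u α ≠ ⊥ := by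
  induction α with
  | bot => simp at hα
  | top => simp [u_top]
  | coe r =>
    rcases le_or_gt r 0 with hr | hr
    · rw [u_of_nonpos (by exact_mod_cast hr), EReal.mul_top_of_pos (by norm_num)]
      simp
    · rw [u_coe hr, two_mul_coe]
      exact EReal.coe_ne_bot _

lemma k_lt_one (hα : ((1.68746 : ℝ) : EReal) ≤ α) : k α < 1 := by
  induction α with
  | bot => simp at hα
  | top => simp [k]
  | coe r =>
    have hr : 1.68746 ≤ r := EReal.coe_le_coe_iff.1 hα
    rw [k_coe (by linarith), ENNReal.ofReal_lt_one, Real.exp_lt_one_iff]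
    linarith [two_mul_uReal_add_lt hr]

lemma propertyCSStar_of_k_lt_one (h : IsSymmetricProblem μ P b)
    (hG : ∀ a : ℝ, 0 < a → (a : EReal) < α → ∃ K, 2 ≤ K ∧ PowerGrowth b a K) (hα : 1 < α)
    (hk : k α < 1) : PropertyCSStar μ P := by
  -- It suffices to find rates of `U` and `V` and an exponent `a < α` with a strict inequality.
  obtain ⟨a, Lu, Lv, ha, haα, hu, hv, hL⟩ : ∃ a Lu Lv : ℝ, 1 < a ∧ (a : EReal) < α ∧
      2 * u α < Lu ∧ v α / 2 < Lv ∧ Lu + 2 * Lv < a * Real.log 4 := by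
    induction α with
    | bot => simp at hα
    | top =>
      have h4 : 1 < Real.log 4 := by
        rw [show (4 : ℝ) = 2 ^ 2 by norm_num, Real.log_pow]
        have := Real.log_two_gt_d9
        norm_num
        linarith
      refine ⟨2, 1 / 2, 1 / 2, by norm_num, EReal.coe_lt_top _, ?_, ?_, by linarith⟩
      · rw [u_top, mul_zero]
        exact EReal.coe_pos.2 (by norm_num)
      · rw [v_top, EReal.zero_div]
        exact EReal.coe_pos.2 (by norm_num)
    | coe r =>
      have hr : 1 < r := by exact_mod_cast hα
      rw [k_coe hr, ENNReal.ofReal_lt_one, Real.exp_lt_one_iff] at hk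
      have h4 : 0 < Real.log 4 := Real.log_pos (by norm_num)
      set δ := r * Real.log 4 - (2 * uReal r + ∑' m, vTerm r m) with hδ
      have hδ0 : 0 < δ := by linarith
      obtain ⟨a, ha1, har⟩ := exists_between (max_lt hr (show r - δ / (4 * Real.log 4) < r by
        have : 0 < δ / (4 * Real.log 4) := by positivity
        linarith))
      rw [max_lt_iff] at ha1
      refine ⟨a, 2 * uReal r + δ / 4, (∑' m, vTerm r m) / 2 + δ / 8, ha1.1,
        EReal.coe_lt_coe_iff.2 har, ?_, ?_, ?_⟩
      · rw [u_coe (by linarith), two_mul_coe, EReal.coe_lt_coe_iff]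
        linarith
      · rw [v_coe hr, coe_div_two, EReal.coe_lt_coe_iff]
        linarith
      · have h5 : (r - a) * Real.log 4 < δ / 4 := by
          have : r - a < δ / (4 * Real.log 4) := by linarith [ha1.2]
          calc (r - a) * Real.log 4 < δ / (4 * Real.log 4) * Real.log 4 := by gcongr
            _ = δ / 4 := by field_simp
        linarith
  obtain ⟨K, hK, hg⟩ := hG a (by linarith) haα
  exact h.propertyCSStar ha hK hg (eventually_U_le_of_lt h hG hu)
    (eventually_V_le_of_lt h hG hα hv) hL

end LimitingExponent

end SymMoment

theorem theorem1p7 (μ : Measure ℝ) (P : ℕ → ℝ[X]) (b : ℕ → ℝ)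
    (hμ : SymMoment.IsSymmetricProblem μ P b)
    (f : ℕ → ℝ) (n₀ : ℕ) (hn₀ : 1 ≤ n₀)
    (hf : ∀ n, n₀ ≤ n → 0 < f n)
    (hb : ∀ n, n₀ ≤ n → b (n - 1) / b n ≤ Real.exp (-f n))
    (α : EReal)
    (hα : α = liminf (fun n : ℕ => (((n : ℝ) * f n : ℝ) : EReal)) atTop) :
    limsup (fun n : ℕ => ENNReal.ofReal (SymMoment.U μ b n) ^ (1 / (n : ℝ))) atTop
        ≤ EReal.exp (2 * SymMoment.u α) ∧
    (1 < α → SymMoment.Indeterminate μ) ∧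
    (1 ≤ α →
      limsup (fun n : ℕ => SymMoment.V P b n ^ (1 / (n : ℝ))) atTop
        ≤ EReal.exp (SymMoment.v α / 2)) ∧
    (1 < α → SymMoment.k α < 1 → SymMoment.PropertyCSStar μ P) ∧
    (((1.68746 : ℝ) : EReal) ≤ α → SymMoment.k α < 1) := by
  have hG : ∀ a : ℝ, 0 < a → (a : EReal) < α → ∃ K, 2 ≤ K ∧ SymMoment.PowerGrowth b a K :=
    fun a ha haα => SymMoment.exists_powerGrowth_of_lt_liminf hμ.b_pos hb ha (hα ▸ haα)
  have hα0 : 0 ≤ α := by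
    rw [hα]
    refine le_liminf_of_le (by isBoundedDefault) ?_
    filter_upwards [eventually_ge_atTop n₀] with n hn
    have := hf n hn
    exact EReal.coe_nonneg.2 (by positivity)
  refine ⟨?_, fun h1 => ?_, fun h1 => ?_, fun h1 hk => ?_, SymMoment.k_lt_one⟩
  · refine SymMoment.limsup_rpow_le_exp (SymMoment.two_mul_u_ne_bot hα0) fun L hL => ?_
    exact (SymMoment.eventually_U_le_of_lt hμ hG hL).mono fun n hn => ENNReal.ofReal_le_ofReal hn
  · obtain ⟨a, ha1, haα⟩ := EReal.lt_iff_exists_real_btwn.1 h1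
    have ha : 1 < a := by exact_mod_cast ha1
    obtain ⟨K, hK, hg⟩ := hG a (by linarith) haα
    exact hμ.indeterminate ha hK hg
  · rcases h1.eq_or_lt with rfl | h1
    · rw [SymMoment.v_one, EReal.top_div_of_pos_ne_top (by norm_num)
        (show (2 : EReal) ≠ ⊤ from EReal.coe_ne_top 2)]
      simp
    · refine SymMoment.limsup_rpow_le_exp ?_ fun L hL =>
        SymMoment.eventually_V_le_of_lt hμ hG h1 hL
      induction α with
      | bot => simp at h1
      | top => simp [SymMoment.v_top]
      | coe r =>
        have hr : 1 < r := by exact_mod_cast h1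
        rw [SymMoment.v_coe hr, SymMoment.coe_div_two]
        exact EReal.coe_ne_bot _
  · exact SymMoment.propertyCSStar_of_k_lt_one hμ hG h1 hk
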